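/- **Setting.** Let $f\in\mathbb C\{z,w\}$ have order $m\ge 2$ at $0$ and be mini-regular in $z$, i.e. $f=H_m+H_{m+1}+\cdots$ with $H_k$ homogeneous of degree $k$ and $H_m(1,0)\neq 0$. Put $\Delta_f=\det\begin{pmatrix}f_{zz}&f_{zw}&f_z\\ f_{wz}&f_{ww}&f_w\\ f_z&f_w&0\end{pmatrix}$ and $K=2|\Delta_f|^2/(|f_z|^2+|f_w|^2)^3$. Let $\mathbb CP^1_*$ be the set of image germs $\alpha_*$ of holomorphic map germs $\alpha:(\mathbb C,0)\to(\mathbb C^2,0)$, $\alpha\not\equiv0$. If $K(\alpha(t))=as^L+\cdots$ with $a>0$, $L\in\mathbb Q$, $s$ the arc length of $\alpha$, put $K_*(\alpha_*)=a\delta^L$ and $L_*(\alpha_*)=L$; if $K\equiv0$ along $\alpha$, put $K_*(\alpha_*)=0\,\delta^\infty$ and $L_*(\alpha_*)=\infty$. $K_*(\alpha_*)$ and $L_*(\alpha_*)$ are undefined if $\operatorname{Grad} f\equiv 0$ along $\alpha$. Order these symbols by $a\delta^L>a'\delta^{L'}$ iff $L<L'$, or $L=L'$ and $a>a'$. Let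 $\mathbb D_1$ be the set of convergent fractional power series $\alpha(y)$ (with exponents in $\frac1N\mathbb Z$ for some $N$) of order $O_y(\alpha)\ge1$. For $\alpha\in\mathbb D_1$ with least such $N$, let $\alpha_*$ be the image germ of $t\mapsto(\alpha(t^N),t^N)$; these germs form $\mathbb C_*$, the set of germs with tangent $\ne[1:0]$. The contact order of $\alpha_*,\beta_*\in\mathbb C_*$ is the maximum of $O_y(\alpha'-\beta')$ over the conjugates $\alpha'$ of $\alpha$ and $\beta'$ of $\beta$ ($\infty$ if $\alpha_*=\beta_*$); for two germs with tangent $[1:0]$ it is computed in the same way after interchanging $z$ and $w$; for germs with different tangents it is $1$. Let $\mathcal H_e(A)$ and $\mathcal H_{e^+}(A)$ be the sets of germs in $\mathbb CP^1_*$ whose contact order with $A$ is $\ge e$ and $>e$, respectively. For $\beta\in\mathbb D_1$ let $\mathcal H_e(\beta_*,r)=\{\mu_*: \mu\in\mathbb D_1,\ \mu=\beta+cy^e+(\text{terms of order}>e),\ |c|\le r\}$. "Generic $u\in\mathbb C$" means all but finitely many $u$. *Tablelands and bumps.* Let $e\ge1$ be rational. Let $L_*^{grc}(\mathcal H_e(\alpha_*))$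 be the value of $L_*((\alpha+uy^e)_*)$ for generic $u$ (with $z,w$ interchanged if $\alpha_*$ has tangent $[1:0]$). $\mathcal H_e(\alpha_*)$ is a curvature tableland if (1) $L_*(\beta_*)$ is defined and $\ge L_*^{grc}(\mathcal H_e(\alpha_*))$ for all $\beta_*\in\mathcal H_e(\alpha_*)$, and (2) if $e>1$, there is a rational $e'$ with $1\le e'<e$ such that $L_*(\nu_*)$ is defined and $>L_*^{grc}(\mathcal H_e(\alpha_*))$ for all $\nu_*\in\mathcal H_{e'}(\alpha_*)\setminus\mathcal H_e(\alpha_*)$. If $\mathcal H_e$ is a curvature tableland, $\beta\in\mathbb D_1$ and $\beta_*\in\mathcal H_e$, then $\mathcal H_{e^+}(\beta_*)$ is an A'Campo bump if for some $\epsilon>0$ one has $K_*(\beta_*)\ge K_*(\mu_*)$ for all $\mu_*\in\mathcal H_e(\beta_*,\epsilon)$. *Canyons.* A polar is a $\gamma\in\mathbb D_1$ with $f_z(\gamma(y),y)=0$. Its gradient degree $d=d_{gr}(\gamma)\in[1,\infty]$ is the smallest rational $e\ge1$ such that $\|\operatorname{Grad}f(\gamma(y),y)\|$ and $\|\operatorname{Grad}f(\gamma(y)+uy^e,y)\|$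 have the same order in $y$ for generic $u$ ($\infty$ if there is none). Its gradient canyons are $\mathcal G(\gamma)=\{\alpha\in\mathbb D_1: O_y(\alpha-\gamma)\ge d\}$ and $\mathcal G_*(\gamma_*)=\mathcal H_d(\gamma_*)$. Both are called minimal if for every polar $\gamma'$, $\mathcal G(\gamma')\subseteq\mathcal G(\gamma)$ implies $\mathcal G(\gamma')=\mathcal G(\gamma)$. For $d<\infty$ the number $L_\gamma\in\mathbb Q$ and the function $R_\gamma:\mathbb C\to\mathbb R$, $R_\gamma\not\equiv0$, are given by: for every $u\in\mathbb C$, $K(\gamma(y)+uy^d,y)=2R_\gamma(u)s^{2L_\gamma}+\cdots$, i.e. $K/(2s^{2L_\gamma})\to R_\gamma(u)$, with $s$ the arc length along $\gamma+uy^d$. **Theorem A.** (a) The minimal gradient canyons $\mathcal G_*(\gamma_*)$ of finite gradient degree are exactly the curvature tablelands. (b) Let $\gamma$ be a polar with $d=d_{gr}(\gamma)<\infty$ and $\mathcal G(\gamma)$ minimal. Then $L_\gamma$ and $R_\gamma$ exist, and if $R_\gamma$ has a local maximum at $c\in\mathbb C$, then $\mathcal H_{d^+}((\gamma+cy^d)_*)$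 is an A'Campo bump. (c) Every A'Campo bump is of the form described in (b). -/

import Mathlib

open Filter Topology Asymptotics

namespace ACampo

noncomputable section

/-! ### Partial derivatives and the curvature of the level curves -/

/-- The partial derivative `g_z` of a function of `(z, w)`. -/
def dz (g : ℂ × ℂ → ℂ) (p : ℂ × ℂ) : ℂ := deriv (fun z : ℂ => g (z, p.2)) p.1

/-- The partial derivative `g_w` of a function of `(z, w)`. -/
def dw (g : ℂ × ℂ → ℂ) (p : ℂ × ℂ) : ℂ := deriv (fun w : ℂ => g (p.1, w)) p.2

/-- `f` is a holomorphic germ at `0 ∈ ℂ²` of order `m`, mini-regular in `z`: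
`f = H_m + H_{m+1} + ⋯` with `H_m(1,0) ≠ 0`.  (The bound says that `f` has no terms of degree
less than `m`, and then `H_m(1,0)` is the coefficient of `z ^ m` in `f(z,0)`.) -/
def IsMiniRegular (f : ℂ × ℂ → ℂ) (m : ℕ) : Prop :=
  AnalyticAt ℂ f 0 ∧ f =O[𝓝 0] (fun p : ℂ × ℂ => ‖p‖ ^ m) ∧
    analyticOrderAt (fun z : ℂ => f (z, 0)) 0 = (m : ℕ∞)

/-- The bordered Hessian determinant `Δ_f`. -/
def Δ (f : ℂ × ℂ → ℂ) (p : ℂ × ℂ) : ℂ :=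
  Matrix.det !![dz (dz f) p, dw (dz f) p, dz f p;
                dz (dw f) p, dw (dw f) p, dw f p;
                dz f p,      dw f p,      0]

/-- The (negative of the usual) Gaussian curvature at `p` of the level curve of `f` through `p`;
meaningful where the gradient of `f` does not vanish. -/
def K (f : ℂ × ℂ → ℂ) (p : ℂ × ℂ) : ℝ :=
  2 * ‖Δ f p‖ ^ 2 / (‖dz f p‖ ^ 2 + ‖dw f p‖ ^ 2) ^ 3

/-! ### Holomorphic arcs and their image germs -/

/-- A holomorphic map germ `(ℂ,0) → (ℂ²,0)`, not identically zero. -/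
def IsArc (φ : ℂ → ℂ × ℂ) : Prop :=
  AnalyticAt ℂ φ 0 ∧ φ 0 = 0 ∧ ¬ (∀ᶠ t in 𝓝 (0 : ℂ), φ t = 0)

/-- The image set germ of an arc.  The germ at `0` of a set `S` is encoded by the filter `𝓝[S] 0`
(two sets have the same germ iff these filters agree); for a non-constant holomorphic arc `φ` and
a small disc `U` around `0`, the filter `𝓝[φ '' U] 0` is `Filter.map φ (𝓝 0)`. -/
def image (φ : ℂ → ℂ × ℂ) : Filter (ℂ × ℂ) := Filter.map φ (𝓝 0)

/-- The enriched Riemann sphere `ℂP¹_*`: the set of all image germs of arcs. -/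
def CPstar : Set (Filter (ℂ × ℂ)) := {A | ∃ φ, IsArc φ ∧ A = image φ}

/-- The Euclidean arc length of `φ` from `0` to the parameter `t`, along the path
`r ↦ φ (r t)`, `0 ≤ r ≤ 1`. -/
def arcLength (φ : ℂ → ℂ × ℂ) (t : ℂ) : ℝ :=
  ∫ r in (0 : ℝ)..1, Real.sqrt (‖deriv (fun x : ℝ => (φ (x * t)).1) r‖ ^ 2 +
    ‖deriv (fun x : ℝ => (φ (x * t)).2) r‖ ^ 2)

/-- The curvature computed along the arc `φ` is `a δ^L`.  Either `L = ∞`, `a = 0`, and the curvature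
vanishes identically along `φ`, or `L` is a rational number, `a > 0` and `K(φ(t)) = a s^L + ⋯`,
where `s = s(t)` is the arc length.  There is no value if the gradient of `f` vanishes
identically along `φ`. -/
def HasCurv (f : ℂ × ℂ → ℂ) (φ : ℂ → ℂ × ℂ) (L : WithTop ℚ) (a : ℝ) : Prop :=
  (∀ᶠ t in 𝓝[≠] (0 : ℂ), dz f (φ t) ≠ 0 ∨ dw f (φ t) ≠ 0) ∧
  ((L = ⊤ ∧ a = 0 ∧ ∀ᶠ t in 𝓝[≠] (0 : ℂ), K f (φ t) = 0) ∨
   (∃ q : ℚ, L = (q : WithTop ℚ) ∧ 0 < a ∧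
      Tendsto (fun t : ℂ => K f (φ t) / arcLength φ t ^ (q : ℝ)) (𝓝[≠] 0) (𝓝 a)))

/-- The curvature function on `ℂP¹_*`: `K_*(A) = a δ^L`. -/
def HasK (f : ℂ × ℂ → ℂ) (A : Filter (ℂ × ℂ)) (L : WithTop ℚ) (a : ℝ) : Prop :=
  ∃ φ, IsArc φ ∧ A = image φ ∧ HasCurv f φ L a

/-- `L_*(A) = L`. -/
def HasL (f : ℂ × ℂ → ℂ) (A : Filter (ℂ × ℂ)) (L : WithTop ℚ) : Prop :=
  ∃ a, HasK f A L a

/-- The symbol `a δ^L`, in the lexicographic order for which `a δ^L > a' δ^{L'}` iff `L < L'`, or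
`L = L'` and `a > a'`. -/
def symb (L : WithTop ℚ) (a : ℝ) : (WithTop ℚ)ᵒᵈ ×ₗ ℝ := toLex (OrderDual.toDual L, a)

/-! ### Newton-Puiseux coordinates -/

/-- The Puiseux multiplicity: the least `N ≥ 1` such that all exponents are in `(1/N) ℤ`
(and `0` if there is none). -/
def mpuis (α : HahnSeries ℚ ℂ) : ℕ :=
  sInf {N : ℕ | 0 < N ∧ ∀ q : ℚ, α.coeff q ≠ 0 → ∃ n : ℤ, q = n / N}

/-- The convergent fractional power series of order at least `1` in `y`. -/
def D1 : Set (HahnSeries ℚ ℂ) :=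
  {α | 1 ≤ α.orderTop ∧ 0 < mpuis α ∧
    ∃ r : ℝ, 0 < r ∧ Summable (fun n : ℕ => ‖α.coeff ((n : ℚ) / mpuis α)‖ * r ^ n)}

/-- The arc `t ↦ (α(t^N), t^N)`, with `N` the Puiseux multiplicity of `α ∈ D1`. -/
def arc (α : HahnSeries ℚ ℂ) (t : ℂ) : ℂ × ℂ :=
  (∑' n : ℕ, α.coeff ((n : ℚ) / mpuis α) * t ^ n, t ^ mpuis α)

/-- The term `u y^e`. -/
def term (u : ℂ) (e : ℚ) : HahnSeries ℚ ℂ := HahnSeries.single e u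

/-- The germ `α_*` (these germs, for `α ∈ D1`, form the chart `ℂ_*` of germs with tangent
different from `[1:0]`). -/
def germ (α : HahnSeries ℚ ℂ) : Filter (ℂ × ℂ) := image (arc α)

/-- The germ given by `α` when the coordinates `z`, `w` are interchanged.  For `α ∈ D1` of order
greater than `1` these are the germs with tangent `[1:0]`, that is, those not in `ℂ_*`. -/
def germ' (α : HahnSeries ℚ ℂ) : Filter (ℂ × ℂ) := image (fun t => (arc α t).swap)

/-- The `k`-th conjugate.  A coefficient at `y^(n/N)` is multiplied by `exp(2πi/N)^(k n)`. -/
def conj (k : ℕ) (α : HahnSeries ℚ ℂ) : HahnSeries ℚ ℂ where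
  coeff q := Complex.exp (2 * Real.pi * Complex.I * k * (q : ℂ)) * α.coeff q
  isPWO_support' := α.isPWO_support.mono (fun q hq => by
    rw [Function.mem_support] at hq
    rw [HahnSeries.mem_support]
    exact right_ne_zero_of_mul hq)

/-- `c` is the largest of the orders of the differences of the conjugates of `α` and `β`. -/
def IsMaxConjOrder (α β : HahnSeries ℚ ℂ) (c : WithTop ℚ) : Prop :=
  IsGreatest {o | ∃ i < mpuis α, ∃ j < mpuis β, o = (conj i α - conj j β).orderTop} c

/-- The contact order of `A` and `B` is `c`.  It is computed from Newton-Puiseux coordinates if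
both germs are in `ℂ_*`, from those with `z`, `w` interchanged if both have the tangent `[1:0]`,
and it is `1` in the remaining case, where the tangents are different. -/
def HasContact (A B : Filter (ℂ × ℂ)) (c : WithTop ℚ) : Prop :=
  ∃ α ∈ D1, ∃ β ∈ D1,
    (A = germ α ∧ B = germ β ∧ IsMaxConjOrder α β c) ∨
    (1 < α.orderTop ∧ 1 < β.orderTop ∧ A = germ' α ∧ B = germ' β ∧ IsMaxConjOrder α β c) ∨
    (1 < α.orderTop ∧ A = germ' α ∧ B = germ β ∧ c = 1) ∨
    (1 < β.orderTop ∧ A = germ α ∧ B = germ' β ∧ c = 1)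

/-- The horn subspace of order `e` centred at `A`. -/
def horn (e : WithTop ℚ) (A : Filter (ℂ × ℂ)) : Set (Filter (ℂ × ℂ)) :=
  {B | B ∈ CPstar ∧ ∃ c, HasContact A B c ∧ e ≤ c}

/-- The horn subspace of order `e⁺` centred at `A`. -/
def hornPlus (e : WithTop ℚ) (A : Filter (ℂ × ℂ)) : Set (Filter (ℂ × ℂ)) :=
  {B | B ∈ CPstar ∧ ∃ c, HasContact A B c ∧ e < c}

/-- The horn interval of order `e` and radius `r` centred at `β_*`:
all `μ_*` with `μ = β + (c y^e + ⋯)`, `|c| ≤ r`. -/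
def hornInterval (e : ℚ) (β : HahnSeries ℚ ℂ) (r : ℝ) : Set (Filter (ℂ × ℂ)) :=
  {M | ∃ μ ∈ D1, M = germ μ ∧
    ∃ c : ℂ, ‖c‖ ≤ r ∧ (e : WithTop ℚ) < (μ - β - term c e).orderTop}

/-! ### Curvature tablelands and bumps -/

/-- The generic value of `L_*` on the horn subspace of order `e` centred at `A` is `L`: it is the
value at `η_*`, `η = α + u y^e`, for all but finitely many `u`, where `α` is a coordinate of `A`. -/
def HasGenericL (f : ℂ × ℂ → ℂ) (e : ℚ) (A : Filter (ℂ × ℂ)) (L : WithTop ℚ) : Prop :=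
  ∃ α ∈ D1,
    (A = germ α ∧ ∀ᶠ u : ℂ in cofinite, HasL f (germ (α + term u e)) L) ∨
    (1 < α.orderTop ∧ A = germ' α ∧ ∀ᶠ u : ℂ in cofinite, HasL f (germ' (α + term u e)) L)

/-- The horn subspace of order `e` centred at `A` is a curvature tableland. -/
def IsTablelandAt (f : ℂ × ℂ → ℂ) (e : ℚ) (A : Filter (ℂ × ℂ)) : Prop :=
  1 ≤ e ∧ ∃ L, HasGenericL f e A L ∧
    (∀ B ∈ horn e A, ∃ L', HasL f B L' ∧ L ≤ L') ∧
    (1 < e → ∃ e' : ℚ, 1 ≤ e' ∧ e' < e ∧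
      ∀ B ∈ horn e' A \ horn e A, ∃ L', HasL f B L' ∧ L < L')

/-- `S` is a curvature tableland. -/
def IsTableland (f : ℂ × ℂ → ℂ) (S : Set (Filter (ℂ × ℂ))) : Prop :=
  ∃ (e : ℚ) (A : Filter (ℂ × ℂ)), S = horn e A ∧ IsTablelandAt f e A

/-- `S` is an A'Campo bump: it is the horn subspace of order `e⁺` of some `β_* ∈ ℂ_*` which lies in
a curvature tableland of order `e` and maximizes `K_*` on a horn interval of order `e` around it. -/
def IsBump (f : ℂ × ℂ → ℂ) (S : Set (Filter (ℂ × ℂ))) : Prop :=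
  ∃ (e : ℚ) (A : Filter (ℂ × ℂ)), IsTablelandAt f e A ∧
    ∃ β ∈ D1, germ β ∈ horn e A ∧ S = hornPlus e (germ β) ∧
      ∃ ε : ℝ, 0 < ε ∧ ∀ M ∈ hornInterval e β ε, ∃ L a L' a',
        HasK f (germ β) L a ∧ HasK f M L' a' ∧ symb L' a' ≤ symb L a

/-! ### Polars and gradient canyons -/

/-- `γ` is a polar: a Newton-Puiseux root of `f_z`. -/
def IsPolar (f : ℂ × ℂ → ℂ) (γ : HahnSeries ℚ ℂ) : Prop :=
  γ ∈ D1 ∧ ∀ᶠ t in 𝓝 (0 : ℂ), dz f (arc γ t) = 0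

/-- The order in `y` of `g(α(y), y)`: the order in `t` along `arc α`, divided by the Puiseux
multiplicity. -/
def orderAlong (g : ℂ × ℂ → ℂ) (α : HahnSeries ℚ ℂ) : WithTop ℚ :=
  WithTop.map (fun n : ℕ => (n : ℚ) / mpuis α) (analyticOrderAt (fun t => g (arc α t)) 0)

/-- The order in `y` of `‖Grad f(α(y), y)‖`. -/
def gradOrder (f : ℂ × ℂ → ℂ) (α : HahnSeries ℚ ℂ) : WithTop ℚ :=
  min (orderAlong (dz f) α) (orderAlong (dw f) α)

open Classical in
/-- The gradient degree of `γ`: the smallest `e ≥ 1` such that `‖Grad f‖` has the same order along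
`γ` and along `γ + u y^e` for generic `u`; it is `∞` if there is no such `e`. -/
def gradDeg (f : ℂ × ℂ → ℂ) (γ : HahnSeries ℚ ℂ) : WithTop ℚ :=
  if h : ∃ d : ℚ, IsLeast {e : ℚ | 1 ≤ e ∧
      ∀ᶠ u : ℂ in cofinite, gradOrder f γ = gradOrder f (γ + term u e)} d
  then (h.choose : WithTop ℚ) else ⊤

/-- The gradient canyon of `γ` in `D1`. -/
def canyon (f : ℂ × ℂ → ℂ) (γ : HahnSeries ℚ ℂ) : Set (HahnSeries ℚ ℂ) :=
  {α | α ∈ D1 ∧ gradDeg f γ ≤ (α - γ).orderTop}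

/-- The gradient canyon of `γ_*`. -/
def canyonStar (f : ℂ × ℂ → ℂ) (γ : HahnSeries ℚ ℂ) : Set (Filter (ℂ × ℂ)) :=
  horn (gradDeg f γ) (germ γ)

/-- The canyons of `γ` and of `γ_*` are minimal. -/
def IsMinimal (f : ℂ × ℂ → ℂ) (γ : HahnSeries ℚ ℂ) : Prop :=
  ∀ γ', IsPolar f γ' → canyon f γ' ⊆ canyon f γ → canyon f γ' = canyon f γ

/-- `R` is the function `R_γ` and `L` the number `L_γ` of a polar `γ` of gradient degree `d`: the
curvature along `γ + u y^d` is `2 R(u) s^{2L} + ⋯` for every `u`, where `s` is the arc length, and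
`R` does not vanish identically.  (This determines `L` and `R`.) -/
def IsR (f : ℂ × ℂ → ℂ) (γ : HahnSeries ℚ ℂ) (d L : ℚ) (R : ℂ → ℝ) : Prop :=
  (∀ u : ℂ, Tendsto (fun t : ℂ => K f (arc (γ + term u d) t) /
      (2 * arcLength (arc (γ + term u d)) t ^ (2 * (L : ℝ)))) (𝓝[≠] 0) (𝓝 (R u))) ∧
  ∃ u, R u ≠ 0

end

end ACampo

open ACampo

/-!
The curvature `K = 2 |Δ_f|² / ‖Grad f‖⁶` is studied along arcs `y ↦ (γ (y) + u y ^ e, y)`.  After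
`y = t ^ M` such an arc is holomorphic (`IsRep`), and since the arc length is asymptotic to the
distance from the origin (`tendsto_arcLength_div_nrm`), the symbol of the curvature can be read
off from `K / nrm ^ L` on the punctured germ (`hasK_iff`).

**Newton polygons.** The substitution `h = t ^ E u` (`exists_scaling`) extracts the leading term
of `f (γ + u y ^ e, y) - f (γ, y)`, a polynomial `p (u)`.  The structure `IsNewton` collects what
it tells about `f`, `f_z` and `f_zz` along all arcs `γ + u y ^ e + ⋯` at once, and
`exists_isNewton` shows that it exists for every `e ≥ 1`.  The roots of `p'` are the initial
coefficients of polars, by the Newton-Puiseux theorem (`exists_puiseux_root`).  Let `φ` be the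
generic order of `f_z` and `q` the generic order of the gradient, which is the minimum of `φ` and
`ord f (γ, y) - 1`.

**The curvature along an arc.** The derivatives of `f`, `f_z` and `f_w` along the arc give `f_w`,
`f_zw` and `f_ww`, so that the leading coefficient of `Δ_f` is a polynomial in those of `f`, `f_z`
and `f_zz` (`exists_grad_Δ_along`).  Hence `K s ^ (2 e)` has a finite limit (`tendsto_K_along`) as
soon as the order of the gradient along the arc is the generic one.

**Canyons are tablelands.** For a polar `γ`, the gradient degree `d` is the slope where `φ`
becomes equal to the order of the gradient along `γ` (`IsPolar.φ_eq`).  On a minimal canyon the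
order of the gradient is constant, since otherwise there would be a polar with a smaller canyon.
So `K s ^ (2 d)` tends to `2 R (u)` on all of the canyon, and `R` has only finitely many zeros:
the leading coefficient of `Δ_f` is a polynomial in `u` whose order at `0` is one less than that
of `p'` (`IsPolar.exists_curvature`, `finite_leadΔ_eq_zero`).  Just outside of the canyon the
supporting lines of the Newton polygon touch it at one vertex only, and `K s ^ (2 e)` is bounded
for the order of contact `e < d`, so that the order of `K` exceeds `- 2 d`
(`IsPolar.exists_lt_hasL`).

**Tablelands are canyons.** If the order of the gradient is constant on a horn larger than `ℋ_e`,
then a generic perturbation which leaves `ℋ_e` increases neither the order of `Δ_f` nor that of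
`K` (`false_of_gradOrder_const`).  This is what happens if `ℋ_e` contains no polar, if it contains
a polar of gradient degree less than `e`, or if its tangent is `[1:0]`.  A polar of gradient
degree `d > e` in `ℋ_e` gives an arc with `L = - 2 d`, less than the generic value.  So a
tableland of order `e > 1` contains a polar of gradient degree `e`
(`exists_polar_of_isTablelandAt`); if `e = 1`, then all polars have gradient degree `1`.

**Bumps.** On a minimal canyon the symbol of `γ + u y ^ d + ⋯` is `2 R (u) δ ^ (- 2 d)` where
`R (u) ≠ 0`, and smaller where `R (u) = 0`.  So local maxima of `K_*` are local maxima of `R`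
(`HornLimit.isBump`, `HornLimit.isLocalMax`).
-/

namespace ACampo

/-! ### Partial derivatives of analytic functions of two variables -/

section PartialDerivatives

variable {g : ℂ × ℂ → ℂ} {p : ℂ × ℂ}

theorem hasDerivAt_comp_pair {a b : ℂ → ℂ} {a' b' t : ℂ} (hg : AnalyticAt ℂ g (a t, b t))
    (ha : HasDerivAt a a' t) (hb : HasDerivAt b b' t) :
    HasDerivAt (fun s => g (a s, b s))
      (fderiv ℂ g (a t, b t) (1, 0) * a' + fderiv ℂ g (a t, b t) (0, 1) * b') t := by
  have h := hg.differentiableAt.hasFDerivAt.comp_hasDerivAt t (ha.prodMk hb)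
  have e : ((a', b') : ℂ × ℂ) = a' • ((1, 0) : ℂ × ℂ) + b' • ((0, 1) : ℂ × ℂ) := by
    ext <;> simp
  rw [e, map_add, map_smul, map_smul, smul_eq_mul, smul_eq_mul, mul_comm a', mul_comm b'] at h
  exact h

theorem dz_eq_fderiv (hg : AnalyticAt ℂ g p) : dz g p = fderiv ℂ g p (1, 0) := by
  have := hasDerivAt_comp_pair (t := p.1) (a := id) (b := fun _ => p.2) hg (hasDerivAt_id _)
    (hasDerivAt_const _ _)
  simpa [dz] using this.deriv

theorem dw_eq_fderiv (hg : AnalyticAt ℂ g p) : dw g p = fderiv ℂ g p (0, 1) := by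
  have := hasDerivAt_comp_pair (t := p.2) (a := fun _ => p.1) (b := id) hg
    (hasDerivAt_const _ _) (hasDerivAt_id _)
  simpa [dw] using this.deriv

/-- The chain rule along an arc. -/
theorem hasDerivAt_arc {a b : ℂ → ℂ} {a' b' t : ℂ} (hg : AnalyticAt ℂ g (a t, b t))
    (ha : HasDerivAt a a' t) (hb : HasDerivAt b b' t) :
    HasDerivAt (fun s => g (a s, b s)) (dz g (a t, b t) * a' + dw g (a t, b t) * b') t := by
  rw [dz_eq_fderiv hg, dw_eq_fderiv hg]
  exact hasDerivAt_comp_pair hg ha hb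

theorem analyticAt_dz (hg : AnalyticAt ℂ g p) : AnalyticAt ℂ (dz g) p := by
  have h : AnalyticAt ℂ (fun x => fderiv ℂ g x (1, 0)) p :=
    ((ContinuousLinearMap.apply ℂ ℂ ((1, 0) : ℂ × ℂ)).analyticAt _).comp hg.fderiv
  refine h.congr ?_
  filter_upwards [hg.eventually_analyticAt] with x hx using (dz_eq_fderiv hx).symm

theorem analyticAt_dw (hg : AnalyticAt ℂ g p) : AnalyticAt ℂ (dw g) p := by
  have h : AnalyticAt ℂ (fun x => fderiv ℂ g x (0, 1)) p :=
    ((ContinuousLinearMap.apply ℂ ℂ ((0, 1) : ℂ × ℂ)).analyticAt _).comp hg.fderiv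
  refine h.congr ?_
  filter_upwards [hg.eventually_analyticAt] with x hx using (dw_eq_fderiv hx).symm

theorem analyticAt_iterate_dz (hg : AnalyticAt ℂ g p) (k : ℕ) : AnalyticAt ℂ (dz^[k] g) p := by
  induction k with
  | zero => exact hg
  | succ k ih => rw [Function.iterate_succ_apply']; exact analyticAt_dz ih

theorem _root_.Filter.EventuallyEq.dz {g₁ g₂ : ℂ × ℂ → ℂ} (h : g₁ =ᶠ[𝓝 p] g₂) :
    dz g₁ =ᶠ[𝓝 p] dz g₂ := by
  filter_upwards [h.eventually_nhds] with x hx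
  refine Filter.EventuallyEq.deriv_eq ?_
  have : Tendsto (fun z : ℂ => (z, x.2)) (𝓝 x.1) (𝓝 x) := by
    have : ContinuousAt (fun z : ℂ => (z, x.2)) x.1 := by fun_prop
    exact this
  exact this.eventually hx

theorem dw_dz_comm (hg : AnalyticAt ℂ g p) : dw (dz g) p = dz (dw g) p := by
  have h1 : dz g =ᶠ[𝓝 p] fun x => fderiv ℂ g x (1, 0) := by
    filter_upwards [hg.eventually_analyticAt] with x hx using dz_eq_fderiv hx
  have h2 : dw g =ᶠ[𝓝 p] fun x => fderiv ℂ g x (0, 1) := by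
    filter_upwards [hg.eventually_analyticAt] with x hx using dw_eq_fderiv hx
  rw [dw_eq_fderiv (analyticAt_dz hg), dz_eq_fderiv (analyticAt_dw hg), h1.fderiv_eq, h2.fderiv_eq]
  have hd : DifferentiableAt ℂ (fderiv ℂ g) p := hg.fderiv.differentiableAt
  rw [fderiv_clm_apply hd (differentiableAt_const _),
    fderiv_clm_apply hd (differentiableAt_const _)]
  have hs : IsSymmSndFDerivAt ℂ g p :=
    (hg.contDiffAt (n := ⊤)).isSymmSndFDerivAt (by simp)
  simpa using hs (0, 1) (1, 0)

theorem differentiableAt_slice (hg : AnalyticAt ℂ g p) :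
    DifferentiableAt ℂ (fun z : ℂ => g (z, p.2)) p.1 :=
  (hasDerivAt_comp_pair (a := id) (b := fun _ => p.2) (t := p.1) hg (hasDerivAt_id _)
    (hasDerivAt_const _ _)).differentiableAt

theorem hasDerivAt_slice (hg : AnalyticAt ℂ g p) :
    HasDerivAt (fun z : ℂ => g (z, p.2)) (dz g p) p.1 :=
  (differentiableAt_slice hg).hasDerivAt

theorem dz_comp_shift (g : ℂ × ℂ → ℂ) (τ σ : ℂ → ℂ) (p : ℂ × ℂ) :
    dz (fun p => g (τ p.2 + p.1, σ p.2)) p = dz g (τ p.2 + p.1, σ p.2) := by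
  simp only [dz]
  exact deriv_comp_const_add (f := fun z => g (z, σ p.2)) (τ p.2) p.1

theorem iterate_dz_comp_shift (g : ℂ × ℂ → ℂ) (τ σ : ℂ → ℂ) (k : ℕ) :
    dz^[k] (fun p => g (τ p.2 + p.1, σ p.2)) = fun p => (dz^[k] g) (τ p.2 + p.1, σ p.2) := by
  induction k with
  | zero => rfl
  | succ k ih =>
    rw [Function.iterate_succ_apply', ih, Function.iterate_succ_apply']
    funext p
    exact dz_comp_shift _ τ σ p

end PartialDerivatives

/-! ### Division by the first variable and Taylor expansion -/

section Division

/-- The projection of `ℂ²` onto the second axis. -/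
noncomputable def sndAxis : ℂ × ℂ →L[ℂ] ℂ × ℂ :=
  (ContinuousLinearMap.inr ℂ ℂ ℂ).comp (ContinuousLinearMap.snd ℂ ℂ ℂ)

theorem norm_sndAxis_le : ‖sndAxis‖ ≤ 1 := by
  refine ContinuousLinearMap.opNorm_le_bound _ zero_le_one fun x => ?_
  simp [sndAxis, Prod.norm_def]

/-- If `p` is the power series of `g`, this is the power series of
`(g (h, t) - g (0, t)) / h`.  The difference `p_{n+1}(x, …, x) - p_{n+1}(y, …, y)`, where
`x = (h, t)` and `y = (0, t)`, is telescoped. -/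
noncomputable def divSeries (p : FormalMultilinearSeries ℂ (ℂ × ℂ) ℂ) :
    FormalMultilinearSeries ℂ (ℂ × ℂ) ℂ := fun n =>
  ∑ i : Fin (n + 1), ((p (n + 1)).curryMid i (1, 0)).compContinuousLinearMap
    fun j => if j.castSucc < i then sndAxis else ContinuousLinearMap.id ℂ _

theorem norm_divSeries_le (p : FormalMultilinearSeries ℂ (ℂ × ℂ) ℂ) (n : ℕ) :
    ‖divSeries p n‖ ≤ (n + 1) * ‖p (n + 1)‖ := by
  refine (norm_sum_le _ _).trans ?_
  have : ∀ i ∈ (Finset.univ : Finset (Fin (n + 1))),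
      ‖((p (n + 1)).curryMid i (1, 0)).compContinuousLinearMap
        fun j => if j.castSucc < i then sndAxis else ContinuousLinearMap.id ℂ _‖ ≤
      ‖p (n + 1)‖ := by
    intro i _
    refine (ContinuousMultilinearMap.norm_compContinuousLinearMap_le _ _).trans ?_
    have h1 : ‖(p (n + 1)).curryMid i (1, 0)‖ ≤ ‖p (n + 1)‖ := by
      refine (ContinuousLinearMap.le_opNorm _ _).trans ?_
      rw [ContinuousMultilinearMap.norm_curryMid]
      simp [Prod.norm_def]
    have h2 : ∏ j : Fin n, ‖(if j.castSucc < i then sndAxis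
        else ContinuousLinearMap.id ℂ (ℂ × ℂ))‖ ≤ 1 := by
      refine Finset.prod_le_one (fun _ _ => norm_nonneg _) fun j _ => ?_
      split_ifs
      · exact norm_sndAxis_le
      · exact ContinuousLinearMap.norm_id_le
    calc _ ≤ ‖p (n + 1)‖ * 1 := by gcongr
      _ = _ := mul_one _
  refine (Finset.sum_le_sum this).trans ?_
  simp

theorem mul_divSeries_apply (p : FormalMultilinearSeries ℂ (ℂ × ℂ) ℂ) (n : ℕ) (x : ℂ × ℂ) :
    x.1 * divSeries p n (fun _ => x) =
      p (n + 1) (fun _ => x) - p (n + 1) (fun _ => (0, x.2)) := by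
  -- The arguments are replaced one after the other; the sum of the differences telescopes.
  set a : ℕ → ℂ := fun i => p (n + 1) (fun j => if j.val < i then ((0, x.2) : ℂ × ℂ) else x) with ha
  have h0 : p (n + 1) (fun _ => x) = a 0 := by simp [ha]
  have h1 : p (n + 1) (fun _ => (0, x.2)) = a (n + 1) := by
    simp only [ha]
    congr 1
    funext j
    rw [if_pos j.isLt]
  rw [h0, h1, ← Finset.sum_range_sub', Finset.sum_range, divSeries,
    sum_apply, Finset.mul_sum]
  refine Finset.sum_congr rfl fun i _ => ?_
  have key : ∀ v : ℂ × ℂ, (Function.update (fun j : Fin (n + 1) =>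
      if j.val < i.val then ((0, x.2) : ℂ × ℂ) else x) i v) =
      i.insertNth v (fun j => if j.castSucc < i then ((0, x.2) : ℂ × ℂ) else x) := by
    intro v
    funext j
    refine Fin.succAboveCases i ?_ (fun k => ?_) j
    · simp
    · rw [Fin.insertNth_apply_succAbove, Function.update_of_ne (Fin.succAbove_ne i k)]
      by_cases hk : k.castSucc < i
      · rw [if_pos hk, Fin.succAbove_of_castSucc_lt _ _ hk, if_pos]
        exact hk
      · rw [if_neg hk, Fin.succAbove_of_le_castSucc _ _ (not_lt.mp hk), if_neg]
        have := not_lt.mp hk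
        rw [Fin.le_def] at this
        simp at this ⊢
        omega
  have e1 : a i = p (n + 1) (i.insertNth x
      (fun j => if j.castSucc < i then ((0, x.2) : ℂ × ℂ) else x)) := by
    rw [← key, ha]
    rw [Function.update_eq_self_iff.mpr]
    simp
  have e2 : a (i + 1) = p (n + 1) (i.insertNth (0, x.2)
      (fun j => if j.castSucc < i then ((0, x.2) : ℂ × ℂ) else x)) := by
    rw [← key]
    simp only [ha]
    congr 1
    funext j
    by_cases hj : j = i
    · subst hj; simp
    · have : j.val ≠ i.val := fun h => hj (Fin.ext h)
      rw [Function.update_of_ne hj]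
      have : (j.val < i.val + 1) ↔ j.val < i.val := by omega
      simp only [this]
  rw [e1, e2]
  have hx : x = x.1 • ((1, 0) : ℂ × ℂ) + (0, x.2) := by ext <;> simp
  simp only [← ContinuousMultilinearMap.curryMid_apply]
  rw [← sub_apply, ← map_sub]
  have hx' : x - (0, x.2) = x.1 • ((1, 0) : ℂ × ℂ) := by ext <;> simp
  rw [hx', map_smul, smul_apply, smul_eq_mul]
  congr 1
  rw [ContinuousMultilinearMap.compContinuousLinearMap_apply]
  congr 1
  funext j
  split_ifs <;> simp [sndAxis]

/-- The `n + 1` summands of `divSeries p n` only cost a factor of `2` in the radius of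
convergence. -/
theorem divSeries_radius_pos {p : FormalMultilinearSeries ℂ (ℂ × ℂ) ℂ} (hp : 0 < p.radius) :
    0 < (divSeries p).radius := by
  obtain ⟨C, r, hC, hr, h⟩ : ∃ C r : ℝ, 0 < C ∧ 0 < r ∧ ∀ n, ‖p n‖ ≤ C * r ^ n := by
    obtain ⟨C, r, hC, hr, h⟩ := p.le_mul_pow_of_radius_pos hp
    exact ⟨C, r, hC, hr, h⟩
  have hr2 : 0 < (2 * r)⁻¹ := by positivity
  have hr3 : ((2 * r)⁻¹.toNNReal : ℝ) = (2 * r)⁻¹ := Real.coe_toNNReal _ hr2.le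
  refine lt_of_lt_of_le ?_ ((divSeries p).le_radius_of_bound (C * r)
    (r := (2 * r)⁻¹.toNNReal) fun n => ?_)
  · rw [ENNReal.coe_pos]
    exact Real.toNNReal_pos.mpr hr2
  · have hn : ((n : ℝ) + 1) ≤ 2 ^ n := by exact_mod_cast Nat.lt_two_pow_self
    rw [hr3]
    calc ‖divSeries p n‖ * ((2 * r)⁻¹) ^ n
        ≤ ((n + 1) * (C * r ^ (n + 1))) * ((2 * r)⁻¹) ^ n := by
          gcongr
          exact (norm_divSeries_le p n).trans (by gcongr; exact h _)
      _ ≤ (2 ^ n * (C * r ^ (n + 1))) * ((2 * r)⁻¹) ^ n := by gcongr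
      _ = C * r := by
          rw [inv_pow, mul_pow]
          field_simp
          ring

/-- Division by the first variable. -/
theorem exists_eq_add_fst_mul {g : ℂ × ℂ → ℂ} (hg : AnalyticAt ℂ g 0) :
    ∃ H, AnalyticAt ℂ H 0 ∧ ∀ᶠ x in 𝓝 (0 : ℂ × ℂ), g x = g (0, x.2) + x.1 * H x := by
  obtain ⟨p, r, hp⟩ := hg
  have hrad := divSeries_radius_pos (lt_of_lt_of_le hp.r_pos hp.r_le)
  have hq := (divSeries p).hasFPowerSeriesOnBall hrad
  refine ⟨_, hq.analyticAt, ?_⟩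
  have hmem : Metric.eball (0 : ℂ × ℂ) (min r (divSeries p).radius) ∈ 𝓝 (0 : ℂ × ℂ) :=
    Metric.eball_mem_nhds 0 (lt_min hp.r_pos hrad)
  filter_upwards [hmem] with x hx
  have hx1 : x ∈ Metric.eball (0 : ℂ × ℂ) r :=
    Metric.eball_subset_eball (min_le_left _ _) hx
  have hx2 : x ∈ Metric.eball (0 : ℂ × ℂ) (divSeries p).radius :=
    Metric.eball_subset_eball (min_le_right _ _) hx
  have hy1 : ((0, x.2) : ℂ × ℂ) ∈ Metric.eball (0 : ℂ × ℂ) r := by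
    rw [Metric.mem_eball, edist_zero_right] at hx1 ⊢
    refine lt_of_le_of_lt ?_ hx1
    rw [← ofReal_norm, ← ofReal_norm]
    refine ENNReal.ofReal_le_ofReal ?_
    simp [Prod.norm_def]
  have s1 := hp.hasSum hx1
  have s2 := hp.hasSum hy1
  have s3 := (hq.hasSum hx2).mul_left x.1
  simp only [zero_add] at s1 s2 s3
  have s4 := s1.sub s2
  rw [hasSum_nat_add_iff' 1 |>.symm] at s4
  simp only [Finset.range_one, Finset.sum_singleton] at s4
  have e0 : p 0 (fun _ => x) = p 0 (fun _ => (0, x.2)) := by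
    congr 1
    funext i
    exact i.elim0
  rw [e0, sub_self, sub_zero] at s4
  simp only [mul_divSeries_apply] at s3
  have := s3.unique s4
  rw [this]
  ring

end Division

@[fun_prop]
theorem analyticAt_fst_pair (x : ℂ × ℂ) : AnalyticAt ℂ (fun y : ℂ × ℂ => y.1) x := analyticAt_fst

@[fun_prop]
theorem analyticAt_snd_pair (x : ℂ × ℂ) : AnalyticAt ℂ (fun y : ℂ × ℂ => y.2) x := analyticAt_snd

section Taylor

/-- The `k`-th Taylor coefficient of `g` in the first variable, as a function of the second. -/
noncomputable def taylorCoeff (g : ℂ × ℂ → ℂ) (k : ℕ) (t : ℂ) : ℂ :=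
  (dz^[k] g) (0, t) / (k.factorial : ℂ)

theorem analyticAt_pair {g : ℂ × ℂ → ℂ} {a b : ℂ → ℂ} {t : ℂ} (hg : AnalyticAt ℂ g (a t, b t))
    (ha : AnalyticAt ℂ a t) (hb : AnalyticAt ℂ b t) : AnalyticAt ℂ (fun s => g (a s, b s)) t :=
  hg.comp₂ ha hb

theorem analyticAt_taylorCoeff {g : ℂ × ℂ → ℂ} (hg : AnalyticAt ℂ g 0) (k : ℕ) :
    AnalyticAt ℂ (taylorCoeff g k) 0 := by
  have := analyticAt_iterate_dz hg k
  exact (analyticAt_pair (a := fun _ => 0) (b := fun t => t) (t := 0) this analyticAt_const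
    analyticAt_id).div_const

theorem iterate_dz_succ_fst_mul {g H : ℂ × ℂ → ℂ} (hH : AnalyticAt ℂ H 0)
    (h : ∀ᶠ x in 𝓝 (0 : ℂ × ℂ), g x = g (0, x.2) + x.1 * H x) (k : ℕ) :
    dz^[k + 1] g =ᶠ[𝓝 0] fun x => x.1 * (dz^[k + 1] H) x + (k + 1) * (dz^[k] H) x := by
  induction k with
  | zero =>
    have h1 : dz g =ᶠ[𝓝 0] dz (fun x => g (0, x.2) + x.1 * H x) := Filter.EventuallyEq.dz h
    filter_upwards [h1, hH.eventually_analyticAt] with x hx hHx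
    simp only [zero_add, Function.iterate_one, Function.iterate_zero, id, Nat.cast_zero]
    rw [hx]
    have := ((hasDerivAt_id x.1).mul (hasDerivAt_slice hHx)).const_add (g (0, x.2))
    have e : dz (fun x => g (0, x.2) + x.1 * H x) x = _ := this.deriv
    rw [e]
    simp
    ring
  | succ k ih =>
    have h1 := ih.dz
    filter_upwards [h1, (analyticAt_iterate_dz hH k).eventually_analyticAt,
      (analyticAt_iterate_dz hH (k + 1)).eventually_analyticAt] with x hx hx1 hx2
    rw [Function.iterate_succ_apply', hx]
    have := ((hasDerivAt_id x.1).mul (hasDerivAt_slice hx2)).add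
      ((hasDerivAt_slice hx1).const_mul ((k : ℂ) + 1))
    have e : dz (fun x => x.1 * (dz^[k + 1] H) x + (k + 1) * (dz^[k] H) x) x = _ := this.deriv
    rw [e, Function.iterate_succ_apply' dz (k + 1) H]
    simp only [Function.iterate_succ_apply' dz k H, id]
    push_cast
    ring

/-- Taylor's formula in the first variable, with an analytic remainder. -/
theorem exists_taylor {g : ℂ × ℂ → ℂ} (hg : AnalyticAt ℂ g 0) (n : ℕ) :
    ∃ U, AnalyticAt ℂ U 0 ∧ ∀ᶠ x in 𝓝 (0 : ℂ × ℂ),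
      g x = ∑ k ∈ Finset.range n, taylorCoeff g k x.2 * x.1 ^ k + x.1 ^ n * U x := by
  induction n generalizing g with
  | zero => exact ⟨g, hg, by simp⟩
  | succ n ih =>
    obtain ⟨H, hH, h⟩ := exists_eq_add_fst_mul hg
    obtain ⟨U, hU, h'⟩ := ih hH
    refine ⟨U, hU, ?_⟩
    have hax : Tendsto (fun x : ℂ × ℂ => ((0, x.2) : ℂ × ℂ)) (𝓝 0) (𝓝 0) := by
      have : ContinuousAt (fun x : ℂ × ℂ => ((0, x.2) : ℂ × ℂ)) 0 := by fun_prop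
      exact this
    have hc : ∀ k, ∀ᶠ x in 𝓝 (0 : ℂ × ℂ), taylorCoeff g (k + 1) x.2 = taylorCoeff H k x.2 := by
      intro k
      filter_upwards [hax.eventually (iterate_dz_succ_fst_mul hH h k)] with x hx
      simp only [taylorCoeff]
      rw [hx, zero_mul, zero_add, Nat.factorial_succ]
      push_cast
      have : (k.factorial : ℂ) ≠ 0 := by exact_mod_cast k.factorial_ne_zero
      have : (k : ℂ) + 1 ≠ 0 := by exact_mod_cast k.succ_ne_zero
      field_simp
    have hc' : ∀ᶠ x in 𝓝 (0 : ℂ × ℂ), ∀ k ∈ Finset.range n,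
        taylorCoeff g (k + 1) x.2 = taylorCoeff H k x.2 :=
      (eventually_all_finset _).mpr fun k _ => hc k
    filter_upwards [h, h', hc'] with x h1 h2 h3
    have e0 : taylorCoeff g 0 x.2 = g (0, x.2) := by simp [taylorCoeff]
    have e1 : ∑ k ∈ Finset.range n, taylorCoeff g (k + 1) x.2 * x.1 ^ (k + 1) =
        ∑ k ∈ Finset.range n, x.1 * (taylorCoeff H k x.2 * x.1 ^ k) :=
      Finset.sum_congr rfl fun k hk => by rw [h3 k hk]; ring
    rw [h1, h2, Finset.sum_range_succ', mul_add, Finset.mul_sum, e0, e1]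
    ring

/-- The substitution `h = t ^ E u`: `g (t ^ E u, t) = t ^ b G (u, t)`, with `b` the height of the
supporting line of co-slope `E` of the Newton polygon of `g`, and `G (u, 0)` the polynomial
which belongs to the edge on this line. -/
theorem exists_scaling {g : ℂ × ℂ → ℂ} (hg : AnalyticAt ℂ g 0) {E : ℕ} (hE : 1 ≤ E) {k₀ : ℕ}
    (hk₀ : analyticOrderAt (taylorCoeff g k₀) 0 ≠ ⊤) :
    ∃ (b : ℕ) (p : Polynomial ℂ) (G : ℂ × ℂ → ℂ), p ≠ 0 ∧ (∀ u, AnalyticAt ℂ G (u, 0)) ∧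
      (∀ u, G (u, 0) = p.eval u) ∧
      (∀ u₀, ∀ᶠ x in 𝓝 ((u₀, 0) : ℂ × ℂ), g (x.2 ^ E * x.1, x.2) = x.2 ^ b * G x) ∧
      (∀ k, (b : ℕ∞) ≤ analyticOrderAt (taylorCoeff g k) 0 + (k * E : ℕ)) ∧
      ∀ k, p.coeff k ≠ 0 ↔ analyticOrderAt (taylorCoeff g k) 0 + (k * E : ℕ) = b := by
  classical
  have hex : ∃ b : ℕ, ∃ k, analyticOrderAt (taylorCoeff g k) 0 + (k * E : ℕ) = b := by
    obtain ⟨o, ho⟩ := ENat.ne_top_iff_exists.mp hk₀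
    exact ⟨o + k₀ * E, k₀, by rw [← ho]; push_cast; rfl⟩
  -- `b` is the least of the numbers `ord g_k + k E`, where `g_k` are the Taylor coefficients.
  set b := Nat.find hex with hb
  have hmin : ∀ k, (b : ℕ∞) ≤ analyticOrderAt (taylorCoeff g k) 0 + (k * E : ℕ) := by
    intro k
    by_cases hk : analyticOrderAt (taylorCoeff g k) 0 = ⊤
    · simp [hk]
    · obtain ⟨o, ho⟩ := ENat.ne_top_iff_exists.mp hk
      rw [← ho]
      have : b ≤ o + k * E := Nat.find_min' hex ⟨k, by rw [← ho]; push_cast; rfl⟩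
      exact_mod_cast this
  obtain ⟨k₁, hk₁⟩ := Nat.find_spec hex
  rw [← hb] at hk₁
  have han : ∀ k, AnalyticAt ℂ (fun t => t ^ (k * E) * taylorCoeff g k t) 0 := fun k =>
    (analyticAt_id.pow _).mul (analyticAt_taylorCoeff hg k)
  have hord : ∀ k, analyticOrderAt (fun t => t ^ (k * E) * taylorCoeff g k t) 0 =
      analyticOrderAt (taylorCoeff g k) 0 + (k * E : ℕ) := by
    intro k
    have h1 : AnalyticAt ℂ (fun t : ℂ => t ^ (k * E)) 0 := by fun_prop
    have := analyticOrderAt_mul h1 (analyticAt_taylorCoeff hg k)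
    have h2 : analyticOrderAt (fun t : ℂ => t ^ (k * E)) 0 = (k * E : ℕ) := by
      have := analyticOrderAt_centeredMonomial (𝕜 := ℂ) (z₀ := 0) (n := k * E)
      simpa [Pi.pow_def] using this
    rw [h2, add_comm] at this
    exact this
  have hfac : ∀ k, ∃ c : ℂ → ℂ, AnalyticAt ℂ c 0 ∧
      ∀ᶠ t in 𝓝 (0 : ℂ), t ^ (k * E) * taylorCoeff g k t = t ^ b * c t := by
    intro k
    obtain ⟨c, hc, h⟩ := (natCast_le_analyticOrderAt (han k)).mp ((hord k).symm ▸ hmin k)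
    exact ⟨c, hc, by simpa using h⟩
  choose c hc hceq using hfac
  have hc0 : ∀ k, c k 0 ≠ 0 ↔ analyticOrderAt (taylorCoeff g k) 0 + (k * E : ℕ) = b := by
    intro k
    have h1 : AnalyticAt ℂ (fun t : ℂ => t ^ b) 0 := by fun_prop
    have h2 : analyticOrderAt (fun t : ℂ => t ^ b) 0 = b := by
      have := analyticOrderAt_centeredMonomial (𝕜 := ℂ) (z₀ := 0) (n := b)
      simpa [Pi.pow_def] using this
    have h3 := analyticOrderAt_mul h1 (hc k)
    rw [← hord k, analyticOrderAt_congr (hceq k)]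
    change analyticOrderAt (fun t => t ^ b * c k t) 0 = _ at h3
    rw [h3, h2, ← (hc k).analyticOrderAt_eq_zero]
    constructor
    · intro h; simp [h]
    · intro h
      by_contra hne
      obtain h' | h' := eq_or_ne (analyticOrderAt (c k) 0) ⊤
      · simp [h'] at h
      · obtain ⟨o, ho⟩ := ENat.ne_top_iff_exists.mp h'
        rw [← ho] at h hne
        have : b + o = b := by exact_mod_cast h
        apply hne
        have : o = 0 := by omega
        simp [this]
  -- Taylor's formula of order `n`, with `n E > b`: the remainder does not contribute to `G (u, 0)`.
  set n := b + 1 with hn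
  have hnE : b + 1 ≤ n * E := by nlinarith
  obtain ⟨U, hU, hT⟩ := exists_taylor hg n
  set p : Polynomial ℂ := ∑ k ∈ Finset.range n, Polynomial.C (c k 0) * Polynomial.X ^ k with hp
  have hpc : ∀ k, p.coeff k = if k < n then c k 0 else 0 := by
    intro k
    simp [hp, Polynomial.coeff_X_pow]
  have hpk : ∀ k, p.coeff k ≠ 0 ↔ analyticOrderAt (taylorCoeff g k) 0 + (k * E : ℕ) = b := by
    intro k
    rw [hpc]
    split_ifs with hk
    · exact hc0 k
    · simp only [ne_eq, not_true_eq_false, false_iff]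
      intro h
      have h1 : ((k * E : ℕ) : ℕ∞) ≤ b := h ▸ le_add_self
      have h2 : k * E ≤ b := by exact_mod_cast h1
      have : b < k * E := by nlinarith
      omega
  refine ⟨b, p, fun x => ∑ k ∈ Finset.range n, c k x.2 * x.1 ^ k +
    x.2 ^ (n * E - b) * x.1 ^ n * U (x.2 ^ E * x.1, x.2), ?_, ?_, ?_, ?_, hmin, hpk⟩
  · intro h0
    exact (hpk k₁).mpr hk₁ (by simp [h0])
  · intro u
    have h1 : AnalyticAt ℂ (fun x : ℂ × ℂ => U (x.2 ^ E * x.1, x.2)) (u, 0) := by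
      refine AnalyticAt.comp₂ (f := fun x : ℂ × ℂ => x.2 ^ E * x.1) (g := fun x => x.2)
        (h := U) ?_ (by fun_prop) (by fun_prop)
      simpa [show E ≠ 0 by omega, ← Prod.zero_eq_mk] using hU
    have h2 : AnalyticAt ℂ (fun x : ℂ × ℂ => ∑ k ∈ Finset.range n, c k x.2 * x.1 ^ k) (u, 0) := by
      refine Finset.analyticAt_fun_sum _ fun k _ => ?_
      refine AnalyticAt.mul ?_ (by fun_prop)
      exact AnalyticAt.fun_comp (g := c k) (f := fun x : ℂ × ℂ => x.2) (hc k) analyticAt_snd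
    exact h2.add ((by fun_prop : AnalyticAt ℂ
      (fun x : ℂ × ℂ => x.2 ^ (n * E - b) * x.1 ^ n) (u, 0)).mul h1)
  · intro u
    have : n * E - b ≠ 0 := by omega
    simp [hp, Polynomial.eval_finsetSum, this]
  · intro u₀
    have ht : Tendsto (fun x : ℂ × ℂ => ((x.2 ^ E * x.1, x.2) : ℂ × ℂ)) (𝓝 (u₀, 0)) (𝓝 0) := by
      have : ContinuousAt (fun x : ℂ × ℂ => ((x.2 ^ E * x.1, x.2) : ℂ × ℂ)) (u₀, 0) := by fun_prop
      simpa [ContinuousAt, show E ≠ 0 by omega, ← Prod.zero_eq_mk] using this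
    have ht2 : Tendsto (fun x : ℂ × ℂ => x.2) (𝓝 (u₀, 0)) (𝓝 0) := by
      have : ContinuousAt (fun x : ℂ × ℂ => x.2) ((u₀, 0) : ℂ × ℂ) := by fun_prop
      exact this
    filter_upwards [ht.eventually hT,
      (eventually_all_finset (Finset.range n)).mpr fun k _ => ht2.eventually (hceq k)] with x h1 h2
    rw [h1, mul_add, Finset.mul_sum]
    congr 1
    · refine Finset.sum_congr rfl fun k hk => ?_
      rw [mul_pow, ← pow_mul, mul_comm E k, ← mul_assoc, mul_comm (taylorCoeff g k x.2),
        h2 k hk]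
      ring
    · have : x.2 ^ b * x.2 ^ (n * E - b) = x.2 ^ (n * E) := by
        rw [← pow_add]; congr 1; omega
      rw [← mul_assoc, ← mul_assoc, this, mul_pow, ← pow_mul, mul_comm E n]

end Taylor

/-! ### Puiseux roots -/

section PuiseuxRoots

theorem iterate_dz_eq_iteratedDeriv (g : ℂ × ℂ → ℂ) (k : ℕ) (p : ℂ × ℂ) :
    (dz^[k] g) p = iteratedDeriv k (fun z => g (z, p.2)) p.1 := by
  induction k generalizing p with
  | zero => simp
  | succ k ih =>
    rw [Function.iterate_succ_apply', iteratedDeriv_succ]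
    simp only [dz, ih]

theorem exists_analytic_root {G : ℂ × ℂ → ℂ} {u₀ : ℂ} (hG : AnalyticAt ℂ G (u₀, 0))
    (h0 : G (u₀, 0) = 0) (h1 : dz G (u₀, 0) ≠ 0) :
    ∃ u : ℂ → ℂ, AnalyticAt ℂ u 0 ∧ u 0 = u₀ ∧ ∀ᶠ t in 𝓝 (0 : ℂ), G (u t, t) = 0 := by
  set F : ℂ × ℂ → ℂ := fun x => G (x.2, x.1) with hF
  have hFa : AnalyticAt ℂ F (0, u₀) :=
    AnalyticAt.comp₂ (h := G) (f := fun x : ℂ × ℂ => x.2) (g := fun x => x.1) hG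
      analyticAt_snd analyticAt_fst
  have cdf : ContDiffAt ℂ (⊤ : WithTop ℕ∞) F (0, u₀) := hFa.contDiffAt
  have hd : (fderiv ℂ F (0, u₀)) (0, 1) = dz G (u₀, 0) := by
    rw [← dw_eq_fderiv hFa]
    rfl
  have hinv : (fderiv ℂ F (0, u₀) ∘L ContinuousLinearMap.inr ℂ ℂ ℂ).IsInvertible := by
    refine ⟨ContinuousLinearEquiv.unitsEquivAut ℂ (Units.mk0 _ h1), ?_⟩
    ext
    simp [hd]
  refine ⟨cdf.implicitFunction (by simp) hinv, ?_, ?_, ?_⟩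
  · exact (cdf.contDiffAt_implicitFunction (by simp) hinv).analyticAt
  · exact cdf.implicitFunction_apply_self (by simp) hinv
  · have := cdf.eventually_apply_implicitFunction (by simp) hinv
    filter_upwards [this] with t ht
    exact ht.trans h0

theorem analyticOrderAt_polynomial_eval {p : Polynomial ℂ} (hp : p ≠ 0) (r : ℂ) :
    analyticOrderAt (fun u => p.eval u) r = p.rootMultiplicity r := by
  have ha : AnalyticAt ℂ (fun u => p.eval u) r := (Polynomial.differentiable p).analyticAt r
  rw [ha.analyticOrderAt_eq_natCast]
  obtain ⟨q, hq, hq'⟩ := p.exists_eq_pow_rootMultiplicity_mul_and_not_dvd hp r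
  refine ⟨fun u => q.eval u, (Polynomial.differentiable q).analyticAt r, ?_, ?_⟩
  · intro h
    exact hq' (Polynomial.dvd_iff_isRoot.mpr h)
  · refine Eventually.of_forall fun u => ?_
    conv_lhs => rw [hq]
    simp

theorem analyticOrderAt_comp_pow {g : ℂ → ℂ} (hg : AnalyticAt ℂ g 0) {N : ℕ} (hN : N ≠ 0) :
    analyticOrderAt (fun s => g (s ^ N)) 0 = analyticOrderAt g 0 * N := by
  have h1 : AnalyticAt ℂ (fun s : ℂ => s ^ N) 0 := by fun_prop
  have h2 : (fun s : ℂ => s ^ N) 0 = 0 := by simp [hN]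
  have := AnalyticAt.analyticOrderAt_comp (f := g) (g := fun s : ℂ => s ^ N) (z₀ := 0)
    (by simpa [hN] using hg) h1
  simp only [h2, sub_zero] at this
  have h3 : analyticOrderAt (fun t : ℂ => t ^ N) 0 = N := by
    have := analyticOrderAt_centeredMonomial (𝕜 := ℂ) (z₀ := 0) (n := N)
    simpa [Pi.pow_def] using this
  rw [h3] at this
  exact this

/-- A polynomial of degree `n` without term of degree `n - 1`, which is not a monomial, has no root
of multiplicity `n`. -/
theorem rootMultiplicity_lt_of_coeff_eq_zero {p : Polynomial ℂ} {n k : ℕ}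
    (hp : p.natDegree = n) (h1 : p.coeff (n - 1) = 0) (hk : k < n) (hpk : p.coeff k ≠ 0) (r : ℂ) :
    p.rootMultiplicity r < n := by
  by_contra! hle
  have hp0 : p ≠ 0 := fun h => hpk (by simp [h])
  obtain ⟨q, hq⟩ := (Polynomial.le_rootMultiplicity_iff hp0).mp hle
  have hq0 : q ≠ 0 := fun h => hp0 (by simp [hq, h])
  have hm : ((Polynomial.X - Polynomial.C r) ^ n).Monic := (Polynomial.monic_X_sub_C r).pow n
  have hdeg : q.natDegree = 0 := by
    have := hm.natDegree_mul' hq0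
    rw [← hq, hp, Polynomial.natDegree_pow, Polynomial.natDegree_X_sub_C] at this
    omega
  rw [Polynomial.eq_C_of_natDegree_eq_zero hdeg] at hq hq0
  have hc : q.coeff 0 ≠ 0 := fun h => hq0 (by rw [h, map_zero])
  rw [hq, Polynomial.coeff_mul_C, sub_eq_add_neg, ← map_neg,
    Polynomial.coeff_X_add_C_pow] at h1 hpk
  have hr : r = 0 := by
    have e : n - (n - 1) = 1 := by omega
    rw [e, pow_one] at h1
    have h3 : (n.choose (n - 1) : ℂ) ≠ 0 := by
      exact_mod_cast (Nat.choose_pos (Nat.sub_le n 1)).ne'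
    simpa [hc, h3] using h1
  rw [hr, neg_zero, zero_pow (by omega)] at hpk
  simp at hpk

/-- Newton-Puiseux: a function `G` regular in `u` of positive order has a root which is a convergent
power series in a root of `t`.  A shift by a root of the derivative of order `n - 1` removes one
coefficient, so that the edge polynomial of the Newton polygon has only roots of multiplicity
less than `n`. -/
theorem exists_puiseux_root (n : ℕ) (G : ℂ × ℂ → ℂ) (u₀ : ℂ) (hG : AnalyticAt ℂ G (u₀, 0))
    (hn : n ≠ 0) (hord : analyticOrderAt (fun u => G (u, 0)) u₀ = n) :
    ∃ N : ℕ, 1 ≤ N ∧ ∃ u : ℂ → ℂ, AnalyticAt ℂ u 0 ∧ u 0 = u₀ ∧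
      ∀ᶠ s in 𝓝 (0 : ℂ), G (u s, s ^ N) = 0 := by
  classical
  induction n using Nat.strong_induction_on generalizing G u₀ with
  | _ n ih =>
  have hGs : AnalyticAt ℂ (fun u => G (u, 0)) u₀ :=
    analyticAt_pair (a := fun u => u) (b := fun _ => 0) hG analyticAt_id analyticAt_const
  have hder := (analyticOrderAt_eq_nat_iff_iteratedDeriv_eq_zero hGs).mp hord
  have hlt : ∀ k < n, (dz^[k] G) (u₀, 0) = 0 := fun k hk => by
    rw [iterate_dz_eq_iteratedDeriv]; exact hder.1 k hk
  have hnn : (dz^[n] G) (u₀, 0) ≠ 0 := by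
    rw [iterate_dz_eq_iteratedDeriv]; exact hder.2
  -- The derivative of order `n - 1` has a simple root `τ`, to which the origin is moved.
  obtain ⟨τ, hτ, hτ0, hτr⟩ := exists_analytic_root (analyticAt_iterate_dz hG (n - 1))
    (hlt (n - 1) (by omega)) (by
      rw [← Function.iterate_succ_apply' dz, Nat.sub_one, Nat.succ_pred hn]; exact hnn)
  set g : ℂ × ℂ → ℂ := fun x => G (τ x.2 + x.1, x.2) with hgdef
  have hg : AnalyticAt ℂ g 0 := by
    refine AnalyticAt.comp₂ (f := fun x : ℂ × ℂ => τ x.2 + x.1) (g := fun x => x.2)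
      (h := G) ?_ ?_ analyticAt_snd
    · simpa [hτ0] using hG
    · exact (AnalyticAt.fun_comp (g := τ) (f := fun x : ℂ × ℂ => x.2) hτ analyticAt_snd).add
        analyticAt_fst
  have htc : ∀ k t, taylorCoeff g k t = (dz^[k] G) (τ t, t) / (k.factorial : ℂ) := by
    intro k t
    rw [taylorCoeff, hgdef, iterate_dz_comp_shift G τ (fun t => t) k]
    simp
  -- If the constant coefficient vanishes, then `τ` itself is a root.
  by_cases h0 : analyticOrderAt (taylorCoeff g 0) 0 = ⊤
  · rw [analyticOrderAt_eq_top] at h0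
    refine ⟨1, le_rfl, τ, hτ, hτ0, ?_⟩
    filter_upwards [h0] with t ht
    rw [htc] at ht
    simpa using ht
  have hn1 : analyticOrderAt (taylorCoeff g (n - 1)) 0 = ⊤ := by
    rw [analyticOrderAt_eq_top]
    filter_upwards [hτr] with t ht
    rw [htc, ht, zero_div]
  have hnz : analyticOrderAt (taylorCoeff g n) 0 = 0 := by
    rw [(analyticAt_taylorCoeff hg n).analyticOrderAt_eq_zero, htc, hτ0]
    exact div_ne_zero hnn (by exact_mod_cast n.factorial_ne_zero)
  -- Among the sides which end at the vertex `(n, 0)`, the one on the boundary of the Newton polygon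
  -- minimizes `o k / (n - k)`; it begins at `k₀`.
  set o : ℕ → ℕ := fun k => analyticOrderNatAt (taylorCoeff g k) 0 with ho
  set S := (Finset.range n).filter fun k => analyticOrderAt (taylorCoeff g k) 0 ≠ ⊤ with hS
  have hSne : S.Nonempty := ⟨0, by simp [hS, h0]; omega⟩
  obtain ⟨k₀, hk₀S, hk₀min⟩ := S.exists_min_image (fun k => (o k : ℚ) / ((n : ℚ) - k)) hSne
  obtain ⟨hk₀n, hk₀⟩ : k₀ < n ∧ analyticOrderAt (taylorCoeff g k₀) 0 ≠ ⊤ := by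
    simpa [hS] using hk₀S
  have hoc : ∀ k, analyticOrderAt (taylorCoeff g k) 0 ≠ ⊤ →
      analyticOrderAt (taylorCoeff g k) 0 = o k := fun k hk =>
    (Nat.cast_analyticOrderNatAt hk).symm
  set E := o k₀ with hE
  have hE1 : 1 ≤ E := by
    have : analyticOrderAt (taylorCoeff g k₀) 0 ≠ 0 := by
      rw [(analyticAt_taylorCoeff hg k₀).analyticOrderAt_ne_zero, htc, hτ0, hlt k₀ hk₀n, zero_div]
    rw [hoc k₀ hk₀] at this
    have : o k₀ ≠ 0 := by exact_mod_cast this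
    omega
  set N := n - k₀ with hN
  have hN0 : N ≠ 0 := by omega
  -- After `t = s ^ N` this side has the integral slope `E`.
  set g' : ℂ × ℂ → ℂ := fun x => g (x.1, x.2 ^ N) with hg'def
  have hg' : AnalyticAt ℂ g' 0 := by
    refine AnalyticAt.comp₂ (f := fun x : ℂ × ℂ => x.1) (g := fun x => x.2 ^ N)
      (h := g) ?_ analyticAt_fst (by fun_prop)
    simpa [hN0, ← Prod.zero_eq_mk] using hg
  have htc' : ∀ k, taylorCoeff g' k = fun s => taylorCoeff g k (s ^ N) := by
    intro k
    funext s
    have := iterate_dz_comp_shift g (fun _ => 0) (fun s => s ^ N) k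
    simp only [zero_add] at this
    rw [taylorCoeff, hg'def, this, taylorCoeff]
  have hord' : ∀ k, analyticOrderAt (taylorCoeff g' k) 0 =
      analyticOrderAt (taylorCoeff g k) 0 * N := fun k => by
    rw [htc', analyticOrderAt_comp_pow (analyticAt_taylorCoeff hg k) hN0]
  obtain ⟨b, p, G', hp0, hG'a, hG'p, hG'eq, hbmin, hpc⟩ := exists_scaling hg' hE1 (k₀ := k₀) (by
    rw [hord', hoc k₀ hk₀]
    exact_mod_cast ENat.natCast_ne_top _)
  have hge : ∀ k, ((n * E : ℕ) : ℕ∞) ≤ analyticOrderAt (taylorCoeff g' k) 0 + (k * E : ℕ) := by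
    intro k
    rw [hord']
    by_cases hkn : k < n
    · by_cases hkt : analyticOrderAt (taylorCoeff g k) 0 = ⊤
      · rw [hkt, ENat.top_mul (by exact_mod_cast hN0)]
        simp
      · rw [hoc k hkt]
        have hm := hk₀min k (by simp [hS, hkn, hkt])
        have h1 : (0 : ℚ) < (n : ℚ) - k := by
          have : (k : ℚ) < n := by exact_mod_cast hkn
          linarith
        have h2 : (0 : ℚ) < (n : ℚ) - k₀ := by
          have : (k₀ : ℚ) < n := by exact_mod_cast hk₀n
          linarith
        rw [div_le_div_iff₀ h2 h1] at hm
        have hNq : (N : ℚ) = n - k₀ := by rw [hN, Nat.cast_sub hk₀n.le]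
        have : (n * E : ℚ) ≤ o k * N + k * E := by rw [hNq]; linarith
        exact_mod_cast this
    · have : n * E ≤ k * E := Nat.mul_le_mul_right _ (not_lt.mp hkn)
      exact le_trans (by exact_mod_cast this) le_add_self
  have hbn : b = n * E := by
    apply le_antisymm
    · have := hbmin n
      rw [hord', hnz, zero_mul, zero_add] at this
      exact_mod_cast this
    · obtain ⟨k, hk⟩ : ∃ k, p.coeff k ≠ 0 := by
        by_contra! h
        exact hp0 (Polynomial.ext (by simpa using h))
      have := hge k
      rw [(hpc k).mp hk] at this
      exact_mod_cast this
  have hpn : p.coeff n ≠ 0 := by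
    rw [hpc, hord', hnz, zero_mul, zero_add, hbn]
  have hpgt : ∀ k, n < k → p.coeff k = 0 := by
    intro k hk
    by_contra h
    rw [← ne_eq, hpc] at h
    have h1 : ((k * E : ℕ) : ℕ∞) ≤ b := h ▸ le_add_self
    have h2 : k * E ≤ b := by exact_mod_cast h1
    rw [hbn] at h2
    have := Nat.le_of_mul_le_mul_right h2 hE1
    omega
  have hdeg : p.natDegree = n :=
    le_antisymm (Polynomial.natDegree_le_iff_coeff_eq_zero.mpr hpgt)
      (Polynomial.le_natDegree_of_ne_zero hpn)
  have hpk₀ : p.coeff k₀ ≠ 0 := by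
    rw [hpc, hord', hoc k₀ hk₀, hbn]
    have : E * N + k₀ * E = n * E := by
      rw [hN, mul_comm E, ← add_mul]; congr 1; omega
    exact_mod_cast this
  have hpn1 : p.coeff (n - 1) = 0 := by
    by_contra h
    rw [← ne_eq, hpc, hord', hn1, ENat.top_mul (by exact_mod_cast hN0)] at h
    simp at h
  obtain ⟨r, hr⟩ := IsAlgClosed.exists_root p (by
    rw [Polynomial.degree_eq_natDegree hp0, hdeg]
    exact_mod_cast hn)
  -- The induction hypothesis applies at a root `r` of the edge polynomial.
  have hmul := rootMultiplicity_lt_of_coeff_eq_zero hdeg hpn1 hk₀n hpk₀ r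
  have hG'o : analyticOrderAt (fun u => G' (u, 0)) r = p.rootMultiplicity r := by
    rw [← analyticOrderAt_polynomial_eval hp0 r]
    congr 1
    funext u
    exact hG'p u
  obtain ⟨N', hN', v, hv, hv0, hvr⟩ := ih _ hmul G' r (hG'a r)
    (((Polynomial.rootMultiplicity_pos hp0).mpr hr).ne') hG'o
  have hN'0 : N' ≠ 0 := by omega
  refine ⟨N' * N, Nat.one_le_iff_ne_zero.mpr (mul_ne_zero hN'0 hN0),
    fun s => τ (s ^ (N' * N)) + (s ^ N') ^ E * v s, ?_, ?_, ?_⟩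
  · refine AnalyticAt.add (AnalyticAt.fun_comp (g := τ) (f := fun s : ℂ => s ^ (N' * N)) ?_
      (by fun_prop)) (AnalyticAt.mul (by fun_prop) hv)
    simpa [hN'0, hN0] using hτ
  · simp [hN'0, hN0, hτ0, show E ≠ 0 by omega]
  · have ht : Tendsto (fun s : ℂ => ((v s, s ^ N') : ℂ × ℂ)) (𝓝 0) (𝓝 (r, 0)) := by
      have h1 : Tendsto v (𝓝 0) (𝓝 r) := hv0 ▸ hv.continuousAt
      have h2 : Tendsto (fun s : ℂ => s ^ N') (𝓝 0) (𝓝 0) := by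
        have : ContinuousAt (fun s : ℂ => s ^ N') 0 := by fun_prop
        simpa [ContinuousAt, hN'0] using this
      exact h1.prodMk_nhds h2
    filter_upwards [ht.eventually (hG'eq r), hvr] with s h1 h2
    rw [h2, mul_zero] at h1
    simp only [hg'def, hgdef] at h1
    rw [pow_mul]
    exact h1

end PuiseuxRoots

/-! ### Parametrizations of fractional power series -/

section Representations

/-- The power series `ζ (t)` is `α (t ^ M)`; here `M` is any common denominator of the
exponents, not necessarily the least one. -/
structure IsRep (M : ℕ) (ζ : ℂ → ℂ) (α : HahnSeries ℚ ℂ) : Prop where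
  pos : 0 < M
  supp : ∀ q, α.coeff q ≠ 0 → ∃ n : ℕ, q = (n : ℚ) / M
  hasSum : ∀ᶠ t in 𝓝 (0 : ℂ), HasSum (fun n : ℕ => α.coeff ((n : ℚ) / M) * t ^ n) (ζ t)

variable {M : ℕ} {ζ ξ : ℂ → ℂ} {α β : HahnSeries ℚ ℂ}

theorem natCast_div_inj (hM : 0 < M) {n k : ℕ} : (n : ℚ) / M = (k : ℚ) / M ↔ n = k := by
  have : (M : ℚ) ≠ 0 := by exact_mod_cast hM.ne'
  rw [div_left_inj' this]
  exact_mod_cast Iff.rfl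

theorem hasFPowerSeriesAt_ofScalars_iff {c : ℕ → ℂ} :
    HasFPowerSeriesAt ζ (FormalMultilinearSeries.ofScalars ℂ c) 0 ↔
      ∀ᶠ t in 𝓝 (0 : ℂ), HasSum (fun n : ℕ => c n * t ^ n) (ζ t) := by
  rw [hasFPowerSeriesAt_iff]
  simp only [FormalMultilinearSeries.coeff_ofScalars, smul_eq_mul, zero_add, mul_comm]

theorem IsRep.hasFPowerSeriesAt (h : IsRep M ζ α) :
    HasFPowerSeriesAt ζ (FormalMultilinearSeries.ofScalars ℂ
      fun n : ℕ => α.coeff ((n : ℚ) / M)) 0 :=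
  hasFPowerSeriesAt_ofScalars_iff.mpr h.hasSum

theorem IsRep.analyticAt (h : IsRep M ζ α) : AnalyticAt ℂ ζ 0 := h.hasFPowerSeriesAt.analyticAt

theorem IsRep.coeff_eq (h : IsRep M ζ α) (n : ℕ) :
    α.coeff ((n : ℚ) / M) = iteratedDeriv n ζ 0 / (n.factorial : ℂ) := by
  have := congrArg (fun p => FormalMultilinearSeries.coeff p n)
    (h.hasFPowerSeriesAt.eq_formalMultilinearSeries h.analyticAt.hasFPowerSeriesAt)
  simpa [FormalMultilinearSeries.coeff_ofScalars] using this

theorem IsRep.coeff_zero (h : IsRep M ζ α) : α.coeff 0 = ζ 0 := by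
  have := h.coeff_eq 0
  simpa using this

theorem IsRep.unique (h : IsRep M ζ α) (h' : IsRep M ξ β) (hξ : ζ =ᶠ[𝓝 0] ξ) : α = β := by
  have key : ∀ n : ℕ, α.coeff ((n : ℚ) / M) = β.coeff ((n : ℚ) / M) := fun n => by
    rw [h.coeff_eq, h'.coeff_eq, hξ.iteratedDeriv_eq n]
  ext q
  by_cases ha : α.coeff q = 0
  · by_cases hb : β.coeff q = 0
    · rw [ha, hb]
    · obtain ⟨n, rfl⟩ := h'.supp q hb
      exact key n
  · obtain ⟨n, rfl⟩ := h.supp q ha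
    exact key n

theorem exists_isRep (hM : 0 < M) (hζ : AnalyticAt ℂ ζ 0) : ∃ α, IsRep M ζ α := by
  classical
  let c : ℚ → ℂ := fun q => if h : ∃ n : ℕ, q = (n : ℚ) / M then
    iteratedDeriv h.choose ζ 0 / (h.choose.factorial : ℂ) else 0
  have hc : ∀ n : ℕ, c ((n : ℚ) / M) = iteratedDeriv n ζ 0 / (n.factorial : ℂ) := by
    intro n
    have h : ∃ k : ℕ, (n : ℚ) / M = (k : ℚ) / M := ⟨n, rfl⟩
    have e : h.choose = n := ((natCast_div_inj hM).mp h.choose_spec).symm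
    simp only [c, dif_pos h, e]
  have hs : ∀ q, c q ≠ 0 → ∃ n : ℕ, q = (n : ℚ) / M := by
    intro q hq
    by_contra h
    exact hq (by simp only [c, dif_neg h])
  have hpwo : (Function.support c).IsPWO := by
    have hmono : Monotone fun n : ℕ => (n : ℚ) / M := fun a b hab => by
      have : (a : ℚ) ≤ b := by exact_mod_cast hab
      exact div_le_div_of_nonneg_right this (by positivity)
    have h1 : (Set.univ : Set ℕ).IsPWO := Set.isPWO_of_wellQuasiOrderedLE _
    refine (h1.image_of_monotone hmono).mono fun q hq => ?_
    obtain ⟨n, hn⟩ := hs q hq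
    exact ⟨n, trivial, hn.symm⟩
  refine ⟨⟨c, hpwo⟩, hM, hs, ?_⟩
  have := hasFPowerSeriesAt_ofScalars_iff.mp hζ.hasFPowerSeriesAt
  simpa only [hc] using this

theorem IsRep.add (h : IsRep M ζ α) (h' : IsRep M ξ β) :
    IsRep M (fun t => ζ t + ξ t) (α + β) := by
  refine ⟨h.pos, fun q hq => ?_, ?_⟩
  · by_cases ha : α.coeff q = 0
    · exact h'.supp q fun hb => hq (by simp [ha, hb])
    · exact h.supp q ha
  · filter_upwards [h.hasSum, h'.hasSum] with t h1 h2
    simpa [add_mul] using h1.add h2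

theorem IsRep.sub (h : IsRep M ζ α) (h' : IsRep M ξ β) :
    IsRep M (fun t => ζ t - ξ t) (α - β) := by
  refine ⟨h.pos, fun q hq => ?_, ?_⟩
  · by_cases ha : α.coeff q = 0
    · exact h'.supp q fun hb => hq (by simp [ha, hb])
    · exact h.supp q ha
  · filter_upwards [h.hasSum, h'.hasSum] with t h1 h2
    simpa [sub_mul] using h1.sub h2

theorem isRep_term (hM : 0 < M) (u : ℂ) {e : ℚ} {E : ℕ} (he : e * M = E) :
    IsRep M (fun t => t ^ E * u) (term u e) := by
  have hM' : (M : ℚ) ≠ 0 := by exact_mod_cast hM.ne'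
  have he' : e = (E : ℚ) / M := by rw [← he, mul_div_assoc, div_self hM', mul_one]
  refine ⟨hM, fun q hq => ⟨E, ?_⟩, Eventually.of_forall fun t => ?_⟩
  · by_contra hne
    exact hq (HahnSeries.coeff_single_of_ne (by rwa [he']))
  · have := hasSum_single (f := fun n : ℕ => (term u e).coeff ((n : ℚ) / M) * t ^ n) E
      fun n hn => by
        rw [term, HahnSeries.coeff_single_of_ne, zero_mul]
        rw [he', Ne, natCast_div_inj hM]
        exact hn
    simpa only [term, ← he', HahnSeries.coeff_single_same, mul_comm u] using this

theorem IsRep.comp_pow (h : IsRep M ζ α) {r : ℕ} (hr : 0 < r) :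
    IsRep (M * r) (fun t => ζ (t ^ r)) α := by
  have hr' : (r : ℚ) ≠ 0 := by exact_mod_cast hr.ne'
  have hM' : (M : ℚ) ≠ 0 := by exact_mod_cast h.pos.ne'
  have e : ∀ n : ℕ, ((n * r : ℕ) : ℚ) / (M * r : ℕ) = (n : ℚ) / M := by
    intro n
    push_cast
    field_simp
  refine ⟨Nat.mul_pos h.pos hr, fun q hq => ?_, ?_⟩
  · obtain ⟨n, rfl⟩ := h.supp q hq
    exact ⟨n * r, (e n).symm⟩
  · have ht : Tendsto (fun s : ℂ => s ^ r) (𝓝 0) (𝓝 0) := by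
      have : ContinuousAt (fun s : ℂ => s ^ r) 0 := by fun_prop
      simpa [ContinuousAt, hr.ne'] using this
    filter_upwards [ht.eventually h.hasSum] with t h1
    have hinj : Function.Injective fun n : ℕ => n * r := fun a b hab =>
      Nat.eq_of_mul_eq_mul_right hr hab
    refine (hinj.hasSum_iff ?_).mp ?_
    · intro k hk
      have : α.coeff ((k : ℚ) / (M * r : ℕ)) = 0 := by
        by_contra hne
        obtain ⟨n, hn⟩ := h.supp _ hne
        rw [← e n, natCast_div_inj (Nat.mul_pos h.pos hr)] at hn
        exact hk ⟨n, hn.symm⟩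
      rw [this, zero_mul]
    · convert h1 using 1
      funext n
      simp only [Function.comp_apply, e, ← pow_mul, mul_comm r]

theorem IsRep.conj (h : IsRep M ζ α) (k : ℕ) :
    IsRep M (fun t => ζ (Complex.exp (2 * Real.pi * Complex.I * k / M) * t)) (conj k α) := by
  have hM' : (M : ℂ) ≠ 0 := by exact_mod_cast h.pos.ne'
  refine ⟨h.pos, fun q hq => h.supp q fun h0 => hq (by simp [ACampo.conj, h0]), ?_⟩
  set ω := Complex.exp (2 * Real.pi * Complex.I * k / M) with hω
  have ht : Tendsto (fun s : ℂ => ω * s) (𝓝 0) (𝓝 0) := by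
    have : ContinuousAt (fun s : ℂ => ω * s) 0 := by fun_prop
    simpa [ContinuousAt] using this
  filter_upwards [ht.eventually h.hasSum] with t h1
  convert h1 using 1
  funext n
  have : Complex.exp (2 * Real.pi * Complex.I * k * (((n : ℚ) / M : ℚ) : ℂ)) = ω ^ n := by
    rw [hω, ← Complex.exp_nat_mul]
    congr 1
    push_cast
    field_simp
  simp only [ACampo.conj]
  rw [this, mul_pow]
  ring

theorem IsRep.le_orderTop_iff (h : IsRep M ζ α) {e : ℚ} {E : ℕ} (he : e * M = E) :
    (e : WithTop ℚ) ≤ α.orderTop ↔ (E : ℕ∞) ≤ analyticOrderAt ζ 0 := by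
  have hM' : (0 : ℚ) < M := by exact_mod_cast h.pos
  rw [natCast_le_analyticOrderAt_iff_iteratedDeriv_eq_zero h.analyticAt,
    HahnSeries.le_orderTop_iff_forall]
  have hcoe : ∀ n : ℕ, (((n : ℚ) / M : ℚ) : WithTop ℚ) < e ↔ n < E := by
    intro n
    rw [WithTop.coe_lt_coe, div_lt_iff₀ hM', he]
    exact_mod_cast Iff.rfl
  constructor
  · intro H n hn
    have h0 := H ((n : ℚ) / M) ((hcoe n).mpr hn)
    rw [h.coeff_eq, div_eq_zero_iff] at h0
    exact h0.resolve_right (by exact_mod_cast n.factorial_ne_zero)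
  · intro H q hq
    by_contra hne
    obtain ⟨n, rfl⟩ := h.supp q hne
    exact hne (by rw [h.coeff_eq, H n ((hcoe n).mp hq), zero_div])

theorem IsRep.lt_orderTop_iff (h : IsRep M ζ α) {e : ℚ} {E : ℕ} (he : e * M = E) :
    (e : WithTop ℚ) < α.orderTop ↔ ((E + 1 : ℕ) : ℕ∞) ≤ analyticOrderAt ζ 0 := by
  have hM' : (0 : ℚ) < M := by exact_mod_cast h.pos
  have he' : (e + 1 / M) * M = (E + 1 : ℕ) := by
    rw [add_mul, he]
    field_simp
    push_cast
    ring
  rw [← h.le_orderTop_iff he']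
  constructor
  · intro hlt
    rw [HahnSeries.le_orderTop_iff_forall]
    intro q hq
    by_contra hne
    obtain ⟨n, rfl⟩ := h.supp q hne
    have h1 := lt_of_lt_of_le hlt (HahnSeries.orderTop_le_of_coeff_ne_zero hne)
    rw [WithTop.coe_lt_coe, lt_div_iff₀ hM', he] at h1
    rw [WithTop.coe_lt_coe, div_lt_iff₀ hM', he'] at hq
    have h1' : E < n := by exact_mod_cast h1
    have hq' : n < E + 1 := by exact_mod_cast hq
    omega
  · refine lt_of_lt_of_le ?_
    rw [WithTop.coe_lt_coe]
    have : (0 : ℚ) < 1 / M := by positivity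
    linarith

theorem IsRep.exists_eq_pow_mul (h : IsRep M ζ α) {e : ℚ} {E : ℕ} (he : e * M = E)
    (hle : (e : WithTop ℚ) ≤ α.orderTop) :
    ∃ u : ℂ → ℂ, AnalyticAt ℂ u 0 ∧ u 0 = α.coeff e ∧ ∀ᶠ t in 𝓝 (0 : ℂ), ζ t = t ^ E * u t := by
  obtain ⟨u, hu, hζ⟩ := (natCast_le_analyticOrderAt h.analyticAt).mp ((h.le_orderTop_iff he).mp hle)
  simp only [sub_zero, smul_eq_mul] at hζ
  refine ⟨u, hu, ?_, hζ⟩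
  have h1 := h.sub (isRep_term h.pos (u 0) he)
  have h2 : ((E + 1 : ℕ) : ℕ∞) ≤ analyticOrderAt (fun t => ζ t - t ^ E * u 0) 0 := by
    have h3 : (1 : ℕ∞) ≤ analyticOrderAt (fun t => u t - u 0) 0 := by
      rw [Order.one_le_iff_ne_zero, AnalyticAt.analyticOrderAt_ne_zero (by fun_prop)]
      simp
    obtain ⟨v, hv, huv⟩ := (natCast_le_analyticOrderAt (n := 1)
      (f := fun t => u t - u 0) (by fun_prop)).mp (by exact_mod_cast h3)
    rw [natCast_le_analyticOrderAt h1.analyticAt]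
    refine ⟨v, hv, ?_⟩
    filter_upwards [huv, hζ] with t h4 h5
    simp only [sub_zero, smul_eq_mul, pow_one] at h4 ⊢
    rw [h5, ← mul_sub, h4]
    ring
  rw [← h1.lt_orderTop_iff he] at h2
  have := HahnSeries.coeff_eq_zero_of_lt_orderTop h2
  rw [HahnSeries.coeff_sub, term, HahnSeries.coeff_single_same, sub_eq_zero] at this
  exact this.symm

theorem mpuis_spec (h : 0 < mpuis α) : ∀ q, α.coeff q ≠ 0 → ∃ n : ℤ, q = (n : ℚ) / mpuis α :=
  (Nat.sInf_mem (Nat.nonempty_of_pos_sInf h)).2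

theorem mpuis_pos {L : ℕ} (hL : 0 < L) (h : ∀ q, α.coeff q ≠ 0 → ∃ n : ℤ, q = (n : ℚ) / L) :
    0 < mpuis α :=
  (Nat.sInf_mem (⟨L, hL, h⟩ : {N : ℕ | 0 < N ∧ ∀ q : ℚ, α.coeff q ≠ 0 →
    ∃ n : ℤ, q = n / N}.Nonempty)).1

theorem mpuis_dvd {L : ℕ} (hL : 0 < L) (h : ∀ q, α.coeff q ≠ 0 → ∃ n : ℤ, q = (n : ℚ) / L) :
    mpuis α ∣ L := by
  have hN := mpuis_pos hL h
  set N := mpuis α with hNdef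
  have hNq : (N : ℚ) ≠ 0 := by exact_mod_cast hN.ne'
  have hLq : (L : ℚ) ≠ 0 := by exact_mod_cast hL.ne'
  have hg : 0 < Nat.gcd N L := Nat.gcd_pos_of_pos_left _ hN
  have hgq : (Nat.gcd N L : ℚ) ≠ 0 := by exact_mod_cast hg.ne'
  have hle : N ≤ Nat.gcd N L := by
    refine Nat.sInf_le ⟨hg, fun q hq => ?_⟩
    obtain ⟨a, ha⟩ := mpuis_spec hN q hq
    obtain ⟨b, hb⟩ := h q hq
    refine ⟨a * N.gcdA L + b * N.gcdB L, ?_⟩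
    have hbez : (Nat.gcd N L : ℚ) = N * N.gcdA L + L * N.gcdB L := by
      exact_mod_cast Nat.gcd_eq_gcd_ab N L
    rw [eq_div_iff hgq, hbez]
    have h1 : q * N = a := by rw [ha]; exact div_mul_cancel₀ _ hNq
    have h2 : q * L = b := by rw [hb]; exact div_mul_cancel₀ _ hLq
    push_cast
    rw [← h1, ← h2]
    ring
  have : Nat.gcd N L = N := le_antisymm (Nat.gcd_le_left _ hN) hle
  exact this ▸ Nat.gcd_dvd_right N L

theorem IsRep.int_supp (h : IsRep M ζ α) : ∀ q, α.coeff q ≠ 0 → ∃ n : ℤ, q = (n : ℚ) / M :=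
  fun q hq => by
    obtain ⟨n, hn⟩ := h.supp q hq
    exact ⟨n, by rw [hn, Int.cast_natCast]⟩

theorem IsRep.mpuis_pos (h : IsRep M ζ α) : 0 < mpuis α := ACampo.mpuis_pos h.pos h.int_supp

theorem IsRep.mpuis_dvd (h : IsRep M ζ α) : mpuis α ∣ M := ACampo.mpuis_dvd h.pos h.int_supp

theorem isRep_arc (hα : α ∈ D1) : IsRep (mpuis α) (fun t => (arc α t).1) α := by
  obtain ⟨h1, hN, r, hr, hs⟩ := hα
  have hNq : (0 : ℚ) < mpuis α := by exact_mod_cast hN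
  refine ⟨hN, fun q hq => ?_, ?_⟩
  · obtain ⟨n, rfl⟩ := mpuis_spec hN q hq
    have h2 := le_trans h1 (HahnSeries.orderTop_le_of_coeff_ne_zero hq)
    have h3 : (1 : ℚ) ≤ (n : ℚ) / mpuis α := by exact_mod_cast h2
    have h4 : (0 : ℚ) ≤ n := by
      rw [le_div_iff₀ hNq] at h3
      linarith
    have h5 : 0 ≤ n := by exact_mod_cast h4
    refine ⟨n.toNat, ?_⟩
    have : ((n.toNat : ℕ) : ℤ) = n := Int.toNat_of_nonneg h5
    congr 1
    exact_mod_cast this.symm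
  · filter_upwards [Metric.ball_mem_nhds (0 : ℂ) hr] with t ht
    have ht' : ‖t‖ ≤ r := (mem_ball_zero_iff.mp ht).le
    have : Summable fun n : ℕ => α.coeff ((n : ℚ) / mpuis α) * t ^ n := by
      refine Summable.of_norm_bounded hs fun n => ?_
      rw [norm_mul, norm_pow]
      gcongr
    exact this.hasSum

theorem IsRep.mem_D1 (h : IsRep M ζ α) (h1 : 1 ≤ α.orderTop) : α ∈ D1 := by
  refine ⟨h1, h.mpuis_pos, ?_⟩
  obtain ⟨k, hk⟩ := h.mpuis_dvd
  have hk0 : 0 < k := Nat.pos_of_ne_zero fun h0 => by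
    have := h.pos
    rw [hk, h0] at this
    omega
  obtain ⟨ε, hε, hball⟩ := Metric.eventually_nhds_iff.mp h.hasSum
  have hr : 0 < ε / 2 := by positivity
  have hs := (hball (y := ((ε / 2 : ℝ) : ℂ)) (by
    rw [dist_zero_right, Complex.norm_real, Real.norm_of_nonneg hr.le]; linarith)).summable.norm
  have hinj : Function.Injective fun n : ℕ => n * k := fun a b hab =>
    Nat.eq_of_mul_eq_mul_right hk0 hab
  refine ⟨(ε / 2) ^ k, by positivity, ?_⟩
  refine (hs.comp_injective hinj).congr fun n => ?_
  have hkq : (k : ℚ) ≠ 0 := by exact_mod_cast hk0.ne'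
  have e : ((n * k : ℕ) : ℚ) / M = (n : ℚ) / mpuis α := by
    rw [hk]
    push_cast
    exact mul_div_mul_right _ _ hkq
  simp only [Function.comp_apply, e, norm_mul, norm_pow, Complex.norm_real,
    Real.norm_of_nonneg hr.le, ← pow_mul, mul_comm k]

theorem exists_isRep_of_dvd (hα : α ∈ D1) {L : ℕ} (hL : 0 < L) (h : mpuis α ∣ L) :
    ∃ ζ, IsRep L ζ α := by
  obtain ⟨k, rfl⟩ := h
  exact ⟨_, (isRep_arc hα).comp_pow (Nat.pos_of_mul_pos_left hL)⟩

theorem IsRep.arc_eq (h : IsRep M ζ α) (hα : α ∈ D1) :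
    ∃ k, 0 < k ∧ M = mpuis α * k ∧ ∀ᶠ t in 𝓝 (0 : ℂ), arc α (t ^ k) = (ζ t, t ^ M) := by
  obtain ⟨k, hk⟩ := h.mpuis_dvd
  have hk0 : 0 < k := Nat.pos_of_ne_zero fun h0 => by
    have := h.pos
    rw [hk, h0] at this
    omega
  refine ⟨k, hk0, hk, ?_⟩
  have h2 := (isRep_arc hα).comp_pow hk0
  filter_upwards [h.hasSum, h2.hasSum] with t h3 h4
  rw [← hk] at h4
  ext
  · exact h4.unique h3
  · simp only [arc, ← pow_mul, mul_comm k, hk]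

theorem map_pow_nhds_zero {k : ℕ} (hk : 0 < k) : map (fun t : ℂ => t ^ k) (𝓝 0) = 𝓝 0 := by
  apply le_antisymm
  · have : ContinuousAt (fun s : ℂ => s ^ k) 0 := by fun_prop
    simpa [ContinuousAt, Tendsto, hk.ne'] using this
  · have ha : AnalyticAt ℂ (fun t : ℂ => t ^ k) 0 := by fun_prop
    rcases ha.eventually_constant_or_nhds_le_map_nhds with h | h
    · exfalso
      have h1 : ∀ᶠ t in 𝓝[≠] (0 : ℂ), t ^ k = 0 ^ k := h.filter_mono nhdsWithin_le_nhds
      obtain ⟨t, ht, ht0⟩ := (h1.and self_mem_nhdsWithin).exists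
      rw [zero_pow hk.ne'] at ht
      exact ht0 (by simpa using pow_eq_zero_iff hk.ne' |>.mp ht)
    · simpa [hk.ne'] using h

theorem IsRep.germ_eq (h : IsRep M ζ α) (hα : α ∈ D1) :
    germ α = map (fun t => (ζ t, t ^ M)) (𝓝 0) := by
  obtain ⟨k, hk, -, he⟩ := h.arc_eq hα
  rw [← map_congr he, germ, image]
  conv_lhs => rw [← map_pow_nhds_zero hk]
  rw [map_map]
  rfl

theorem IsRep.germ'_eq (h : IsRep M ζ α) (hα : α ∈ D1) :
    germ' α = map (fun t => (t ^ M, ζ t)) (𝓝 0) := by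
  have h1 : germ' α = map Prod.swap (germ α) := by
    rw [germ, image, map_map]
    rfl
  rw [h1, h.germ_eq hα, map_map]
  rfl

theorem germ'_eq_map_swap (α : HahnSeries ℚ ℂ) : germ' α = map Prod.swap (germ α) := by
  rw [germ, image, map_map]
  rfl

end Representations

/-! ### Conjugation, germs and contact orders -/

section Germs

variable {M : ℕ} {ζ ξ : ℂ → ℂ} {α β : HahnSeries ℚ ℂ}

theorem exists_nat_eq_mul {e : ℚ} (he : 0 ≤ e) {M : ℕ} (h : e.den ∣ M) : ∃ E : ℕ, e * M = E := by
  obtain ⟨k, rfl⟩ := h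
  refine ⟨e.num.toNat * k, ?_⟩
  have h1 : ((e.num.toNat : ℕ) : ℤ) = e.num := Int.toNat_of_nonneg (Rat.num_nonneg.mpr he)
  have h2 : ((e.num.toNat : ℕ) : ℚ) = e.num := by exact_mod_cast h1
  push_cast
  rw [h2, ← mul_assoc, Rat.mul_den_eq_num]

theorem coeff_conj_ne_zero (k : ℕ) (q : ℚ) : (conj k α).coeff q ≠ 0 ↔ α.coeff q ≠ 0 := by
  simp [conj, Complex.exp_ne_zero]

theorem conj_conj (i j : ℕ) (α : HahnSeries ℚ ℂ) : conj i (conj j α) = conj (i + j) α := by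
  ext q
  simp only [conj, ← mul_assoc, ← Complex.exp_add]
  congr 2
  push_cast
  ring

theorem conj_zero (α : HahnSeries ℚ ℂ) : conj 0 α = α := by
  ext q
  simp [conj]

theorem conj_sub (k : ℕ) (α β : HahnSeries ℚ ℂ) : conj k (α - β) = conj k α - conj k β := by
  ext q
  simp only [conj, HahnSeries.coeff_sub, mul_sub]

theorem orderTop_conj (k : ℕ) (α : HahnSeries ℚ ℂ) : (conj k α).orderTop = α.orderTop := by
  apply le_antisymm
  · rw [HahnSeries.le_orderTop_iff_forall]
    intro q hq
    by_contra h
    exact (coeff_conj_ne_zero k q).mpr h (HahnSeries.coeff_eq_zero_of_lt_orderTop hq)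
  · rw [HahnSeries.le_orderTop_iff_forall]
    intro q hq
    by_contra h
    exact (coeff_conj_ne_zero k q).mp h (HahnSeries.coeff_eq_zero_of_lt_orderTop hq)

theorem orderTop_conj_sub_conj (k : ℕ) (α β : HahnSeries ℚ ℂ) :
    (conj k α - conj k β).orderTop = (α - β).orderTop := by
  rw [← conj_sub, orderTop_conj]

theorem IsRep.conj_mul (h : IsRep M ζ α) (k : ℕ) : ACampo.conj (M * k) α = α := by
  refine (h.conj (M * k)).unique h (Eventually.of_forall fun t => ?_)
  have hM : (M : ℂ) ≠ 0 := by exact_mod_cast h.pos.ne'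
  have : Complex.exp (2 * Real.pi * Complex.I * (M * k : ℕ) / M) = 1 := by
    rw [Complex.exp_eq_one_iff]
    refine ⟨k, ?_⟩
    push_cast
    field_simp
  simp only [this, one_mul]

/-- Conjugation is invertible on `D1`. -/
theorem exists_conj_conj_eq (hα : α ∈ D1) (k : ℕ) :
    ∃ k', conj k' (conj k α) = α := by
  refine ⟨(mpuis α - 1) * k, ?_⟩
  have h := isRep_arc hα
  rw [conj_conj]
  have : (mpuis α - 1) * k + k = mpuis α * k := by
    have := h.pos
    rw [← Nat.succ_mul, Nat.succ_eq_add_one, Nat.sub_add_cancel this]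
  rw [this, h.conj_mul]

theorem conj_mem_D1 (hα : α ∈ D1) (k : ℕ) : conj k α ∈ D1 :=
  ((isRep_arc hα).conj k).mem_D1 (by rw [orderTop_conj]; exact hα.1)

theorem germ_conj (hα : α ∈ D1) (k : ℕ) : germ (conj k α) = germ α := by
  have h := isRep_arc hα
  rw [(h.conj k).germ_eq (conj_mem_D1 hα k), h.germ_eq hα]
  set M := mpuis α
  set ω := Complex.exp (2 * Real.pi * Complex.I * k / M) with hω
  have hM : (M : ℂ) ≠ 0 := by exact_mod_cast h.pos.ne'
  have hωM : ω ^ M = 1 := by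
    rw [hω, ← Complex.exp_nat_mul, Complex.exp_eq_one_iff]
    exact ⟨k, by push_cast; field_simp⟩
  have hmap : map (fun t => ω * t) (𝓝 0) = 𝓝 (0 : ℂ) := by
    have := (Homeomorph.mulLeft₀ ω (Complex.exp_ne_zero _)).map_nhds_eq 0
    simpa using this
  conv_rhs => rw [← hmap, map_map]
  refine congrArg (fun F => map F (𝓝 0)) ?_
  funext t
  simp only [Function.comp_apply, mul_pow, hωM, one_mul]

/-- Two elements of `D1` have parametrizations by the same root `y = t ^ M`, in which a given
exponent `e` is integral. -/
theorem exists_common_isRep (hα : α ∈ D1) (hβ : β ∈ D1) {e : ℚ} (he : 0 ≤ e) :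
    ∃ (M : ℕ) (ζ ξ : ℂ → ℂ) (E : ℕ), IsRep M ζ α ∧ IsRep M ξ β ∧ e * M = E := by
  have ha := (isRep_arc hα).pos
  have hb := (isRep_arc hβ).pos
  have hM : 0 < mpuis α * mpuis β * e.den := Nat.mul_pos (Nat.mul_pos ha hb) e.den_pos
  obtain ⟨ζ, hζ⟩ := exists_isRep_of_dvd hα hM ⟨mpuis β * e.den, by ring⟩
  obtain ⟨ξ, hξ⟩ := exists_isRep_of_dvd hβ hM ⟨mpuis α * e.den, by ring⟩
  obtain ⟨E, hE⟩ := exists_nat_eq_mul (M := mpuis α * mpuis β * e.den) he (Dvd.intro_left _ rfl)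
  exact ⟨_, ζ, ξ, E, hζ, hξ, hE⟩

theorem exists_isRep_mul (hα : α ∈ D1) {e : ℚ} (he : 0 ≤ e) :
    ∃ (M : ℕ) (ζ : ℂ → ℂ) (E : ℕ), IsRep M ζ α ∧ e * M = E := by
  obtain ⟨M, ζ, -, E, h, -, hE⟩ := exists_common_isRep hα hα he
  exact ⟨M, ζ, E, h, hE⟩

theorem le_orderTop_term (u : ℂ) (e : ℚ) : (e : WithTop ℚ) ≤ (term u e).orderTop :=
  HahnSeries.orderTop_single_le

theorem add_term_mem_D1 (hα : α ∈ D1) {e : ℚ} (he : 1 ≤ e) (u : ℂ) : α + term u e ∈ D1 := by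
  obtain ⟨M, ζ, E, h, hE⟩ := exists_isRep_mul hα (zero_le_one.trans he)
  refine (h.add (isRep_term h.pos u hE)).mem_D1 ?_
  refine le_trans (le_min hα.1 (le_trans ?_ (le_orderTop_term u e)))
    HahnSeries.min_orderTop_le_orderTop_add
  exact_mod_cast he

theorem le_orderTop_sub_trans {α β γ : HahnSeries ℚ ℂ} {c : WithTop ℚ}
    (h1 : c ≤ (α - β).orderTop) (h2 : c ≤ (β - γ).orderTop) : c ≤ (α - γ).orderTop := by
  rw [← sub_add_sub_cancel α β γ]
  exact le_trans (le_min h1 h2) HahnSeries.min_orderTop_le_orderTop_add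

theorem lt_orderTop_sub_trans {α β γ : HahnSeries ℚ ℂ} {c : WithTop ℚ}
    (h1 : c < (α - β).orderTop) (h2 : c < (β - γ).orderTop) : c < (α - γ).orderTop := by
  rw [← sub_add_sub_cancel α β γ]
  exact lt_of_lt_of_le (lt_min h1 h2) HahnSeries.min_orderTop_le_orderTop_add

theorem orderTop_sub_comm (α β : HahnSeries ℚ ℂ) : (α - β).orderTop = (β - α).orderTop := by
  rw [← neg_sub, HahnSeries.orderTop_neg]

theorem one_le_orderTop_sub (hα : α ∈ D1) (hβ : β ∈ D1) : 1 ≤ (α - β).orderTop :=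
  le_trans (le_min hα.1 hβ.1) HahnSeries.min_orderTop_le_orderTop_sub

/-- Two fractional power series with the same image germ are conjugate. -/
theorem exists_eq_conj_of_germ_eq (hα : α ∈ D1) (hβ : β ∈ D1) (h : germ α = germ β) :
    ∃ k, α = conj k β := by
  obtain ⟨M, ζ, ξ, -, hζ, hξ, -⟩ := exists_common_isRep hα hβ zero_le_one
  rw [hζ.germ_eq hα, hξ.germ_eq hβ] at h
  -- Points of the first arc lie on the second one, with a parameter which differs by a root of
  -- unity.
  have hr : Set.range (fun t => (ξ t, t ^ M)) ∈ map (fun t => (ξ t, t ^ M)) (𝓝 (0 : ℂ)) :=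
    range_mem_map
  rw [← h, mem_map] at hr
  have h1 : ∀ᶠ t in 𝓝[≠] (0 : ℂ), ∃ k < M,
      ζ t = ξ (Complex.exp (2 * Real.pi * Complex.I * k / M) * t) := by
    filter_upwards [nhdsWithin_le_nhds hr, self_mem_nhdsWithin] with t ht ht0
    obtain ⟨s, hs⟩ := ht
    simp only [Prod.mk.injEq] at hs
    have ht0' : t ≠ 0 := ht0
    have hroot : (s / t) ^ M = 1 := by
      rw [div_pow, hs.2, div_self (pow_ne_zero _ ht0')]
    have : NeZero M := ⟨hζ.pos.ne'⟩
    obtain ⟨k, hk, hk'⟩ := (Complex.isPrimitiveRoot_exp M hζ.pos.ne').eq_pow_of_pow_eq_one hroot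
    refine ⟨k, hk, ?_⟩
    rw [← hs.1]
    congr 1
    rw [← div_eq_iff ht0', ← hk', ← Complex.exp_nat_mul]
    congr 1
    ring
  -- One of the finitely many roots of unity occurs arbitrarily close to `0`; conclude by the
  -- identity theorem.
  obtain ⟨k, hk⟩ : ∃ k : ℕ, ∃ᶠ t in 𝓝[≠] (0 : ℂ),
      ζ t = ξ (Complex.exp (2 * Real.pi * Complex.I * k / M) * t) := by
    by_contra! hne
    have h2 : ∀ᶠ t in 𝓝[≠] (0 : ℂ), ∀ k ∈ Finset.range M,
        ¬ ζ t = ξ (Complex.exp (2 * Real.pi * Complex.I * k / M) * t) :=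
      (eventually_all_finset _).mpr fun k _ => hne k
    obtain ⟨t, ⟨k, hk, hk'⟩, h4⟩ := (h1.and h2).exists
    exact h4 k (Finset.mem_range.mpr hk) hk'
  have hc := hξ.conj k
  exact ⟨k, hζ.unique hc ((hζ.analyticAt.frequently_eq_iff_eventually_eq hc.analyticAt).mp hk)⟩

theorem IsRep.exists_eq_pow_mul_self (h : IsRep M ζ α) (hα : α ∈ D1) :
    ∃ u : ℂ → ℂ, AnalyticAt ℂ u 0 ∧ u 0 = α.coeff 1 ∧ ∀ᶠ t in 𝓝 (0 : ℂ), ζ t = t ^ M * u t :=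
  h.exists_eq_pow_mul (e := 1) (one_mul _) hα.1

/-- Germs with tangent `[1:0]` are not in the chart of germs with other tangents. -/
theorem germ_ne_germ' (hα : α ∈ D1) (hβ : β ∈ D1) (hβ1 : 1 < β.orderTop) :
    germ α ≠ germ' β := by
  intro h
  have hζ := isRep_arc hα
  have hξ := isRep_arc hβ
  rw [hζ.germ_eq hα, hξ.germ'_eq hβ] at h
  obtain ⟨u, hu, -, hu'⟩ := hζ.exists_eq_pow_mul_self hα
  obtain ⟨v, hv, hv0, hv'⟩ := hξ.exists_eq_pow_mul_self hβ
  rw [HahnSeries.coeff_eq_zero_of_lt_orderTop (by exact_mod_cast hβ1)] at hv0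
  -- On the first germ `|z| ≤ C |w|`, but `w = o (z)` on the second one.
  obtain ⟨C, hC, hCu⟩ : ∃ C : ℝ, 0 < C ∧ ∀ᶠ t in 𝓝 (0 : ℂ), ‖u t‖ ≤ C := by
    refine ⟨‖u 0‖ + 1, by positivity, ?_⟩
    exact (hu.continuousAt.norm.eventually_le_const (lt_add_one _))
  have h1 : ∀ᶠ p in map (fun t => ((arc α t).1, t ^ mpuis α)) (𝓝 (0 : ℂ)),
      ‖p.1‖ ≤ C * ‖p.2‖ := by
    rw [eventually_map]
    filter_upwards [hu', hCu] with t h2 h3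
    rw [h2, norm_mul, mul_comm]
    gcongr
  rw [h, eventually_map] at h1
  have h4 : ∀ᶠ t in 𝓝 (0 : ℂ), ‖v t‖ < 1 / (2 * C) := by
    have : Tendsto (fun t => ‖v t‖) (𝓝 0) (𝓝 0) := by
      have := hv.continuousAt.norm
      rw [ContinuousAt, hv0, norm_zero] at this
      exact this
    exact this.eventually_lt_const (by positivity)
  have h5 := ((h1.and (hv'.and h4)).filter_mono (nhdsWithin_le_nhds (s := {0}ᶜ))).and
    self_mem_nhdsWithin
  obtain ⟨t, ⟨h6, h7, h8⟩, h9⟩ := h5.exists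
  have hpos : 0 < ‖t ^ mpuis β‖ := norm_pos_iff.mpr (pow_ne_zero _ h9)
  rw [h7, norm_mul] at h6
  have h10 : C * (‖t ^ mpuis β‖ * ‖v t‖) ≤ C * (‖t ^ mpuis β‖ * (1 / (2 * C))) := by gcongr
  have h11 : C * (‖t ^ mpuis β‖ * (1 / (2 * C))) = ‖t ^ mpuis β‖ / 2 := by field_simp
  linarith

theorem isArc_arc (hα : α ∈ D1) : IsArc (arc α) := by
  have h := isRep_arc hα
  have h2 : AnalyticAt ℂ (fun t : ℂ => t ^ mpuis α) 0 := by fun_prop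
  refine ⟨h.analyticAt.prod h2, ?_, fun h0 => ?_⟩
  · have h0 : (arc α 0).1 = 0 := by
      rw [← h.coeff_zero]
      exact HahnSeries.coeff_eq_zero_of_lt_orderTop
        (lt_of_lt_of_le (by exact_mod_cast zero_lt_one) hα.1)
    ext
    · exact h0
    · simp [arc, h.pos.ne']
  · obtain ⟨t, ht, ht0⟩ := ((h0.filter_mono (nhdsWithin_le_nhds (s := {0}ᶜ))).and
      self_mem_nhdsWithin).exists
    have : t ^ mpuis α = 0 := congrArg Prod.snd ht
    exact ht0 (by simpa using (pow_eq_zero_iff h.pos.ne').mp this)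

theorem isArc_swap (hα : α ∈ D1) : IsArc (fun t => (arc α t).swap) := by
  obtain ⟨h1, h2, h3⟩ := isArc_arc hα
  refine ⟨?_, by simp [h2], fun h0 => h3 ?_⟩
  · exact AnalyticAt.prod (analyticAt_snd.comp h1) (analyticAt_fst.comp h1)
  · filter_upwards [h0] with t ht
    rw [← Prod.swap_swap (arc α t), ht]
    rfl

theorem germ_mem_CPstar (hα : α ∈ D1) : germ α ∈ CPstar := ⟨_, isArc_arc hα, rfl⟩

theorem germ'_mem_CPstar (hα : α ∈ D1) : germ' α ∈ CPstar := ⟨_, isArc_swap hα, rfl⟩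

theorem exists_isMaxConjOrder (hα : α ∈ D1) (hβ : β ∈ D1) :
    ∃ c, IsMaxConjOrder α β c ∧ (α - β).orderTop ≤ c := by
  have hfin : {o | ∃ i < mpuis α, ∃ j < mpuis β, o = (conj i α - conj j β).orderTop}.Finite := by
    refine (((Set.finite_lt_nat (mpuis α)).prod (Set.finite_lt_nat (mpuis β))).image
      fun p : ℕ × ℕ => (conj p.1 α - conj p.2 β).orderTop).subset ?_
    rintro o ⟨i, hi, j, hj, rfl⟩
    exact ⟨(i, j), ⟨hi, hj⟩, rfl⟩
  have hmem : (α - β).orderTop ∈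
      {o | ∃ i < mpuis α, ∃ j < mpuis β, o = (conj i α - conj j β).orderTop} :=
    ⟨0, (isRep_arc hα).pos, 0, (isRep_arc hβ).pos, by rw [conj_zero, conj_zero]⟩
  obtain ⟨c, hc, hmax⟩ := hfin.exists_maximal ⟨_, hmem⟩
  have hg : IsMaxConjOrder α β c := ⟨hc, fun o ho => (le_total o c).elim id (hmax ho)⟩
  exact ⟨c, hg, hg.2 hmem⟩

theorem exists_eq_orderTop_of_isMaxConjOrder {α' β' : HahnSeries ℚ ℂ} {c : WithTop ℚ}
    (hα : α ∈ D1) (hα' : α' ∈ D1) (h : germ α = germ α')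
    (hc : IsMaxConjOrder α' β' c) : ∃ k, c = (α - conj k β').orderTop := by
  obtain ⟨⟨i, -, j, -, rfl⟩, -⟩ := hc
  obtain ⟨k, rfl⟩ := exists_eq_conj_of_germ_eq hα' hα h.symm
  rw [conj_conj]
  obtain ⟨k', hk'⟩ := exists_conj_conj_eq hα (i + k)
  refine ⟨k' + j, ?_⟩
  rw [← orderTop_conj_sub_conj k', hk', conj_conj]

theorem hasContact_germ_cases {B : Filter (ℂ × ℂ)} {c : WithTop ℚ} (hα : α ∈ D1)
    (h : HasContact (germ α) B c) :
    (∃ β ∈ D1, B = germ β ∧ (α - β).orderTop = c) ∨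
      (c = 1 ∧ ∃ β ∈ D1, 1 < β.orderTop ∧ B = germ' β) := by
  obtain ⟨α', hα', β', hβ', ⟨h1, h2, h3⟩ | ⟨h1, -, h2, -⟩ | ⟨h1, h2, -⟩ | ⟨h1, h2, h3, h4⟩⟩ := h
  · obtain ⟨k, hk⟩ := exists_eq_orderTop_of_isMaxConjOrder hα hα' h1 h3
    exact Or.inl ⟨conj k β', conj_mem_D1 hβ' k, by rw [h2, germ_conj hβ'], hk.symm⟩
  · exact absurd h2 (germ_ne_germ' hα hα' h1)
  · exact absurd h2 (germ_ne_germ' hα hα' h1)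
  · exact Or.inr ⟨h4, β', hβ', h1, h3⟩

theorem germ'_injective (h : germ' α = germ' β) : germ α = germ β := by
  rw [germ'_eq_map_swap, germ'_eq_map_swap] at h
  exact map_injective Prod.swap_injective h

theorem hasContact_germ'_cases {B : Filter (ℂ × ℂ)} {c : WithTop ℚ} (hα : α ∈ D1)
    (hα1 : 1 < α.orderTop) (h : HasContact (germ' α) B c) :
    (∃ β ∈ D1, 1 < β.orderTop ∧ B = germ' β ∧ (α - β).orderTop = c) ∨
      (c = 1 ∧ ∃ β ∈ D1, B = germ β) := by
  obtain ⟨α', hα', β', hβ', ⟨h1, -⟩ | ⟨h1, h2, h3, h4, h5⟩ | ⟨h1, h2, h3, h4⟩ | ⟨h1, h2, -⟩⟩ := h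
  · exact absurd h1.symm (germ_ne_germ' hα' hα hα1)
  · obtain ⟨k, hk⟩ := exists_eq_orderTop_of_isMaxConjOrder hα hα' (germ'_injective h3) h5
    refine Or.inl ⟨conj k β', conj_mem_D1 hβ' k, by rwa [orderTop_conj], ?_, hk.symm⟩
    rw [h4, germ'_eq_map_swap, germ'_eq_map_swap, germ_conj hβ']
  · exact Or.inr ⟨h4, β', hβ', h3⟩
  · exact absurd h2.symm (germ_ne_germ' hα' hα hα1)

theorem exists_hasContact_germ (hα : α ∈ D1) (hβ : β ∈ D1) :
    ∃ c, HasContact (germ α) (germ β) c ∧ (α - β).orderTop ≤ c := by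
  obtain ⟨c, hc, hle⟩ := exists_isMaxConjOrder hα hβ
  exact ⟨c, ⟨α, hα, β, hβ, Or.inl ⟨rfl, rfl, hc⟩⟩, hle⟩

/-- The horn subspaces of the chart, described by coordinates. -/
theorem mem_horn_germ_iff {e : ℚ} (he : 1 ≤ e) (hα : α ∈ D1) {B : Filter (ℂ × ℂ)} :
    B ∈ horn e (germ α) ↔ (∃ β ∈ D1, B = germ β ∧ (e : WithTop ℚ) ≤ (α - β).orderTop) ∨
      (e = 1 ∧ ∃ β ∈ D1, 1 < β.orderTop ∧ B = germ' β) := by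
  constructor
  · rintro ⟨-, c, hc, hec⟩
    rcases hasContact_germ_cases hα hc with ⟨β, hβ, rfl, rfl⟩ | ⟨rfl, β, hβ, h1, rfl⟩
    · exact Or.inl ⟨β, hβ, rfl, hec⟩
    · exact Or.inr ⟨le_antisymm (by exact_mod_cast hec) he, β, hβ, h1, rfl⟩
  · rintro (⟨β, hβ, rfl, h⟩ | ⟨rfl, β, hβ, h1, rfl⟩)
    · obtain ⟨c, hc, hle⟩ := exists_hasContact_germ hα hβ
      exact ⟨germ_mem_CPstar hβ, c, hc, h.trans hle⟩
    · exact ⟨germ'_mem_CPstar hβ, 1, ⟨α, hα, β, hβ, Or.inr (Or.inr (Or.inr ⟨h1, rfl, rfl, rfl⟩))⟩,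
        by simp⟩

theorem mem_hornPlus_germ_iff {e : ℚ} (he : 1 ≤ e) (hα : α ∈ D1) {B : Filter (ℂ × ℂ)} :
    B ∈ hornPlus e (germ α) ↔ ∃ β ∈ D1, B = germ β ∧ (e : WithTop ℚ) < (α - β).orderTop := by
  constructor
  · rintro ⟨-, c, hc, hec⟩
    rcases hasContact_germ_cases hα hc with ⟨β, hβ, rfl, rfl⟩ | ⟨rfl, -⟩
    · exact ⟨β, hβ, rfl, hec⟩
    · exact absurd (by exact_mod_cast hec) (not_lt.mpr he)
  · rintro ⟨β, hβ, rfl, h⟩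
    obtain ⟨c, hc, hle⟩ := exists_hasContact_germ hα hβ
    exact ⟨germ_mem_CPstar hβ, c, hc, h.trans_le hle⟩

/-- The horn subspace of order `1` is the whole of `ℂP¹_*` which is covered by the two charts. -/
theorem mem_horn_one_iff {A : Filter (ℂ × ℂ)}
    (hA : (∃ α ∈ D1, A = germ α) ∨ ∃ α ∈ D1, 1 < α.orderTop ∧ A = germ' α)
    {B : Filter (ℂ × ℂ)} : B ∈ horn ((1 : ℚ) : WithTop ℚ) A ↔
      (∃ β ∈ D1, B = germ β) ∨ ∃ β ∈ D1, 1 < β.orderTop ∧ B = germ' β := by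
  rcases hA with ⟨α, hα, rfl⟩ | ⟨α, hα, hα1, rfl⟩
  · rw [mem_horn_germ_iff le_rfl hα]
    constructor
    · rintro (⟨β, hβ, rfl, -⟩ | ⟨-, h⟩)
      · exact Or.inl ⟨β, hβ, rfl⟩
      · exact Or.inr h
    · rintro (⟨β, hβ, rfl⟩ | h)
      · exact Or.inl ⟨β, hβ, rfl, one_le_orderTop_sub hα hβ⟩
      · exact Or.inr ⟨rfl, h⟩
  · constructor
    · rintro ⟨-, c, hc, -⟩
      rcases hasContact_germ'_cases hα hα1 hc with ⟨β, hβ, h1, h2, -⟩ | ⟨-, h⟩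
      · exact Or.inr ⟨β, hβ, h1, h2⟩
      · exact Or.inl h
    · rintro (⟨β, hβ, rfl⟩ | ⟨β, hβ, hβ1, rfl⟩)
      · exact ⟨germ_mem_CPstar hβ, 1,
          ⟨α, hα, β, hβ, Or.inr (Or.inr (Or.inl ⟨hα1, rfl, rfl, rfl⟩))⟩, by simp⟩
      · obtain ⟨c, hc, hle⟩ := exists_isMaxConjOrder hα hβ
        exact ⟨germ'_mem_CPstar hβ, c, ⟨α, hα, β, hβ, Or.inr (Or.inl ⟨hα1, hβ1, rfl, rfl, hc⟩)⟩,
          (one_le_orderTop_sub hα hβ).trans hle⟩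

theorem horn_germ_eq {e : ℚ} (he : 1 ≤ e) (hα : α ∈ D1) (hβ : β ∈ D1)
    (h : (e : WithTop ℚ) ≤ (α - β).orderTop) : horn e (germ α) = horn e (germ β) := by
  ext B
  rw [mem_horn_germ_iff he hα, mem_horn_germ_iff he hβ]
  refine or_congr_left ⟨?_, ?_⟩
  · rintro ⟨δ, hδ, rfl, h'⟩
    exact ⟨δ, hδ, rfl, le_orderTop_sub_trans (by rwa [orderTop_sub_comm]) h'⟩
  · rintro ⟨δ, hδ, rfl, h'⟩
    exact ⟨δ, hδ, rfl, le_orderTop_sub_trans h h'⟩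

theorem hornPlus_germ_eq {e : ℚ} (he : 1 ≤ e) (hα : α ∈ D1) (hβ : β ∈ D1)
    (h : (e : WithTop ℚ) < (α - β).orderTop) : hornPlus e (germ α) = hornPlus e (germ β) := by
  ext B
  rw [mem_hornPlus_germ_iff he hα, mem_hornPlus_germ_iff he hβ]
  constructor
  · rintro ⟨δ, hδ, rfl, h'⟩
    exact ⟨δ, hδ, rfl, lt_orderTop_sub_trans (by rwa [orderTop_sub_comm]) h'⟩
  · rintro ⟨δ, hδ, rfl, h'⟩
    exact ⟨δ, hδ, rfl, lt_orderTop_sub_trans h h'⟩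

end Germs

/-! ### Arc length and the curvature of a germ -/

section ArcLength

/-- The Euclidean norm on `ℂ²`. -/
noncomputable def nrm (p : ℂ × ℂ) : ℝ := Real.sqrt (‖p.1‖ ^ 2 + ‖p.2‖ ^ 2)

theorem nrm_sq (p : ℂ × ℂ) : nrm p ^ 2 = ‖p.1‖ ^ 2 + ‖p.2‖ ^ 2 := Real.sq_sqrt (by positivity)

theorem nrm_nonneg (p : ℂ × ℂ) : 0 ≤ nrm p := Real.sqrt_nonneg _

theorem nrm_eq_zero {p : ℂ × ℂ} : nrm p = 0 ↔ p = 0 := by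
  rw [nrm, Real.sqrt_eq_zero (by positivity)]
  constructor
  · intro h
    have h1 : ‖p.1‖ ^ 2 = 0 := by nlinarith [sq_nonneg ‖p.1‖, sq_nonneg ‖p.2‖]
    have h2 : ‖p.2‖ ^ 2 = 0 := by nlinarith [sq_nonneg ‖p.1‖, sq_nonneg ‖p.2‖]
    ext
    · simpa using h1
    · simpa using h2
  · rintro rfl
    simp

theorem nrm_pos {p : ℂ × ℂ} (h : p ≠ 0) : 0 < nrm p :=
  lt_of_le_of_ne (nrm_nonneg p) fun h0 => h (nrm_eq_zero.mp h0.symm)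

theorem nrm_smul (c : ℂ) (p : ℂ × ℂ) : nrm (c • p) = ‖c‖ * nrm p := by
  rw [nrm, nrm]
  have : ‖(c • p).1‖ ^ 2 + ‖(c • p).2‖ ^ 2 = ‖c‖ ^ 2 * (‖p.1‖ ^ 2 + ‖p.2‖ ^ 2) := by
    simp only [Prod.smul_fst, Prod.smul_snd, smul_eq_mul, norm_mul]
    ring
  rw [this, Real.sqrt_mul (by positivity), Real.sqrt_sq (norm_nonneg _)]

@[fun_prop]
theorem continuous_nrm : Continuous nrm := by
  unfold nrm
  fun_prop

theorem exists_eq_pow_smul {φ : ℂ → ℂ × ℂ} (hφ : AnalyticAt ℂ φ 0)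
    (h : ¬ ∀ᶠ t in 𝓝 (0 : ℂ), φ t = 0) :
    ∃ (k : ℕ) (ψ : ℂ → ℂ × ℂ), AnalyticAt ℂ ψ 0 ∧ ψ 0 ≠ 0 ∧
      ∀ᶠ t in 𝓝 (0 : ℂ), φ t = t ^ k • ψ t := by
  obtain ⟨k, ψ, h1, h2, h3⟩ := hφ.exists_eventuallyEq_pow_smul_nonzero_iff.mpr h
  exact ⟨k, ψ, h1, h2, by simpa using h3⟩

theorem IsArc.exists_eq_pow_smul {φ : ℂ → ℂ × ℂ} (hφ : IsArc φ) :
    ∃ (k : ℕ) (ψ : ℂ → ℂ × ℂ), 0 < k ∧ AnalyticAt ℂ ψ 0 ∧ ψ 0 ≠ 0 ∧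
      ∀ᶠ t in 𝓝 (0 : ℂ), φ t = t ^ k • ψ t := by
  obtain ⟨k, ψ, h1, h2, h3⟩ := ACampo.exists_eq_pow_smul hφ.1 hφ.2.2
  refine ⟨k, ψ, Nat.pos_of_ne_zero fun h0 => ?_, h1, h2, h3⟩
  have := h3.self_of_nhds
  rw [hφ.2.1, h0, pow_zero, one_smul] at this
  exact h2 this.symm

/-- The arc length of a holomorphic arc is asymptotic to the distance from the origin. -/
theorem tendsto_arcLength_div_nrm {φ : ℂ → ℂ × ℂ} (hφ : IsArc φ) :
    Tendsto (fun t => arcLength φ t / nrm (φ t)) (𝓝[≠] 0) (𝓝 1) := by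
  obtain ⟨k, ψ, hk, hψ, hψ0, hφψ⟩ := hφ.exists_eq_pow_smul
  obtain ⟨l, rfl⟩ : ∃ l, k = l + 1 := ⟨k - 1, by omega⟩
  set χ : ℂ → ℂ × ℂ := fun t => ((l : ℂ) + 1) • ψ t + t • deriv ψ t with hχdef
  have hχ : AnalyticAt ℂ χ 0 := by
    have := hψ.deriv
    fun_prop
  have hχ0 : χ 0 = ((l : ℂ) + 1) • ψ 0 := by simp [hχdef]
  have hderiv : ∀ᶠ t in 𝓝 (0 : ℂ), HasDerivAt φ (t ^ l • χ t) t := by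
    filter_upwards [hφψ.eventually_nhds, hψ.eventually_analyticAt] with t h1 h2
    have h3 : HasDerivAt (fun s : ℂ => s ^ (l + 1) • ψ s)
        (t ^ (l + 1) • deriv ψ t + (((l + 1 : ℕ) : ℂ) * t ^ l) • ψ t) t :=
      (hasDerivAt_pow (l + 1) t).smul h2.differentiableAt.hasDerivAt
    have h4 : HasDerivAt φ _ t := h3.congr_of_eventuallyEq h1
    convert h4 using 1
    simp only [hχdef, smul_add, smul_smul]
    rw [add_comm]
    congr 2
    push_cast
    ring
  -- The arc length, divided by the leading power of the parameter, is a parametric integral.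
  set J : ℂ → ℝ := fun t => ∫ r in (0 : ℝ)..1, r ^ l * nrm (χ (r * t)) with hJ
  obtain ⟨δ, hδ, hball⟩ := Metric.eventually_nhds_iff.mp (hderiv.and hχ.eventually_analyticAt)
  have hsmall : ∀ t : ℂ, ‖t‖ < δ → ∀ r : ℝ, r ∈ Set.Icc (0 : ℝ) 1 → dist ((r : ℂ) * t) 0 < δ := by
    intro t ht r hr
    rw [dist_zero_right, norm_mul, Complex.norm_real, Real.norm_of_nonneg hr.1]
    exact lt_of_le_of_lt (mul_le_of_le_one_left (norm_nonneg _) hr.2) ht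
  have hlen : ∀ t : ℂ, ‖t‖ < δ → arcLength φ t = ‖t‖ ^ (l + 1) * J t := by
    intro t ht
    rw [arcLength, hJ, ← intervalIntegral.integral_const_mul]
    refine intervalIntegral.integral_congr fun r hr => ?_
    rw [Set.uIcc_of_le zero_le_one] at hr
    have hd := (hball (hsmall t ht r hr)).1
    have h1 : HasDerivAt (fun x : ℝ => (x : ℂ) * t) t r := by
      simpa using (Complex.ofRealCLM.hasDerivAt (x := r)).mul_const t
    have h2 := hd.scomp r h1
    have h3 : HasDerivAt (fun x : ℝ => (φ (x * t)).1)
        (t * (((r : ℂ) * t) ^ l * (χ (r * t)).1)) r := by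
      have := (ContinuousLinearMap.fst ℝ ℂ ℂ).hasFDerivAt.comp_hasDerivAt r h2
      simpa [Function.comp_def] using this
    have h4 : HasDerivAt (fun x : ℝ => (φ (x * t)).2)
        (t * (((r : ℂ) * t) ^ l * (χ (r * t)).2)) r := by
      have := (ContinuousLinearMap.snd ℝ ℂ ℂ).hasFDerivAt.comp_hasDerivAt r h2
      simpa [Function.comp_def] using this
    simp only [h3.deriv, h4.deriv]
    have h5 := nrm_smul (t * ((r : ℂ) * t) ^ l) (χ (r * t))
    simp only [nrm, Prod.smul_fst, Prod.smul_snd, smul_eq_mul, mul_assoc] at h5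
    rw [h5, norm_mul, norm_pow, norm_mul, Complex.norm_real, Real.norm_of_nonneg hr.1, nrm]
    ring
  -- By dominated convergence `J` tends to `nrm (ψ 0)`, as does `nrm (φ t)` divided by the same
  -- power.
  have hJcont : ContinuousAt J 0 := by
    obtain ⟨C, hC⟩ : ∃ C : ℝ, ∀ᶠ t in 𝓝 (0 : ℂ), nrm (χ t) ≤ C := by
      refine ⟨nrm (χ 0) + 1, ?_⟩
      have : ContinuousAt (fun t => nrm (χ t)) 0 :=
        continuous_nrm.continuousAt.comp hχ.continuousAt
      exact this.eventually_le_const (lt_add_one _)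
    obtain ⟨η, hη, hηC⟩ := Metric.eventually_nhds_iff.mp hC
    have hmem : ∀ᶠ t in 𝓝 (0 : ℂ), ‖t‖ < min δ η := by
      have := Metric.ball_mem_nhds (0 : ℂ) (lt_min hδ hη)
      filter_upwards [this] with t ht using mem_ball_zero_iff.mp ht
    refine intervalIntegral.continuousAt_of_dominated_interval (bound := fun _ => C) ?_ ?_
      intervalIntegrable_const ?_
    · filter_upwards [hmem] with t ht
      refine ContinuousOn.aestronglyMeasurable ?_ measurableSet_uIoc
      intro r hr
      rw [Set.uIoc_of_le zero_le_one] at hr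
      have hr' := hsmall t (ht.trans_le (min_le_left _ _)) r ⟨hr.1.le, hr.2⟩
      have h1 : ContinuousAt (fun r : ℝ => χ (r * t)) r := by
        refine ContinuousAt.comp (f := fun r : ℝ => (r : ℂ) * t) (g := χ)
          (hball hr').2.continuousAt ?_
        fun_prop
      have h2 : ContinuousAt (fun r : ℝ => nrm (χ (r * t))) r :=
        continuous_nrm.continuousAt.comp h1
      exact ((continuousAt_id.pow l).mul h2).continuousWithinAt
    · filter_upwards [hmem] with t ht
      refine Eventually.of_forall fun r hr => ?_
      rw [Set.uIoc_of_le zero_le_one] at hr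
      have h1 : nrm (χ (r * t)) ≤ C := hηC (by
        rw [dist_zero_right, norm_mul, Complex.norm_real, Real.norm_of_nonneg hr.1.le]
        exact lt_of_le_of_lt (mul_le_of_le_one_left (norm_nonneg _) hr.2)
          (ht.trans_le (min_le_right _ _)))
      rw [norm_mul, Real.norm_of_nonneg (nrm_nonneg _), norm_pow, Real.norm_of_nonneg hr.1.le]
      calc r ^ l * nrm (χ (r * t)) ≤ 1 * nrm (χ (r * t)) := by
            gcongr
            · exact nrm_nonneg _
            · exact pow_le_one₀ hr.1.le hr.2
        _ ≤ C := by rwa [one_mul]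
    · refine Eventually.of_forall fun r _ => ?_
      have h1 : ContinuousAt (fun t : ℂ => χ (r * t)) 0 := by
        refine ContinuousAt.comp (f := fun t : ℂ => (r : ℂ) * t) (g := χ) ?_ (by fun_prop)
        simpa using hχ.continuousAt
      exact continuousAt_const.mul (continuous_nrm.continuousAt.comp h1)
  have hJ0 : J 0 = nrm (ψ 0) := by
    simp only [hJ, mul_zero, hχ0, nrm_smul, intervalIntegral.integral_mul_const, integral_pow]
    have : ‖(l : ℂ) + 1‖ = (l : ℝ) + 1 := by
      have := Complex.norm_natCast (l + 1)
      push_cast at this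
      exact this
    rw [this]
    have : (l : ℝ) + 1 ≠ 0 := by positivity
    field_simp
    simp
  have hlim : Tendsto (fun t => J t / nrm (ψ t)) (𝓝[≠] 0) (𝓝 1) := by
    have h1 : ContinuousAt (fun t => J t / nrm (ψ t)) 0 :=
      hJcont.div (continuous_nrm.continuousAt.comp hψ.continuousAt) (nrm_pos hψ0).ne'
    rw [ContinuousAt, hJ0, div_self (nrm_pos hψ0).ne'] at h1
    exact h1.mono_left nhdsWithin_le_nhds
  refine hlim.congr' ?_
  have hmem : ∀ᶠ t in 𝓝 (0 : ℂ), ‖t‖ < δ := by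
    filter_upwards [Metric.ball_mem_nhds (0 : ℂ) hδ] with t ht using mem_ball_zero_iff.mp ht
  filter_upwards [nhdsWithin_le_nhds hmem, nhdsWithin_le_nhds hφψ, self_mem_nhdsWithin]
    with t h1 h2 h3
  have h4 : ‖t‖ ≠ 0 := norm_ne_zero_iff.mpr h3
  rw [hlen t h1, h2, nrm_smul, norm_pow, mul_div_mul_left _ _ (pow_ne_zero _ h4)]

end ArcLength

section Curvature

/-- The germ `A` without the origin. -/
def punct (A : Filter (ℂ × ℂ)) : Filter (ℂ × ℂ) := A ⊓ 𝓟 {0}ᶜ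

variable {f : ℂ × ℂ → ℂ} {φ : ℂ → ℂ × ℂ} {A : Filter (ℂ × ℂ)} {L L' : WithTop ℚ} {a a' : ℝ}

theorem IsArc.eventually_ne (hφ : IsArc φ) : ∀ᶠ t in 𝓝[≠] (0 : ℂ), φ t ≠ 0 := by
  obtain h | h := hφ.1.eventually_eq_zero_or_eventually_ne_zero
  · exact absurd h hφ.2.2
  · exact h

theorem IsArc.map_eq_punct (hφ : IsArc φ) : map φ (𝓝[≠] 0) = punct (image φ) := by
  rw [punct, image, ← Filter.push_pull, comap_principal]
  congr 1
  have : ∀ᶠ t in 𝓝 (0 : ℂ), t ∈ ({0}ᶜ : Set ℂ) ↔ t ∈ φ ⁻¹' {0}ᶜ := by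
    have := eventually_nhdsWithin_iff.mp hφ.eventually_ne
    filter_upwards [this] with t ht
    constructor
    · exact fun h => ht h
    · rintro h rfl
      exact h hφ.2.1
  rw [nhdsWithin]
  ext s
  simp only [mem_inf_principal]
  exact eventually_congr (this.mono fun t ht => by rw [ht])

theorem IsArc.tendsto_nrm (hφ : IsArc φ) :
    Tendsto (fun t => nrm (φ t)) (𝓝[≠] 0) (𝓝[>] 0) := by
  rw [tendsto_nhdsWithin_iff]
  refine ⟨?_, hφ.eventually_ne.mono fun t ht => nrm_pos ht⟩
  have : ContinuousAt (fun t => nrm (φ t)) 0 :=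
    continuous_nrm.continuousAt.comp hφ.1.continuousAt
  rw [ContinuousAt, hφ.2.1, nrm_eq_zero.mpr rfl] at this
  exact this.mono_left nhdsWithin_le_nhds

theorem neBot_punct (hA : A ∈ CPstar) : (punct A).NeBot := by
  obtain ⟨φ, hφ, rfl⟩ := hA
  rw [← hφ.map_eq_punct]
  infer_instance

theorem tendsto_nrm_punct (hA : A ∈ CPstar) : Tendsto nrm (punct A) (𝓝[>] 0) := by
  obtain ⟨φ, hφ, rfl⟩ := hA
  rw [← hφ.map_eq_punct, tendsto_map'_iff]
  exact hφ.tendsto_nrm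

/-- In limits of quotients by powers, the arc length may be replaced by the distance from the
origin. -/
theorem tendsto_div_arcLength_iff (hφ : IsArc φ) (g : ℂ × ℂ → ℝ) (q : ℝ) (a : ℝ) :
    Tendsto (fun t => g (φ t) / arcLength φ t ^ q) (𝓝[≠] 0) (𝓝 a) ↔
      Tendsto (fun t => g (φ t) / nrm (φ t) ^ q) (𝓝[≠] 0) (𝓝 a) := by
  have h1 := tendsto_arcLength_div_nrm hφ
  have h2 : Tendsto (fun t => (arcLength φ t / nrm (φ t)) ^ q) (𝓝[≠] 0) (𝓝 1) := by
    simpa using h1.rpow_const (p := q) (Or.inl one_ne_zero)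
  have h3 : ∀ᶠ t in 𝓝[≠] (0 : ℂ), 0 < arcLength φ t := by
    filter_upwards [h1.eventually_const_lt zero_lt_one, hφ.eventually_ne] with t h h'
    have := mul_pos h (nrm_pos h')
    rwa [div_mul_cancel₀ _ (nrm_pos h').ne'] at this
  have h4 : ∀ᶠ t in 𝓝[≠] (0 : ℂ), (arcLength φ t / nrm (φ t)) ^ q * nrm (φ t) ^ q =
      arcLength φ t ^ q := by
    filter_upwards [h3, hφ.eventually_ne] with t h h'
    rw [Real.div_rpow h.le (nrm_nonneg _), div_mul_cancel₀]
    exact (Real.rpow_pos_of_pos (nrm_pos h') q).ne'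
  constructor
  · intro h
    have h5 := h.mul h2
    rw [mul_one] at h5
    refine h5.congr' ?_
    filter_upwards [h3, hφ.eventually_ne, h4] with t h6 h7 h8
    have h9 := (Real.rpow_pos_of_pos (nrm_pos h7) q).ne'
    have h10 := (Real.rpow_pos_of_pos h6 q).ne'
    rw [← h8] at h10 ⊢
    have h11 := left_ne_zero_of_mul h10
    field_simp
  · intro h
    have h5 := h.div h2 one_ne_zero
    rw [div_one] at h5
    refine h5.congr' ?_
    filter_upwards [h4] with t h8
    rw [← h8, Pi.div_apply, div_div, mul_comm (nrm (φ t) ^ q)]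

/-- The curvature of a germ, computed on the germ itself instead of a parametrization. -/
theorem hasK_iff (hA : A ∈ CPstar) : HasK f A L a ↔
    (∀ᶠ p in punct A, dz f p ≠ 0 ∨ dw f p ≠ 0) ∧
    ((L = ⊤ ∧ a = 0 ∧ ∀ᶠ p in punct A, K f p = 0) ∨
      ∃ q : ℚ, L = q ∧ 0 < a ∧ Tendsto (fun p => K f p / nrm p ^ (q : ℝ)) (punct A) (𝓝 a)) := by
  have key : ∀ φ, IsArc φ → A = image φ → (HasCurv f φ L a ↔
      (∀ᶠ p in punct A, dz f p ≠ 0 ∨ dw f p ≠ 0) ∧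
      ((L = ⊤ ∧ a = 0 ∧ ∀ᶠ p in punct A, K f p = 0) ∨
      ∃ q : ℚ, L = q ∧ 0 < a ∧ Tendsto (fun p => K f p / nrm p ^ (q : ℝ)) (punct A) (𝓝 a))) := by
    rintro φ hφ rfl
    rw [← hφ.map_eq_punct, HasCurv]
    simp only [eventually_map, tendsto_map'_iff, Function.comp_def,
      tendsto_div_arcLength_iff hφ (K f)]
  constructor
  · rintro ⟨φ, hφ, hAφ, h⟩
    exact (key φ hφ hAφ).mp h
  · intro h
    obtain ⟨φ, hφ, hAφ⟩ := hA
    exact ⟨φ, hφ, hAφ, (key φ hφ hAφ).mpr h⟩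

theorem HasK.mem_CPstar (h : HasK f A L a) : A ∈ CPstar := by
  obtain ⟨φ, hφ, hA, -⟩ := h
  exact ⟨φ, hφ, hA⟩

theorem tendsto_rpow_nrm_punct (hA : A ∈ CPstar) {r : ℝ} (hr : 0 < r) :
    Tendsto (fun p => nrm p ^ r) (punct A) (𝓝 0) := by
  have h1 : Tendsto nrm (punct A) (𝓝 0) := (tendsto_nrm_punct hA).mono_right nhdsWithin_le_nhds
  simpa [hr.ne'] using h1.rpow_const (p := r) (Or.inr hr.le)

/-- An upper bound for the growth of the curvature is a lower bound for `L_*`. -/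
theorem HasK.le_of_bounded (h : HasK f A L a) {r : ℚ} {C : ℝ}
    (hC : ∀ᶠ p in punct A, K f p / nrm p ^ (r : ℝ) ≤ C) : (r : WithTop ℚ) ≤ L := by
  have hA := h.mem_CPstar
  have := neBot_punct hA
  rcases ((hasK_iff hA).mp h).2 with ⟨rfl, -⟩ | ⟨q, rfl, ha, hq⟩
  · exact le_top
  by_contra! hlt
  have hqr : (0 : ℝ) < (r : ℝ) - q := by
    have : q < r := by exact_mod_cast hlt
    have : (q : ℝ) < r := by exact_mod_cast this
    linarith
  have h1 := (tendsto_rpow_nrm_punct hA hqr).const_mul C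
  rw [mul_zero] at h1
  refine absurd (le_of_tendsto_of_tendsto hq h1 ?_) (not_le.mpr ha)
  have hpos : ∀ᶠ p in punct A, 0 < nrm p := (tendsto_nrm_punct hA).eventually self_mem_nhdsWithin
  filter_upwards [hC, hpos] with p h2 h3
  have h4 : K f p / nrm p ^ (q : ℝ) = K f p / nrm p ^ (r : ℝ) * nrm p ^ ((r : ℝ) - q) := by
    rw [Real.rpow_sub h3]
    have := (Real.rpow_pos_of_pos h3 (q : ℝ)).ne'
    have := (Real.rpow_pos_of_pos h3 (r : ℝ)).ne'
    field_simp
  rw [h4]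
  exact mul_le_mul_of_nonneg_right h2 (Real.rpow_nonneg h3.le _)

theorem HasK.le_of_tendsto (h : HasK f A L a) {r : ℚ} {c : ℝ}
    (hc : Tendsto (fun p => K f p / nrm p ^ (r : ℝ)) (punct A) (𝓝 c)) : (r : WithTop ℚ) ≤ L :=
  h.le_of_bounded (C := c + 1) (hc.eventually_le_const (lt_add_one c))

theorem HasK.lt_of_tendsto_zero (h : HasK f A L a) {r : ℚ}
    (hc : Tendsto (fun p => K f p / nrm p ^ (r : ℝ)) (punct A) (𝓝 0)) : (r : WithTop ℚ) < L := by
  refine lt_of_le_of_ne (h.le_of_tendsto hc) ?_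
  rintro rfl
  have hA := h.mem_CPstar
  have := neBot_punct hA
  rcases ((hasK_iff hA).mp h).2 with ⟨h1, -⟩ | ⟨q, h1, ha, hq⟩
  · exact WithTop.coe_ne_top h1
  · have : r = q := by exact_mod_cast h1
    subst this
    exact ha.ne (tendsto_nhds_unique hc hq)

theorem HasK.unique (h : HasK f A L a) (h' : HasK f A L' a') : L = L' ∧ a = a' := by
  have hA := h.mem_CPstar
  have := neBot_punct hA
  have key : ∀ {L L' : WithTop ℚ} {a a' : ℝ}, HasK f A L a → HasK f A L' a' → L ≤ L' := by
    intro L L' a a' h h'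
    rcases ((hasK_iff hA).mp h).2 with ⟨rfl, -, h0⟩ | ⟨q, rfl, ha, hq⟩
    · rcases ((hasK_iff hA).mp h').2 with ⟨rfl, -⟩ | ⟨q', rfl, ha', hq'⟩
      · exact le_rfl
      · exfalso
        refine ha'.ne (tendsto_nhds_unique (tendsto_const_nhds.congr' ?_) hq')
        filter_upwards [h0] with p hp
        rw [hp, zero_div]
    · exact h'.le_of_tendsto hq
  have hL : L = L' := le_antisymm (key h h') (key h' h)
  refine ⟨hL, ?_⟩
  subst hL
  rcases ((hasK_iff hA).mp h).2 with ⟨h1, ha, -⟩ | ⟨q, h1, ha, hq⟩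
  · rcases ((hasK_iff hA).mp h').2 with ⟨h2, ha', -⟩ | ⟨q', h2, ha', hq'⟩
    · rw [ha, ha']
    · exact absurd (h1.symm.trans h2).symm (WithTop.coe_ne_top)
  · rcases ((hasK_iff hA).mp h').2 with ⟨h2, ha', -⟩ | ⟨q', h2, ha', hq'⟩
    · exact absurd (h1.symm.trans h2) (WithTop.coe_ne_top)
    · have : q = q' := by exact_mod_cast h1.symm.trans h2
      subst this
      exact tendsto_nhds_unique hq hq'

theorem HasL.unique (h : HasL f A L) (h' : HasL f A L') : L = L' := by
  obtain ⟨a, h⟩ := h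
  obtain ⟨a', h'⟩ := h'
  exact (h.unique h').1

/-- The gradient of `f`. -/
noncomputable def grad (f : ℂ × ℂ → ℂ) (p : ℂ × ℂ) : ℂ × ℂ := (dz f p, dw f p)

theorem grad_ne_zero_iff {p : ℂ × ℂ} : grad f p ≠ 0 ↔ dz f p ≠ 0 ∨ dw f p ≠ 0 := by
  rw [grad, Ne, Prod.mk_eq_zero, not_and_or]

theorem K_eq (f : ℂ × ℂ → ℂ) (p : ℂ × ℂ) : K f p = 2 * ‖Δ f p‖ ^ 2 / nrm (grad f p) ^ 6 := by
  rw [K, show nrm (grad f p) ^ 6 = (nrm (grad f p) ^ 2) ^ 3 by ring, nrm_sq]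
  rfl

/-- The leading coefficient of the curvature along an arc, from those of the arc, of the gradient
and of `Δ_f`. -/
theorem tendsto_K_div_nrm {ν Q E B : ℕ} {r : ℝ} {ψ g : ℂ → ℂ × ℂ} {D : ℂ → ℂ}
    (hψ : ContinuousAt ψ 0) (hg : ContinuousAt g 0) (hD : ContinuousAt D 0)
    (hψ0 : ψ 0 ≠ 0) (hg0 : g 0 ≠ 0) (hr : r * ν = 2 * (B : ℝ) - 2 * E - 6 * Q)
    (hφ : ∀ᶠ t in 𝓝[≠] (0 : ℂ), φ t = t ^ ν • ψ t)
    (hgrad : ∀ᶠ t in 𝓝[≠] (0 : ℂ), grad f (φ t) = t ^ Q • g t)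
    (hΔ : ∀ᶠ t in 𝓝[≠] (0 : ℂ), t ^ E * Δ f (φ t) = t ^ B * D t) :
    Tendsto (fun t => K f (φ t) / nrm (φ t) ^ r) (𝓝[≠] 0)
      (𝓝 (2 * ‖D 0‖ ^ 2 / nrm (g 0) ^ 6 / nrm (ψ 0) ^ r)) := by
  have h1 : ContinuousAt (fun t => 2 * ‖D t‖ ^ 2 / nrm (g t) ^ 6 / nrm (ψ t) ^ r) 0 := by
    have h2 : ContinuousAt (fun t => nrm (g t)) 0 := continuous_nrm.continuousAt.comp hg
    have h3 : ContinuousAt (fun t => nrm (ψ t)) 0 := continuous_nrm.continuousAt.comp hψ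
    refine ((continuousAt_const.mul (hD.norm.pow 2)).div (h2.pow 6)
      (pow_ne_zero _ (nrm_pos hg0).ne')).div (h3.rpow_const (Or.inl (nrm_pos hψ0).ne')) ?_
    exact (Real.rpow_pos_of_pos (nrm_pos hψ0) r).ne'
  refine (h1.tendsto.mono_left nhdsWithin_le_nhds).congr' ?_
  filter_upwards [hφ, hgrad, hΔ, self_mem_nhdsWithin] with t h2 h3 h4 h5
  have ht : 0 < ‖t‖ := norm_pos_iff.mpr h5
  have h6 : ‖t‖ ^ E * ‖Δ f (φ t)‖ = ‖t‖ ^ B * ‖D t‖ := by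
    rw [← norm_pow, ← norm_mul, h4, norm_mul, norm_pow]
  have h7 : ‖Δ f (φ t)‖ = ‖t‖ ^ B * ‖D t‖ / ‖t‖ ^ E := by
    rw [eq_div_iff (by positivity), mul_comm, h6]
  rw [K_eq, h7, h3, h2, nrm_smul, nrm_smul, norm_pow, norm_pow,
    Real.mul_rpow (by positivity) (nrm_nonneg _), ← Real.rpow_natCast_mul ht.le,
    mul_comm (ν : ℝ), hr, Real.rpow_sub ht, Real.rpow_sub ht]
  have e1 : ‖t‖ ^ (2 * (B : ℝ)) = (‖t‖ ^ B) ^ 2 := by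
    rw [← pow_mul, ← Real.rpow_natCast]; push_cast; ring_nf
  have e2 : ‖t‖ ^ (2 * (E : ℝ)) = (‖t‖ ^ E) ^ 2 := by
    rw [← pow_mul, ← Real.rpow_natCast]; push_cast; ring_nf
  have e3 : ‖t‖ ^ (6 * (Q : ℝ)) = (‖t‖ ^ Q) ^ 6 := by
    rw [← pow_mul, ← Real.rpow_natCast]; push_cast; ring_nf
  rw [e1, e2, e3]
  have hB : ‖t‖ ^ B ≠ 0 := by positivity
  have hE : ‖t‖ ^ E ≠ 0 := by positivity
  have hQ : ‖t‖ ^ Q ≠ 0 := by positivity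
  generalize ‖t‖ ^ B = x at *
  generalize ‖t‖ ^ E = y at *
  generalize ‖t‖ ^ Q = z at *
  field_simp

theorem analyticAt_Δ {p : ℂ × ℂ} (hf : AnalyticAt ℂ f p) : AnalyticAt ℂ (Δ f) p := by
  have e : Δ f = fun p => -(dz (dz f) p * dw f p ^ 2) + dw (dz f) p * dz f p * dw f p +
      dz (dw f) p * dz f p * dw f p - dw (dw f) p * dz f p ^ 2 := by
    funext p
    rw [Δ, Matrix.det_fin_three]
    simp
    ring
  rw [e]
  have h1 := analyticAt_dz hf
  have h2 := analyticAt_dw hf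
  have h3 := analyticAt_dz h1
  have h4 := analyticAt_dw h1
  have h5 := analyticAt_dz h2
  have h6 := analyticAt_dw h2
  exact ((((h3.mul (h2.pow 2)).neg).add ((h4.mul h1).mul h2)).add ((h5.mul h1).mul h2)).sub
    (h6.mul (h1.pow 2))

theorem analyticAt_grad {p : ℂ × ℂ} (hf : AnalyticAt ℂ f p) : AnalyticAt ℂ (grad f) p :=
  (analyticAt_dz hf).prod (analyticAt_dw hf)

theorem IsArc.analyticAt_comp {E : Type*} [NormedAddCommGroup E] [NormedSpace ℂ E] {g : ℂ × ℂ → E}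
    (hφ : IsArc φ) (hg : AnalyticAt ℂ g 0) : AnalyticAt ℂ (fun t => g (φ t)) 0 :=
  AnalyticAt.fun_comp (by rw [hφ.2.1]; exact hg) hφ.1

/-- The formula for `L_*` in terms of orders. -/
theorem hasL_of_eq_pow (hφ : IsArc φ) {ν Q B : ℕ} {ψ g : ℂ → ℂ × ℂ} {D : ℂ → ℂ}
    (hψ : ContinuousAt ψ 0) (hg : ContinuousAt g 0) (hD : ContinuousAt D 0)
    (hψ0 : ψ 0 ≠ 0) (hg0 : g 0 ≠ 0) (hD0 : D 0 ≠ 0) (hν : 0 < ν)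
    (hφψ : ∀ᶠ t in 𝓝 (0 : ℂ), φ t = t ^ ν • ψ t)
    (hgrad : ∀ᶠ t in 𝓝 (0 : ℂ), grad f (φ t) = t ^ Q • g t)
    (hΔ : ∀ᶠ t in 𝓝 (0 : ℂ), Δ f (φ t) = t ^ B * D t) :
    HasL f (image φ) (((2 * (B : ℚ) - 6 * Q) / ν : ℚ) : WithTop ℚ) := by
  have hν' : (ν : ℝ) ≠ 0 := by exact_mod_cast hν.ne'
  have h1 := tendsto_K_div_nrm (f := f) (φ := φ) (E := 0) (B := B) (Q := Q) (ν := ν)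
    (r := (((2 * (B : ℚ) - 6 * Q) / ν : ℚ) : ℝ)) hψ hg hD hψ0 hg0
    (by push_cast; field_simp; ring)
    (hφψ.filter_mono nhdsWithin_le_nhds) (hgrad.filter_mono nhdsWithin_le_nhds)
    (by simpa using hΔ.filter_mono nhdsWithin_le_nhds)
  refine ⟨2 * ‖D 0‖ ^ 2 / nrm (g 0) ^ 6 /
    nrm (ψ 0) ^ ((((2 * (B : ℚ) - 6 * Q) / ν : ℚ) : ℝ)), (hasK_iff ⟨φ, hφ, rfl⟩).mpr ⟨?_, ?_⟩⟩
  · rw [← hφ.map_eq_punct, eventually_map]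
    have hgne : ∀ᶠ t in 𝓝 (0 : ℂ), g t ≠ 0 := hg.eventually_ne hg0
    filter_upwards [nhdsWithin_le_nhds hgrad, nhdsWithin_le_nhds hgne, self_mem_nhdsWithin]
      with t h2 h3 h4
    rw [← grad_ne_zero_iff, h2]
    exact smul_ne_zero (pow_ne_zero _ h4) h3
  · refine Or.inr ⟨_, rfl, ?_, ?_⟩
    · have := nrm_pos hψ0
      have := nrm_pos hg0
      have := norm_pos_iff.mpr hD0
      positivity
    · rw [← hφ.map_eq_punct, tendsto_map'_iff]
      exact h1

/-- The curvature of a germ is defined if the gradient does not vanish identically along it. -/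
theorem exists_hasK (hf : AnalyticAt ℂ f 0) (hφ : IsArc φ)
    (hgrad : ¬ ∀ᶠ t in 𝓝 (0 : ℂ), grad f (φ t) = 0) : ∃ L a, HasK f (image φ) L a := by
  obtain ⟨ν, ψ, hν, hψ, hψ0, hφψ⟩ := hφ.exists_eq_pow_smul
  obtain ⟨Q, g, hg, hg0, hgeq⟩ := exists_eq_pow_smul (hφ.analyticAt_comp (analyticAt_grad hf)) hgrad
  have hΔ := hφ.analyticAt_comp (analyticAt_Δ hf)
  by_cases h0 : ∀ᶠ t in 𝓝 (0 : ℂ), Δ f (φ t) = 0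
  · refine ⟨⊤, 0, (hasK_iff ⟨φ, hφ, rfl⟩).mpr ⟨?_, Or.inl ⟨rfl, rfl, ?_⟩⟩⟩
    · rw [← hφ.map_eq_punct, eventually_map]
      have hgne : ∀ᶠ t in 𝓝 (0 : ℂ), g t ≠ 0 := hg.continuousAt.eventually_ne hg0
      filter_upwards [nhdsWithin_le_nhds hgeq, nhdsWithin_le_nhds hgne, self_mem_nhdsWithin]
        with t h2 h3 h4
      rw [← grad_ne_zero_iff, h2]
      exact smul_ne_zero (pow_ne_zero _ h4) h3
    · rw [← hφ.map_eq_punct, eventually_map]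
      filter_upwards [nhdsWithin_le_nhds h0] with t ht
      rw [K_eq, ht]
      simp
  · obtain ⟨B, D, hD, hD0, hDeq⟩ := hΔ.exists_eventuallyEq_pow_smul_nonzero_iff.mpr h0
    obtain ⟨a, ha⟩ := hasL_of_eq_pow hφ hψ.continuousAt hg.continuousAt hD.continuousAt
      hψ0 hg0 hD0 hν hφψ hgeq (by simpa using hDeq)
    exact ⟨_, a, ha⟩

end Curvature

/-! ### The leading coefficient of the curvature along an arc -/

section LeadingCoefficient

variable {f : ℂ × ℂ → ℂ} {M : ℕ} {ζ : ℂ → ℂ}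

theorem Δ_eq (f : ℂ × ℂ → ℂ) (p : ℂ × ℂ) (hs : dw (dz f) p = dz (dw f) p) (κ : ℂ) :
    Δ f p = -dz (dz f) p * (κ * dz f p + dw f p) ^ 2 +
      2 * dz f p * (κ * dz f p + dw f p) * (κ * dz (dz f) p + dw (dz f) p) -
      dz f p ^ 2 * ((κ * dz (dw f) p + dw (dw f) p) + κ * (κ * dz (dz f) p + dw (dz f) p)) := by
  rw [Δ, Matrix.det_fin_three]
  simp [← hs]
  ring

theorem isArc_of_eq_pow_mul (hM : 0 < M) {ζ₁ : ℂ → ℂ} (hζ₁ : AnalyticAt ℂ ζ₁ 0)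
    (hζ : ∀ᶠ t in 𝓝 (0 : ℂ), ζ t = t ^ M * ζ₁ t) : IsArc fun t => (ζ t, t ^ M) := by
  have hζa : AnalyticAt ℂ ζ 0 :=
    (show AnalyticAt ℂ (fun t => t ^ M * ζ₁ t) 0 by fun_prop).congr
      (hζ.mono fun _ h => h.symm)
  refine ⟨hζa.prod (by fun_prop), ?_, fun h0 => ?_⟩
  · simp [hζ.self_of_nhds, hM.ne']
  · obtain ⟨t, ht, ht0⟩ := ((h0.filter_mono (nhdsWithin_le_nhds (s := {0}ᶜ))).and
      self_mem_nhdsWithin).exists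
    have : t ^ M = 0 := congrArg Prod.snd ht
    exact ht0 (by simpa using (pow_eq_zero_iff hM.ne').mp this)

/-- The leading coefficient of `Δ_f`, where `q + 1` and `b` are the order and the leading
coefficient of `f` along an arc, `p₁` and `p₂` are the leading coefficients of `f_z` and
`f_zz`, and `flag` tells whether the degree is `1`. -/
def leadΔ (flag : Prop) [Decidable flag] (q b p₁ p₂ : ℂ) : ℂ :=
  -p₂ * ((q + 1) * b) ^ 2 + if flag then q * ((q + 1) * b) * p₁ ^ 2 else 0

/-- The gradient and `Δ_f` along the arc `(ζ (t), t ^ M)`.  The derivatives of `f` in the direction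
`(κ, 1)` of the arc are found by differentiation of `f`, `f_z` and `f_w` along the arc. -/
theorem exists_grad_Δ_along (hf : AnalyticAt ℂ f 0) (hM : 0 < M) {ζ₁ P₁ F₁ Z₁ : ℂ → ℂ} {Q E : ℕ}
    (hME : M ≤ E) (hζ₁ : AnalyticAt ℂ ζ₁ 0) (hP₁ : AnalyticAt ℂ P₁ 0) (hF₁ : AnalyticAt ℂ F₁ 0)
    (hZ₁ : AnalyticAt ℂ Z₁ 0) (hζ : ∀ᶠ t in 𝓝 (0 : ℂ), ζ t = t ^ M * ζ₁ t)
    (hP : ∀ᶠ t in 𝓝[≠] (0 : ℂ), dz f (ζ t, t ^ M) = t ^ Q * P₁ t)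
    (hF : ∀ᶠ t in 𝓝[≠] (0 : ℂ), f (ζ t, t ^ M) = t ^ (Q + M) * F₁ t)
    (hZ : ∀ᶠ t in 𝓝[≠] (0 : ℂ), t ^ E * dz (dz f) (ζ t, t ^ M) = t ^ Q * Z₁ t) :
    ∃ (g : ℂ → ℂ × ℂ) (D : ℂ → ℂ), AnalyticAt ℂ g 0 ∧ ContinuousAt D 0 ∧
      g 0 = (P₁ 0, ((Q : ℂ) / M + 1) * F₁ 0 - ζ₁ 0 * P₁ 0) ∧
      D 0 = leadΔ (E = M) (Q / M) (F₁ 0) (P₁ 0) (Z₁ 0) ∧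
      (∀ᶠ t in 𝓝[≠] (0 : ℂ), grad f (ζ t, t ^ M) = t ^ Q • g t) ∧
      ∀ᶠ t in 𝓝[≠] (0 : ℂ), t ^ E * Δ f (ζ t, t ^ M) = t ^ (3 * Q) * D t := by
  have hM' : (M : ℂ) ≠ 0 := by exact_mod_cast hM.ne'
  have hφ := isArc_of_eq_pow_mul hM hζ₁ hζ
  set κ : ℂ → ℂ := fun t => ζ₁ t + t * deriv ζ₁ t / M with hκ
  set A : ℂ → ℂ := fun t => (((Q : ℂ) + M) * F₁ t + t * deriv F₁ t) / M with hA
  set B : ℂ → ℂ := fun t => (Q * P₁ t + t * deriv P₁ t) / M with hB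
  set W : ℂ → ℂ := fun t => A t - κ t * P₁ t with hW
  set C : ℂ → ℂ := fun t => (Q * W t + t * deriv W t) / M + κ t * B t with hC
  have hζd := hζ₁.deriv
  have hFd := hF₁.deriv
  have hPd := hP₁.deriv
  have hκa : AnalyticAt ℂ κ 0 := by fun_prop
  have hAa : AnalyticAt ℂ A 0 := by fun_prop
  have hBa : AnalyticAt ℂ B 0 := by fun_prop
  have hWa : AnalyticAt ℂ W 0 := by fun_prop
  have hWd := hWa.deriv
  have hCa : AnalyticAt ℂ C 0 := by fun_prop
  have hpow : ∀ (n : ℕ) (t : ℂ), t * ((n : ℂ) * t ^ (n - 1)) = n * t ^ n := by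
    intro n t
    rcases Nat.eq_zero_or_pos n with rfl | hn
    · simp
    · rw [mul_left_comm, ← pow_succ', Nat.sub_add_cancel hn]
  have hev : ∀ {P : ℂ → Prop}, (∀ᶠ t in 𝓝 (0 : ℂ), P t) → ∀ᶠ t in 𝓝[≠] (0 : ℂ), P t :=
    fun h => h.filter_mono nhdsWithin_le_nhds
  have hpunct : ∀ {P : ℂ → Prop}, (∀ᶠ t in 𝓝[≠] (0 : ℂ), P t) →
      ∀ᶠ t in 𝓝[≠] (0 : ℂ), ∀ᶠ s in 𝓝 t, P s := by
    intro P h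
    filter_upwards [eventually_eventually_nhdsWithin.mpr h, self_mem_nhdsWithin] with t h1 h2
    rwa [isOpen_compl_singleton.nhdsWithin_eq h2] at h1
  have hfa : ∀ᶠ t in 𝓝 (0 : ℂ), AnalyticAt ℂ f (ζ t, t ^ M) := by
    have h1 : Tendsto (fun t => (ζ t, t ^ M)) (𝓝 (0 : ℂ)) (𝓝 0) := by
      have h0 : ((ζ 0, (0 : ℂ) ^ M) : ℂ × ℂ) = 0 := hφ.2.1
      have := hφ.1.continuousAt
      rw [ContinuousAt] at this
      rwa [h0] at this
    exact h1.eventually hf.eventually_analyticAt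
  -- The velocity of the arc is `M t ^ (M - 1) • (κ, 1)`.
  have hvel : ∀ᶠ t in 𝓝 (0 : ℂ), HasDerivAt ζ ((M : ℂ) * t ^ (M - 1) * κ t) t := by
    filter_upwards [hζ.eventually_nhds, hζ₁.eventually_analyticAt] with t h1 h2
    have h3 := ((hasDerivAt_pow M t).mul h2.differentiableAt.hasDerivAt).congr_of_eventuallyEq h1
    refine h3.congr_deriv ?_
    simp only [hκ, mul_add]
    congr 1
    rw [mul_div_assoc', eq_div_iff hM']
    linear_combination (-deriv ζ₁ t) * hpow M t
  have hchain : ∀ {g : ℂ × ℂ → ℂ}, (∀ᶠ t in 𝓝 (0 : ℂ), AnalyticAt ℂ g (ζ t, t ^ M)) →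
      ∀ {n : ℕ} {c : ℂ → ℂ}, AnalyticAt ℂ c 0 →
      (∀ᶠ t in 𝓝[≠] (0 : ℂ), g (ζ t, t ^ M) = t ^ n * c t) →
      ∀ᶠ t in 𝓝[≠] (0 : ℂ), t ^ M * (κ t * dz g (ζ t, t ^ M) + dw g (ζ t, t ^ M)) =
        t ^ n * ((n * c t + t * deriv c t) / M) := by
    intro g hg n c hc hgc
    filter_upwards [hev hg, hev hvel, hpunct hgc, hev hc.eventually_analyticAt]
      with t h1 h2 h3 h4
    have h5 := hasDerivAt_arc h1 h2 (hasDerivAt_pow M t)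
    have h6 := (((hasDerivAt_pow n t).mul h4.differentiableAt.hasDerivAt).congr_of_eventuallyEq h3)
    have h7 := h5.unique h6
    rw [mul_div_assoc', eq_div_iff hM']
    have e1 := hpow M t
    have e2 := hpow n t
    linear_combination (-(κ t * dz g (ζ t, t ^ M) + dw g (ζ t, t ^ M))) * e1 + t * h7 + c t * e2
  have hAeq : ∀ᶠ t in 𝓝[≠] (0 : ℂ),
      κ t * dz f (ζ t, t ^ M) + dw f (ζ t, t ^ M) = t ^ Q * A t := by
    filter_upwards [hchain hfa hF₁ hF, self_mem_nhdsWithin] with t h1 h2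
    have h3 : t ^ M ≠ 0 := pow_ne_zero _ h2
    apply mul_left_cancel₀ h3
    rw [h1, hA, pow_add]
    push_cast
    ring
  have hWeq : ∀ᶠ t in 𝓝[≠] (0 : ℂ), dw f (ζ t, t ^ M) = t ^ Q * W t := by
    filter_upwards [hAeq, hP] with t h1 h2
    rw [h2] at h1
    simp only [hW]
    linear_combination h1
  have hBeq := hchain (hfa.mono fun t h => analyticAt_dz h) hP₁ hP
  have hCeq := hchain (hfa.mono fun t h => analyticAt_dw h) hWa hWeq
  refine ⟨fun t => (P₁ t, W t),
    fun t => -Z₁ t * A t ^ 2 + t ^ (E - M) * (2 * P₁ t * A t * B t - P₁ t ^ 2 * C t),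
    hP₁.prod hWa, ?_, ?_, ?_, ?_, ?_⟩
  · have : AnalyticAt ℂ (fun t => -Z₁ t * A t ^ 2 +
        t ^ (E - M) * (2 * P₁ t * A t * B t - P₁ t ^ 2 * C t)) 0 := by fun_prop
    exact this.continuousAt
  · simp only [hW, hA, hκ, zero_mul, add_zero, zero_div]
    congr 2
    field_simp
  · have hA0 : A 0 = ((Q : ℂ) / M + 1) * F₁ 0 := by
      simp only [hA, zero_mul, add_zero]
      field_simp
    have hB0 : B 0 = (Q : ℂ) / M * P₁ 0 := by
      simp only [hB, zero_mul, add_zero]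
      ring
    have hC0 : C 0 = (Q : ℂ) / M * A 0 := by
      simp only [hC, hW, hB0, zero_mul, add_zero]
      ring
    simp only [leadΔ, hB0, hC0, hA0]
    split_ifs with h
    · subst h
      simp
      ring
    · have : E - M ≠ 0 := by omega
      simp [this]
  · filter_upwards [hP, hWeq] with t h1 h2
    ext
    · simpa [grad] using h1
    · simpa [grad] using h2
  · filter_upwards [hP, hAeq, hBeq, hCeq, hZ, hev hfa] with t h1 h2 h3 h4 h5 h6
    rw [Δ_eq f _ (dw_dz_comm h6) (κ t), h1] at *
    rw [h2]
    have h7 : t ^ E = t ^ (E - M) * t ^ M := by rw [← pow_add, Nat.sub_add_cancel hME]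
    set fzz := dz (dz f) (ζ t, t ^ M)
    set b := κ t * fzz + dw (dz f) (ζ t, t ^ M)
    set c := κ t * dz (dw f) (ζ t, t ^ M) + dw (dw f) (ζ t, t ^ M)
    have h3' : t ^ M * b = t ^ Q * B t := h3
    have h4' : t ^ M * c = t ^ Q * ((Q * W t + t * deriv W t) / M) := h4
    have h8 : t ^ M * (c + κ t * b) = t ^ Q * C t := by
      simp only [hC]
      linear_combination h4' + κ t * h3'
    have h9 : t ^ (3 * Q) = t ^ Q * t ^ Q * t ^ Q := by ring
    rw [h9]
    generalize hT : t ^ Q = T at *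
    generalize hR : t ^ (E - M) = R at *
    calc t ^ E * (-fzz * (T * A t) ^ 2 + 2 * (T * P₁ t) * (T * A t) * b -
          (T * P₁ t) ^ 2 * (c + κ t * b))
        = -(t ^ E * fzz) * (T * A t) ^ 2 + R * (2 * (T * P₁ t) * (T * A t) * (t ^ M * b) -
          (T * P₁ t) ^ 2 * (t ^ M * (c + κ t * b))) := by rw [h7]; ring
      _ = _ := by rw [h5, h3', h8]; ring

/-- The coefficient `a` of the curvature `a s ^ (- 2 e)` in terms of the leading coefficients along
an arc with tangent `[c : 1]`. -/
noncomputable def leadK (flag : Prop) [Decidable flag] (e : ℚ) (q c b p₁ p₂ : ℂ) : ℝ :=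
  2 * ‖leadΔ flag q b p₁ p₂‖ ^ 2 / nrm (p₁, (q + 1) * b - c * p₁) ^ 6 /
    nrm (c, 1) ^ ((-2 * e : ℚ) : ℝ)

/-- Since `Δ_f` has at least the order `3 Q - E` along the arc and the gradient has the order `Q`,
the quotient `K / s ^ (- 2 e)` has a finite limit, which is zero if `Δ_f` has a larger order. -/
theorem tendsto_K_along (hf : AnalyticAt ℂ f 0) (hM : 0 < M) {ζ₁ P₁ F₁ Z₁ : ℂ → ℂ} {Q E : ℕ}
    {e : ℚ} (he : e * M = E)
    (hME : M ≤ E) (hζ₁ : AnalyticAt ℂ ζ₁ 0) (hP₁ : AnalyticAt ℂ P₁ 0) (hF₁ : AnalyticAt ℂ F₁ 0)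
    (hZ₁ : AnalyticAt ℂ Z₁ 0) (hζ : ∀ᶠ t in 𝓝 (0 : ℂ), ζ t = t ^ M * ζ₁ t)
    (hP : ∀ᶠ t in 𝓝[≠] (0 : ℂ), dz f (ζ t, t ^ M) = t ^ Q * P₁ t)
    (hF : ∀ᶠ t in 𝓝[≠] (0 : ℂ), f (ζ t, t ^ M) = t ^ (Q + M) * F₁ t)
    (hZ : ∀ᶠ t in 𝓝[≠] (0 : ℂ), t ^ E * dz (dz f) (ζ t, t ^ M) = t ^ Q * Z₁ t)
    (hne : P₁ 0 ≠ 0 ∨ F₁ 0 ≠ 0) :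
    (∀ᶠ p in punct (map (fun t => (ζ t, t ^ M)) (𝓝 0)), dz f p ≠ 0 ∨ dw f p ≠ 0) ∧
    Tendsto (fun p => K f p / nrm p ^ ((-2 * e : ℚ) : ℝ))
      (punct (map (fun t => (ζ t, t ^ M)) (𝓝 0)))
      (𝓝 (leadK (E = M) e (Q / M) (ζ₁ 0) (F₁ 0) (P₁ 0) (Z₁ 0))) := by
  have hM' : (M : ℝ) ≠ 0 := by exact_mod_cast hM.ne'
  have hM'' : (M : ℂ) ≠ 0 := by exact_mod_cast hM.ne'
  have hφ := isArc_of_eq_pow_mul hM hζ₁ hζ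
  obtain ⟨g, D, hg, hD, hg0, hD0, hgeq, hDeq⟩ :=
    exists_grad_Δ_along hf hM hME hζ₁ hP₁ hF₁ hZ₁ hζ hP hF hZ
  have hq : (Q : ℂ) / M + 1 ≠ 0 := by
    have h1 : (Q : ℂ) + M ≠ 0 := by exact_mod_cast (by omega : Q + M ≠ 0)
    have : (Q : ℂ) / M + 1 = (Q + M) / M := by field_simp
    rw [this]
    exact div_ne_zero h1 hM''
  have hg0' : g 0 ≠ 0 := by
    rw [hg0, Ne, Prod.mk_eq_zero]
    rintro ⟨h1, h2⟩
    rw [h1, mul_zero, sub_zero, mul_eq_zero] at h2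
    exact hne.elim (fun h => h h1) fun h => h2.elim hq h
  have hpe : punct (map (fun t => (ζ t, t ^ M)) (𝓝 0)) =
      map (fun t => (ζ t, t ^ M)) (𝓝[≠] (0 : ℂ)) := hφ.map_eq_punct.symm
  rw [hpe]
  constructor
  · rw [eventually_map]
    filter_upwards [hgeq, nhdsWithin_le_nhds (hg.continuousAt.eventually_ne hg0'),
      self_mem_nhdsWithin] with t h1 h2 h3
    rw [← grad_ne_zero_iff, h1]
    exact smul_ne_zero (pow_ne_zero _ h3) h2
  · rw [tendsto_map'_iff]
    have heR : (e : ℝ) * M = E := by exact_mod_cast congrArg (fun x : ℚ => (x : ℝ)) he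
    have := tendsto_K_div_nrm (f := f) (φ := fun t => (ζ t, t ^ M)) (ν := M) (Q := Q) (E := E)
      (B := 3 * Q) (r := ((-2 * e : ℚ) : ℝ)) (ψ := fun t => (ζ₁ t, 1)) (g := g) (D := D)
      (hζ₁.continuousAt.prodMk continuousAt_const) hg.continuousAt hD (by simp) hg0'
      (by push_cast; linear_combination (-2) * heR)
      (by
        filter_upwards [nhdsWithin_le_nhds hζ] with t ht
        ext
        · simpa using ht
        · simp)
      hgeq hDeq
    rw [hg0, hD0] at this
    exact this

end LeadingCoefficient

/-! ### Interchange of the coordinates -/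

section Swap

variable {f : ℂ × ℂ → ℂ} {A : Filter (ℂ × ℂ)} {L : WithTop ℚ} {a : ℝ}

theorem dz_swap (f : ℂ × ℂ → ℂ) : dz (f ∘ Prod.swap) = dw f ∘ Prod.swap := rfl

theorem dw_swap (f : ℂ × ℂ → ℂ) : dw (f ∘ Prod.swap) = dz f ∘ Prod.swap := rfl

theorem K_swap (f : ℂ × ℂ → ℂ) (p : ℂ × ℂ) : K (f ∘ Prod.swap) p = K f p.swap := by
  have h : Δ (f ∘ Prod.swap) p = Δ f p.swap := by
    rw [Δ, Δ, Matrix.det_fin_three, Matrix.det_fin_three]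
    simp only [dz_swap, dw_swap, Function.comp_apply]
    simp
    ring
  rw [K, K, h, dz_swap, dw_swap, Function.comp_apply, Function.comp_apply]
  ring_nf

theorem nrm_swap (p : ℂ × ℂ) : nrm p.swap = nrm p := by
  rw [nrm, nrm, Prod.fst_swap, Prod.snd_swap, add_comm]

theorem punct_map_swap (A : Filter (ℂ × ℂ)) :
    punct (map Prod.swap A) = map Prod.swap (punct A) := by
  rw [punct, punct, ← Filter.push_pull, comap_principal]
  congr 3
  ext p
  simp only [Set.mem_preimage, Set.mem_compl_iff, Set.mem_singleton_iff, Prod.ext_iff]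
  simp [and_comm]

theorem map_swap_mem_CPstar (hA : A ∈ CPstar) : map Prod.swap A ∈ CPstar := by
  obtain ⟨φ, ⟨h1, h2, h3⟩, rfl⟩ := hA
  refine ⟨fun t => (φ t).swap, ⟨?_, by simp [h2], fun h0 => h3 ?_⟩, by simp [image, map_map]; rfl⟩
  · exact AnalyticAt.prod (analyticAt_snd.comp h1) (analyticAt_fst.comp h1)
  · filter_upwards [h0] with t ht
    rw [← Prod.swap_swap (φ t), ht]
    rfl

theorem hasK_map_swap (hA : A ∈ CPstar) :
    HasK f (map Prod.swap A) L a ↔ HasK (f ∘ Prod.swap) A L a := by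
  rw [hasK_iff hA, hasK_iff (map_swap_mem_CPstar hA), punct_map_swap]
  simp only [eventually_map, tendsto_map'_iff, Function.comp_def, nrm_swap]
  simp only [or_comm (a := dz f _ ≠ 0)]
  simp only [← K_swap]
  rfl

theorem hasL_germ'_iff {α : HahnSeries ℚ ℂ} (hα : α ∈ D1) :
    HasL f (germ' α) L ↔ HasL (f ∘ Prod.swap) (germ α) L := by
  rw [germ'_eq_map_swap]
  exact exists_congr fun a => hasK_map_swap (germ_mem_CPstar hα)

end Swap

/-! ### Perturbation of an arc -/

section Perturbation

variable {f : ℂ × ℂ → ℂ} {M : ℕ} {ζ : ℂ → ℂ}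

theorem eventually_eval_ne_zero {p : Polynomial ℂ} (hp : p ≠ 0) :
    ∀ᶠ v : ℂ in cofinite, p.eval v ≠ 0 := by
  refine p.roots.toFinset.finite_toSet.subset fun v hv => ?_
  simp only [Set.mem_compl_iff, Set.mem_ofPred_eq, not_not] at hv
  simpa [hp] using hv

/-- If the order of the gradient does not change under perturbations of order `E`, then the generic
perturbation does not increase the order of the curvature, as it does not increase the
order of `Δ_f`. -/
theorem eventually_hasL_perturb (hf : AnalyticAt ℂ f 0) (hM : 0 < M) {ζ₁ : ℂ → ℂ} {E Q : ℕ}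
    (hME : M ≤ E) (hζ₁ : AnalyticAt ℂ ζ₁ 0) (hζ : ∀ᶠ t in 𝓝 (0 : ℂ), ζ t = t ^ M * ζ₁ t)
    (hgrad : ∀ v : ℂ, ∃ g : ℂ → ℂ × ℂ, AnalyticAt ℂ g 0 ∧ g 0 ≠ 0 ∧
      ∀ᶠ t in 𝓝 (0 : ℂ), grad f (ζ t + t ^ E * v, t ^ M) = t ^ Q • g t)
    {L : WithTop ℚ} (hL : HasL f (map (fun t => (ζ t, t ^ M)) (𝓝 0)) L) (hLtop : L ≠ ⊤) :
    ∀ᶠ v in cofinite, ∃ L' ≤ L, HasL f (map (fun t => (ζ t + t ^ E * v, t ^ M)) (𝓝 0)) L' := by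
  have hφ := isArc_of_eq_pow_mul hM hζ₁ hζ
  have hζa : AnalyticAt ℂ ζ 0 := analyticAt_fst.comp hφ.1
  have hζ0 : ζ 0 = 0 := congrArg Prod.fst hφ.2.1
  have hψ : ∀ v : ℂ, ∃ ψ : ℂ → ℂ, AnalyticAt ℂ ψ 0 ∧
      ∀ᶠ t in 𝓝 (0 : ℂ), ζ t + t ^ E * v = t ^ M * ψ t := by
    intro v
    refine ⟨fun t => ζ₁ t + t ^ (E - M) * v, by fun_prop, ?_⟩
    filter_upwards [hζ] with t ht
    rw [ht, mul_add, ← mul_assoc, ← pow_add, Nat.add_sub_cancel' hME]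
  have hform : ∀ (v : ℂ) (B : ℕ) (D : ℂ → ℂ), ContinuousAt D 0 → D 0 ≠ 0 →
      (∀ᶠ t in 𝓝 (0 : ℂ), Δ f (ζ t + t ^ E * v, t ^ M) = t ^ B * D t) →
      HasL f (map (fun t => (ζ t + t ^ E * v, t ^ M)) (𝓝 0))
        (((2 * (B : ℚ) - 6 * Q) / M : ℚ) : WithTop ℚ) := by
    intro v B D hD hD0 hDeq
    obtain ⟨ψ, hψa, hψ⟩ := hψ v
    obtain ⟨g, hg, hg0, hgeq⟩ := hgrad v
    refine hasL_of_eq_pow (isArc_of_eq_pow_mul hM hψa hψ) (ψ := fun t => (ψ t, 1))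
      (hψa.continuousAt.prodMk continuousAt_const) hg.continuousAt hD (by simp) hg0 hD0 hM
      ?_ hgeq hDeq
    filter_upwards [hψ] with t ht
    ext
    · simpa using ht
    · simp
  set δ : ℂ × ℂ → ℂ := fun x => Δ f (ζ x.2 + x.1, x.2 ^ M) with hδ
  have hδa : AnalyticAt ℂ δ 0 := by
    refine AnalyticAt.comp₂ (h := Δ f) (f := fun x : ℂ × ℂ => ζ x.2 + x.1)
      (g := fun x => x.2 ^ M) ?_ ?_ (by fun_prop)
    · simpa [hM.ne', hζ0, ← Prod.zero_eq_mk] using analyticAt_Δ hf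
    · exact (AnalyticAt.fun_comp (g := ζ) (f := fun x : ℂ × ℂ => x.2) hζa analyticAt_snd).add
        analyticAt_fst
  have htc0 : taylorCoeff δ 0 = fun t => Δ f (ζ t, t ^ M) := by
    funext t
    simp [taylorCoeff, hδ]
  -- `Δ_f` does not vanish identically along the unperturbed arc.
  have hne : analyticOrderAt (taylorCoeff δ 0) 0 ≠ ⊤ := by
    intro htop
    rw [htc0, analyticOrderAt_eq_top] at htop
    obtain ⟨a, ha⟩ := hL
    have h1 := (hasK_iff ⟨_, hφ, rfl⟩).mp ha
    have h2 : HasK f (map (fun t => (ζ t, t ^ M)) (𝓝 0)) ⊤ 0 := by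
      refine (hasK_iff ⟨_, hφ, rfl⟩).mpr ⟨h1.1, Or.inl ⟨rfl, rfl, ?_⟩⟩
      rw [← hφ.map_eq_punct, eventually_map]
      filter_upwards [nhdsWithin_le_nhds htop] with t ht
      rw [K_eq, ht]
      simp
    exact hLtop (ha.unique h2).1
  -- The generic order `b` of `Δ_f` along the perturbations is at most the order `B` along the arc.
  obtain ⟨b, p, G, hp, hG, hGp, hGeq, hb, -⟩ := exists_scaling hδa (hM.trans_le hME) hne
  obtain ⟨B, hB⟩ := ENat.ne_top_iff_exists.mp hne
  obtain ⟨D, hD, hD0, hDeq⟩ :=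
    ((analyticAt_taylorCoeff hδa 0).analyticOrderAt_eq_natCast).mp hB.symm
  have hbB : b ≤ B := by
    have := hb 0
    rw [← hB] at this
    exact_mod_cast (by simpa using this : (b : ℕ∞) ≤ B)
  have hL0 : L = (((2 * (B : ℚ) - 6 * Q) / M : ℚ) : WithTop ℚ) := by
    have h1 := hform 0 B D hD.continuousAt hD0 (by
      filter_upwards [hDeq] with t ht
      rw [htc0] at ht
      simpa using ht)
    simp only [mul_zero, add_zero] at h1
    exact hL.unique h1
  filter_upwards [eventually_eval_ne_zero hp] with v hv
  refine ⟨(((2 * (b : ℚ) - 6 * Q) / M : ℚ) : WithTop ℚ), ?_, ?_⟩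
  · rw [hL0, WithTop.coe_le_coe]
    have h1 : (b : ℚ) ≤ B := by exact_mod_cast hbB
    gcongr
  · have hGv : AnalyticAt ℂ (fun t => G (v, t)) 0 :=
      analyticAt_pair (a := fun _ => v) (b := fun t => t) (hG v) analyticAt_const analyticAt_id
    refine hform v b (fun t => G (v, t)) hGv.continuousAt (by rwa [hGp]) ?_
    have ht : Tendsto (fun t : ℂ => ((v, t) : ℂ × ℂ)) (𝓝 0) (𝓝 (v, 0)) := by
      have : ContinuousAt (fun t : ℂ => ((v, t) : ℂ × ℂ)) 0 := by fun_prop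
      exact this
    exact ht.eventually (hGeq v)

end Perturbation

/-! ### Orders along an arc -/

section Orders

variable {f g : ℂ × ℂ → ℂ} {M : ℕ} {ζ : ℂ → ℂ} {α : HahnSeries ℚ ℂ}

theorem coe_le_map_div_iff (hM : 0 < M) {q : ℚ} {Q : ℕ} (hq : q * M = Q) (n : ℕ∞) :
    (q : WithTop ℚ) ≤ WithTop.map (fun n : ℕ => (n : ℚ) / M) n ↔ (Q : ℕ∞) ≤ n := by
  have hM' : (0 : ℚ) < M := by exact_mod_cast hM
  induction n using ENat.recTopCoe with
  | top => exact ⟨fun _ => le_top, fun _ => le_top⟩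
  | coe n =>
    rw [Nat.cast_le, ← Nat.cast_le (α := ℚ), ← hq, ← le_div_iff₀ hM']
    exact WithTop.coe_le_coe

theorem map_div_eq_coe_iff (hM : 0 < M) {q : ℚ} {Q : ℕ} (hq : q * M = Q) (n : ℕ∞) :
    WithTop.map (fun n : ℕ => (n : ℚ) / M) n = q ↔ n = Q := by
  have hM' : (M : ℚ) ≠ 0 := by exact_mod_cast hM.ne'
  induction n using ENat.recTopCoe with
  | top => exact ⟨fun h => absurd h WithTop.top_ne_coe, fun h => absurd h (ENat.top_ne_natCast Q)⟩
  | coe n =>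
    rw [Nat.cast_inj, ← Nat.cast_inj (R := ℚ), ← hq, ← div_eq_iff hM']
    exact WithTop.coe_eq_coe

theorem analyticOrderAt_prodMk {a b : ℂ → ℂ} (ha : AnalyticAt ℂ a 0) (hb : AnalyticAt ℂ b 0) :
    analyticOrderAt (fun t => (a t, b t)) 0 = min (analyticOrderAt a 0) (analyticOrderAt b 0) := by
  refine ENat.eq_of_forall_natCast_le_iff fun n => ?_
  rw [le_min_iff, natCast_le_analyticOrderAt (ha.prod hb), natCast_le_analyticOrderAt ha,
    natCast_le_analyticOrderAt hb]
  constructor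
  · rintro ⟨u, hu, h⟩
    exact ⟨⟨fun t => (u t).1, analyticAt_fst.comp hu, h.mono fun t ht => congrArg Prod.fst ht⟩,
      ⟨fun t => (u t).2, analyticAt_snd.comp hu, h.mono fun t ht => congrArg Prod.snd ht⟩⟩
  · rintro ⟨⟨u, hu, h⟩, v, hv, h'⟩
    refine ⟨fun t => (u t, v t), hu.prod hv, ?_⟩
    filter_upwards [h, h'] with t h1 h2
    ext
    · exact h1
    · exact h2

theorem IsRep.apply_zero (h : IsRep M ζ α) (hα : α ∈ D1) : ζ 0 = 0 := by
  rw [← h.coeff_zero]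
  exact HahnSeries.coeff_eq_zero_of_lt_orderTop
    (lt_of_lt_of_le (by exact_mod_cast zero_lt_one) hα.1)

theorem IsRep.analyticAt_comp (h : IsRep M ζ α) (hα : α ∈ D1) {E : Type*} [NormedAddCommGroup E]
    [NormedSpace ℂ E] {g : ℂ × ℂ → E} (hg : AnalyticAt ℂ g 0) :
    AnalyticAt ℂ (fun t => g (ζ t, t ^ M)) 0 := by
  refine AnalyticAt.comp₂ ?_ h.analyticAt (by fun_prop)
  simpa [h.apply_zero hα, h.pos.ne', ← Prod.zero_eq_mk] using hg

theorem IsRep.orderAlong_eq (h : IsRep M ζ α) (hα : α ∈ D1) (hg : AnalyticAt ℂ g 0) :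
    orderAlong g α =
      WithTop.map (fun n : ℕ => (n : ℚ) / M) (analyticOrderAt (fun t => g (ζ t, t ^ M)) 0) := by
  obtain ⟨k, hk, hM, he⟩ := h.arc_eq hα
  have h1 : analyticOrderAt (fun t => g (ζ t, t ^ M)) 0 =
      analyticOrderAt (fun t => g (arc α t)) 0 * k := by
    rw [← analyticOrderAt_comp_pow ((isArc_arc hα).analyticAt_comp hg) hk.ne']
    refine analyticOrderAt_congr ?_
    filter_upwards [he] with t ht
    rw [ht]
  have hk' : (k : ℚ) ≠ 0 := by exact_mod_cast hk.ne'
  rw [orderAlong, h1]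
  induction analyticOrderAt (fun t => g (arc α t)) 0 using ENat.recTopCoe with
  | top =>
    rw [ENat.top_mul (by exact_mod_cast hk.ne')]
    rfl
  | coe n =>
    rw [← Nat.cast_mul]
    change ((_ : ℚ) : WithTop ℚ) = ((_ : ℚ) : WithTop ℚ)
    rw [hM]
    push_cast
    rw [mul_div_mul_right _ _ hk']

theorem IsRep.gradOrder_eq (h : IsRep M ζ α) (hα : α ∈ D1) (hf : AnalyticAt ℂ f 0) :
    gradOrder f α = WithTop.map (fun n : ℕ => (n : ℚ) / M)
      (analyticOrderAt (fun t => grad f (ζ t, t ^ M)) 0) := by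
  have hmono : Monotone (WithTop.map (fun n : ℕ => (n : ℚ) / M)) :=
    WithTop.monotone_map_iff.mpr fun a b hab => by gcongr
  rw [gradOrder, h.orderAlong_eq hα (analyticAt_dz hf), h.orderAlong_eq hα (analyticAt_dw hf)]
  refine (hmono.map_min).symm.trans (congrArg _ ?_)
  exact (analyticOrderAt_prodMk (h.analyticAt_comp hα (analyticAt_dz hf))
    (h.analyticAt_comp hα (analyticAt_dw hf))).symm

theorem gradOrder_ne_top_of_hasL (hf : AnalyticAt ℂ f 0) (hα : α ∈ D1) {L : WithTop ℚ}
    (h : HasL f (germ α) L) : gradOrder f α ≠ ⊤ := by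
  obtain ⟨a, ha⟩ := h
  have h1 := ((hasK_iff (germ_mem_CPstar hα)).mp ha).1
  have hr := isRep_arc hα
  rw [germ, ← (isArc_arc hα).map_eq_punct, eventually_map] at h1
  intro h2
  rw [hr.gradOrder_eq hα hf] at h2
  have h3 : analyticOrderAt (fun t => grad f ((arc α t).1, t ^ mpuis α)) 0 = ⊤ := by
    cases hn : analyticOrderAt (fun t => grad f ((arc α t).1, t ^ mpuis α)) 0 with
    | top => rfl
    | coe n =>
      rw [hn] at h2
      exact absurd h2 (WithTop.coe_ne_top)
  rw [analyticOrderAt_eq_top] at h3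
  obtain ⟨t, h4, h5⟩ := (h1.and (nhdsWithin_le_nhds h3)).exists
  exact grad_ne_zero_iff.mpr h4 h5

theorem exists_hasK_germ (hf : AnalyticAt ℂ f 0) (hα : α ∈ D1)
    (h : ∀ᶠ p in punct (germ α), dz f p ≠ 0 ∨ dw f p ≠ 0) : ∃ L a, HasK f (germ α) L a := by
  refine exists_hasK hf (isArc_arc hα) fun h0 => ?_
  rw [germ, ← (isArc_arc hα).map_eq_punct, eventually_map] at h
  obtain ⟨t, h1, h2⟩ := (h.and (nhdsWithin_le_nhds h0)).exists
  exact grad_ne_zero_iff.mpr h1 h2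

end Orders

/-! ### Leading coefficients along an arc -/

section Lead

variable {f : ℂ × ℂ → ℂ} {α : HahnSeries ℚ ℂ} {e q : ℚ} {b p₁ p₂ : ℂ}

/-- Along `α`, the coefficients of `y ^ (q + 1)` in `f`, of `y ^ q` in `f_z` and of `y ^ (q - e)` in
`f_zz` are `b`, `p₁` and `p₂`, and there are no terms of lower order. -/
def Lead (f : ℂ × ℂ → ℂ) (α : HahnSeries ℚ ℂ) (e q : ℚ) (b p₁ p₂ : ℂ) : Prop :=
  ∃ (M : ℕ) (ζ : ℂ → ℂ) (E Q : ℕ) (F P Z : ℂ → ℂ), IsRep M ζ α ∧ e * M = E ∧ q * M = Q ∧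
    AnalyticAt ℂ F 0 ∧ AnalyticAt ℂ P 0 ∧ AnalyticAt ℂ Z 0 ∧
    (∀ᶠ t in 𝓝[≠] (0 : ℂ), f (ζ t, t ^ M) = t ^ (Q + M) * F t) ∧
    (∀ᶠ t in 𝓝[≠] (0 : ℂ), dz f (ζ t, t ^ M) = t ^ Q * P t) ∧
    (∀ᶠ t in 𝓝[≠] (0 : ℂ), t ^ E * dz (dz f) (ζ t, t ^ M) = t ^ Q * Z t) ∧
    F 0 = b ∧ P 0 = p₁ ∧ Z 0 = p₂

theorem le_of_mul_natCast {M E : ℕ} (he : 1 ≤ e) (heM : e * M = E) : M ≤ E := by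
  have h0 : (0 : ℚ) ≤ M := by positivity
  have : (M : ℚ) ≤ E := by rw [← heM]; nlinarith
  exact_mod_cast this

theorem analyticOrderAt_eq_of_eq_pow_mul {E : Type*} [NormedAddCommGroup E] [NormedSpace ℂ E]
    {g u : ℂ → E} {n : ℕ} (hg : AnalyticAt ℂ g 0) (hu : AnalyticAt ℂ u 0)
    (h : ∀ᶠ t in 𝓝[≠] (0 : ℂ), g t = t ^ n • u t) :
    analyticOrderAt g 0 = n + analyticOrderAt u 0 := by
  have h1 : g =ᶠ[𝓝 0] (fun t => t ^ n) • u :=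
    (hg.frequently_eq_iff_eventually_eq (g := (fun t => t ^ n) • u)
      ((show AnalyticAt ℂ (fun t : ℂ => t ^ n) 0 by fun_prop).smul hu)).mp h.frequently
  rw [analyticOrderAt_congr h1, analyticOrderAt_smul (by fun_prop) hu]
  have := analyticOrderAt_centeredMonomial (𝕜 := ℂ) (z₀ := 0) (n := n)
  congr 1
  simpa [Pi.pow_def] using this

theorem leadK_congr {s t : Prop} [Decidable s] [Decidable t] (h : s ↔ t) (e : ℚ)
    (q c b p₁ p₂ : ℂ) : leadK s e q c b p₁ p₂ = leadK t e q c b p₁ p₂ := by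
  simp only [leadK, leadΔ, h]

theorem Lead.orderAlong (hf : AnalyticAt ℂ f 0) (hα : α ∈ D1) (h : Lead f α e q b p₁ p₂) :
    ((q + 1 : ℚ) : WithTop ℚ) ≤ orderAlong f α ∧
      (b ≠ 0 ↔ ACampo.orderAlong f α = ((q + 1 : ℚ) : WithTop ℚ)) := by
  obtain ⟨M, ζ, E, Q, F, P, Z, hr, heM, hqM, hFa, hPa, hZa, hF, hP, hZ, rfl, rfl, rfl⟩ := h
  have h1 : (q + 1) * M = ((Q + M : ℕ) : ℚ) := by push_cast; linear_combination hqM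
  have h2 := analyticOrderAt_eq_of_eq_pow_mul (hr.analyticAt_comp hα hf) hFa hF
  rw [hr.orderAlong_eq hα hf, coe_le_map_div_iff hr.pos h1, map_div_eq_coe_iff hr.pos h1, h2,
    ← hFa.analyticOrderAt_eq_zero]
  refine ⟨le_self_add, ?_⟩
  constructor
  · intro h
    rw [h, add_zero]
  · intro h
    have h3 : ((Q + M : ℕ) : ℕ∞) + analyticOrderAt F 0 = ((Q + M : ℕ) : ℕ∞) + 0 := by
      rw [h, add_zero]
    exact ENat.add_right_injective_of_ne_top (ENat.natCast_ne_top _) h3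

theorem Lead.curvature (hf : AnalyticAt ℂ f 0) (hα : α ∈ D1) (he : 1 ≤ e)
    (h : Lead f α e q b p₁ p₂) (hne : p₁ ≠ 0 ∨ b ≠ 0) :
    (∀ᶠ p in punct (germ α), dz f p ≠ 0 ∨ dw f p ≠ 0) ∧
      Tendsto (fun p => K f p / nrm p ^ ((-2 * e : ℚ) : ℝ)) (punct (germ α))
        (𝓝 (leadK (e = 1) e q (α.coeff 1) b p₁ p₂)) := by
  obtain ⟨M, ζ, E, Q, F, P, Z, hr, heM, hqM, hFa, hPa, hZa, hF, hP, hZ, rfl, rfl, rfl⟩ := h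
  obtain ⟨ζ₁, hζ₁, hζ₁0, hζ⟩ := hr.exists_eq_pow_mul_self hα
  have h1 := tendsto_K_along hf hr.pos heM (le_of_mul_natCast he heM) hζ₁ hPa hFa hZa hζ hP hF hZ
    hne
  have hM : (M : ℚ) ≠ 0 := by exact_mod_cast hr.pos.ne'
  have hflag : E = M ↔ e = 1 := by
    rw [← mul_left_inj' hM, heM, one_mul]
    norm_cast
  have hq : ((q : ℚ) : ℂ) = (Q : ℂ) / M := by
    have : q = (Q : ℚ) / M := by rw [← hqM]; field_simp
    rw [this]
    push_cast
    rfl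
  rwa [hr.germ_eq hα, hq, ← hζ₁0, ← leadK_congr hflag]

theorem Lead.le_gradOrder (hf : AnalyticAt ℂ f 0) (hα : α ∈ D1) (he : 1 ≤ e)
    (h : Lead f α e q b p₁ p₂) : (q : WithTop ℚ) ≤ gradOrder f α ∧
      (p₁ ≠ 0 ∨ b ≠ 0 → gradOrder f α = q) := by
  obtain ⟨M, ζ, E, Q, F, P, Z, hr, heM, hqM, hFa, hPa, hZa, hF, hP, hZ, rfl, rfl, rfl⟩ := h
  obtain ⟨ζ₁, hζ₁, hζ₁0, hζ⟩ := hr.exists_eq_pow_mul_self hα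
  obtain ⟨g, -, hg, -, hg0, -, hgeq, -⟩ :=
    exists_grad_Δ_along hf hr.pos (le_of_mul_natCast he heM) hζ₁ hPa hFa hZa hζ hP hF hZ
  have h2 := analyticOrderAt_eq_of_eq_pow_mul (hr.analyticAt_comp hα (analyticAt_grad hf)) hg hgeq
  rw [hr.gradOrder_eq hα hf, coe_le_map_div_iff hr.pos hqM, map_div_eq_coe_iff hr.pos hqM, h2]
  refine ⟨le_self_add, fun hne => ?_⟩
  rw [hg.analyticOrderAt_eq_zero.mpr, add_zero]
  rw [hg0, Ne, Prod.mk_eq_zero]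
  rintro ⟨h1, h2⟩
  rw [h1, mul_zero, sub_zero, mul_eq_zero] at h2
  refine hne.elim (fun h => h h1) fun h => h2.elim ?_ h
  have h1 : (Q : ℂ) + M ≠ 0 := by exact_mod_cast (by have := hr.pos; omega : Q + M ≠ 0)
  have hM : (M : ℂ) ≠ 0 := by exact_mod_cast hr.pos.ne'
  have : (Q : ℂ) / M + 1 = (Q + M) / M := by field_simp
  rw [this]
  exact div_ne_zero h1 hM

theorem Lead.exists_hasK (hf : AnalyticAt ℂ f 0) (hα : α ∈ D1) (he : 1 ≤ e)
    (h : Lead f α e q b p₁ p₂) (hne : p₁ ≠ 0 ∨ b ≠ 0) :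
    ∃ L a, HasK f (germ α) L a ∧ ((-2 * e : ℚ) : WithTop ℚ) ≤ L := by
  obtain ⟨h1, h2⟩ := h.curvature hf hα he hne
  obtain ⟨L, a, hK⟩ := exists_hasK_germ hf hα h1
  exact ⟨L, a, hK, hK.le_of_tendsto h2⟩

end Lead

/-! ### The Newton polygon at an arc -/

section Newton

variable {f : ℂ × ℂ → ℂ} {M : ℕ} {ζ : ℂ → ℂ} {α β γ : HahnSeries ℚ ℂ} {e : ℚ} {E : ℕ}

theorem tendsto_scaled (hζ : ContinuousAt ζ 0) (hζ0 : ζ 0 = 0) (hM : 0 < M) (hE : 0 < E) (u : ℂ) :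
    Tendsto (fun x : ℂ × ℂ => (ζ x.2 + x.2 ^ E * x.1, x.2 ^ M)) (𝓝 (u, 0)) (𝓝 0) := by
  have h2 : Tendsto (fun x : ℂ × ℂ => x.2) (𝓝 (u, 0)) (𝓝 0) := continuous_snd.tendsto' _ _ rfl
  have h1 : Tendsto (fun x : ℂ × ℂ => ζ x.2 + x.2 ^ E * x.1) (𝓝 (u, 0)) (𝓝 0) := by
    have h3 : Tendsto (fun x : ℂ × ℂ => x.2 ^ E * x.1) (𝓝 (u, 0)) (𝓝 0) := by
      have : Continuous fun x : ℂ × ℂ => x.2 ^ E * x.1 := by fun_prop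
      exact this.tendsto' _ _ (by simp [hE.ne'])
    have h4 : Tendsto ζ (𝓝 0) (𝓝 0) := by simpa [ContinuousAt, hζ0] using hζ
    simpa using (h4.comp h2).add h3
  have h5 : Tendsto (fun x : ℂ × ℂ => x.2 ^ M) (𝓝 (u, 0)) (𝓝 0) := by
    simpa [hM.ne'] using h2.pow M
  exact h1.prodMk_nhds h5

theorem eventually_dz_scaled {g G : ℂ × ℂ → ℂ} {a c s : ℂ → ℂ} {u : ℂ} (hg : AnalyticAt ℂ g 0)
    (hζ : ContinuousAt ζ 0) (hζ0 : ζ 0 = 0) (hM : 0 < M) (hE : 0 < E) (hG : AnalyticAt ℂ G (u, 0))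
    (h : ∀ᶠ x in 𝓝 ((u, 0) : ℂ × ℂ),
      c x.2 * g (ζ x.2 + x.2 ^ E * x.1, x.2 ^ M) = a x.2 + s x.2 * G x) :
    ∀ᶠ x in 𝓝 ((u, 0) : ℂ × ℂ),
      c x.2 * x.2 ^ E * dz g (ζ x.2 + x.2 ^ E * x.1, x.2 ^ M) = s x.2 * dz G x := by
  filter_upwards [h.eventually_nhds, hG.eventually_analyticAt,
    (tendsto_scaled hζ hζ0 hM hE u).eventually hg.eventually_analyticAt] with x h1 h2 h3
  have h4 : Tendsto (fun z : ℂ => (z, x.2)) (𝓝 x.1) (𝓝 x) :=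
    (by fun_prop : Continuous fun z : ℂ => (z, x.2)).tendsto' _ _ rfl
  have h5 : HasDerivAt (fun z : ℂ => ζ x.2 + x.2 ^ E * z) (x.2 ^ E) x.1 := by
    simpa using ((hasDerivAt_id x.1).const_mul (x.2 ^ E)).const_add (ζ x.2)
  have h6 := (HasDerivAt.comp (h₂ := fun z => g (z, x.2 ^ M)) x.1 (hasDerivAt_slice h3)
    h5).const_mul (c x.2)
  have h7 := ((hasDerivAt_slice h2).const_mul (s x.2)).const_add (a x.2)
  have h8 := (h7.congr_of_eventuallyEq (h4.eventually h1)).unique h6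
  rw [h8]
  ring

theorem dz_eq_derivative_eval {G : ℂ × ℂ → ℂ} {p : Polynomial ℂ} (h : ∀ u, G (u, 0) = p.eval u)
    (u : ℂ) : dz G (u, 0) = p.derivative.eval u := by
  rw [dz]
  simp only [h]
  exact p.deriv

/-- The leading coefficients along a perturbation `β` of `γ` of order `e`, when
`f = F₀ (t) + t ^ b G (u, t)` along `γ + u y ^ e`, where `y = t ^ M`. -/
theorem lead_of_scaling (hf : AnalyticAt ℂ f 0) (hr : IsRep M ζ γ) (hγ : γ ∈ D1) (he : 1 ≤ e)
    (heM : e * M = E) {b : ℕ} {p : Polynomial ℂ} {G : ℂ × ℂ → ℂ} {F₀ : ℂ → ℂ}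
    (hG : ∀ u, AnalyticAt ℂ G (u, 0)) (hGp : ∀ u, G (u, 0) = p.eval u)
    (hGeq : ∀ u, ∀ᶠ x in 𝓝 ((u, 0) : ℂ × ℂ),
      f (ζ x.2 + x.2 ^ E * x.1, x.2 ^ M) = F₀ x.2 + x.2 ^ b * G x)
    {Q : ℕ} {F₁ : ℂ → ℂ} (hF₁ : AnalyticAt ℂ F₁ 0)
    (hF₀ : ∀ᶠ t in 𝓝 (0 : ℂ), F₀ t = t ^ (Q + M) * F₁ t) (hQ : Q + E ≤ b) {q : ℚ}
    (hqM : q * M = Q) (hβ : β ∈ D1) (hle : (e : WithTop ℚ) ≤ (β - γ).orderTop) :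
    Lead f β e q (F₁ 0 + if b = Q + M then p.eval ((β - γ).coeff e) else 0)
      (if b = Q + E then p.derivative.eval ((β - γ).coeff e) else 0)
      (if b = Q + E then p.derivative.derivative.eval ((β - γ).coeff e) else 0) := by
  have hMpos := hr.pos
  have hME := le_of_mul_natCast he heM
  have hE : 0 < E := by omega
  have hζ0 := hr.apply_zero hγ
  have hζc := hr.analyticAt.continuousAt
  set r := mpuis β with hrdef
  have hr0 : 0 < r := hβ.2.1
  obtain ⟨ξ, hξ⟩ := exists_isRep_of_dvd hβ (L := M * r) (by positivity) (Dvd.intro_left _ rfl)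
  have hγr := hr.comp_pow hr0
  have heM' : e * (M * r : ℕ) = (E * r : ℕ) := by push_cast; rw [← mul_assoc, heM]
  have hqM' : q * (M * r : ℕ) = (Q * r : ℕ) := by push_cast; rw [← mul_assoc, hqM]
  -- After the scaling, the arc of `β` becomes the graph of `w` over `s = t ^ r`, and `w 0 = u`.
  obtain ⟨w, hw, hw0, hweq⟩ := (hξ.sub hγr).exists_eq_pow_mul heM' hle
  set u := (β - γ).coeff e with hu
  have hpair : AnalyticAt ℂ (fun t => ((w t, t ^ r) : ℂ × ℂ)) 0 := hw.prod (by fun_prop)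
  have ht : Tendsto (fun t => ((w t, t ^ r) : ℂ × ℂ)) (𝓝 0) (𝓝 (u, 0)) := by
    have := hpair.continuousAt
    simpa [ContinuousAt, hw0, hr0.ne'] using this
  have hcomp : ∀ {g : ℂ × ℂ → ℂ}, AnalyticAt ℂ g (u, 0) →
      AnalyticAt ℂ (fun t => g (w t, t ^ r)) 0 := fun hg => by
    refine analyticAt_pair (a := w) (b := fun t => t ^ r) ?_ hw (by fun_prop)
    simpa [hw0, hr0.ne'] using hg
  have hGu := hG u
  have hdz : ∀ᶠ x in 𝓝 ((u, 0) : ℂ × ℂ),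
      1 * x.2 ^ E * dz f (ζ x.2 + x.2 ^ E * x.1, x.2 ^ M) = x.2 ^ b * dz G x :=
    eventually_dz_scaled (c := fun _ => 1) (s := fun t => t ^ b) (a := F₀) hf hζc hζ0 hMpos hE hGu
      ((hGeq u).mono fun x hx => by simpa using hx)
  have hdzz : ∀ᶠ x in 𝓝 ((u, 0) : ℂ × ℂ),
      1 * x.2 ^ E * x.2 ^ E * dz (dz f) (ζ x.2 + x.2 ^ E * x.1, x.2 ^ M) =
        x.2 ^ b * dz (dz G) x :=
    eventually_dz_scaled (c := fun t => 1 * t ^ E) (s := fun t => t ^ b) (a := fun _ => 0)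
      (analyticAt_dz hf) hζc hζ0 hMpos hE (analyticAt_dz hGu)
      (hdz.mono fun x hx => by simpa using hx)
  have htr : Tendsto (fun t : ℂ => t ^ r) (𝓝 0) (𝓝 0) := (map_pow_nhds_zero hr0).le
  -- The arc of `β` is `ζ (s) + s ^ E w`, where `s = t ^ r`.
  have harc : ∀ᶠ t in 𝓝 (0 : ℂ),
      (ξ t, t ^ (M * r)) = (ζ (t ^ r) + (t ^ r) ^ E * w t, (t ^ r) ^ M) := by
    filter_upwards [hweq] with t ht
    ext
    · change ξ t = ζ (t ^ r) + (t ^ r) ^ E * w t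
      rw [← pow_mul, mul_comm r, ← ht]
      ring
    · change t ^ (M * r) = (t ^ r) ^ M
      rw [← pow_mul, mul_comm]
  obtain ⟨c, rfl⟩ := Nat.exists_eq_add_of_le hQ
  obtain ⟨k, rfl⟩ := Nat.exists_eq_add_of_le hME
  have hdG := dz_eq_derivative_eval hGp
  have hdGG := dz_eq_derivative_eval hdG
  refine ⟨M * r, ξ, (M + k) * r, Q * r,
    fun t => F₁ (t ^ r) + (t ^ r) ^ (k + c) * G (w t, t ^ r),
    fun t => (t ^ r) ^ c * dz G (w t, t ^ r), fun t => (t ^ r) ^ c * dz (dz G) (w t, t ^ r),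
    hξ, heM', hqM', ?_, ?_, ?_, ?_, ?_, ?_, ?_, ?_, ?_⟩
  · refine AnalyticAt.add (AnalyticAt.fun_comp (g := F₁) (f := fun t : ℂ => t ^ r) ?_
      (by fun_prop)) (AnalyticAt.mul (by fun_prop) (hcomp hGu))
    simpa [hr0.ne'] using hF₁
  · exact AnalyticAt.mul (by fun_prop) (hcomp (analyticAt_dz hGu))
  · exact AnalyticAt.mul (by fun_prop) (hcomp (analyticAt_dz (analyticAt_dz hGu)))
  · refine Eventually.filter_mono nhdsWithin_le_nhds ?_
    filter_upwards [harc, ht.eventually (hGeq u), htr.eventually hF₀] with t h1 h2 h3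
    rw [h1, h2, h3]
    ring
  · filter_upwards [nhdsWithin_le_nhds harc, nhdsWithin_le_nhds (ht.eventually hdz),
      self_mem_nhdsWithin] with t h1 h2 h3
    rw [h1]
    have h4 : (t ^ r) ^ (M + k) ≠ 0 := pow_ne_zero _ (pow_ne_zero _ h3)
    apply mul_left_cancel₀ h4
    rw [one_mul] at h2
    rw [h2]
    ring
  · filter_upwards [nhdsWithin_le_nhds harc, nhdsWithin_le_nhds (ht.eventually hdzz),
      self_mem_nhdsWithin] with t h1 h2 h3
    rw [h1]
    have h4 : (t ^ r) ^ (M + k) ≠ 0 := pow_ne_zero _ (pow_ne_zero _ h3)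
    apply mul_left_cancel₀ h4
    rw [one_mul, mul_assoc] at h2
    rw [mul_comm (M + k) r, pow_mul, h2]
    ring
  · have h1 : Q + (M + k) + c = Q + M ↔ k + c = 0 := by omega
    simp only [h1, zero_pow hr0.ne', hw0, hGp]
    congr 1
    split_ifs with h
    · rw [h, pow_zero, one_mul]
    · rw [zero_pow h, zero_mul]
  · have h1 : Q + (M + k) + c = Q + (M + k) ↔ c = 0 := by omega
    simp only [h1, zero_pow hr0.ne', hw0, hdG]
    split_ifs with h
    · rw [h, pow_zero, one_mul]
    · rw [zero_pow h, zero_mul]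
  · have h1 : Q + (M + k) + c = Q + (M + k) ↔ c = 0 := by omega
    simp only [h1, zero_pow hr0.ne', hw0, hdGG]
    split_ifs with h
    · rw [h, pow_zero, one_mul]
    · rw [zero_pow h, zero_mul]

end Newton

/-! ### Existence of the Newton polygon data -/

section NewtonData

variable {f : ℂ × ℂ → ℂ} {m M : ℕ} {ζ : ℂ → ℂ} {α β γ : HahnSeries ℚ ℂ} {e : ℚ} {E : ℕ}

theorem le_analyticOrderAt_of_isBigO {g : ℂ → ℂ} {n : ℕ} (hg : AnalyticAt ℂ g 0)
    (h : g =O[𝓝[≠] 0] fun t => t ^ n) : (n : ℕ∞) ≤ analyticOrderAt g 0 := by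
  by_contra! hlt
  obtain ⟨k, hk⟩ := ENat.ne_top_iff_exists.mp hlt.ne_top
  rw [← hk] at hlt
  have hkn : k < n := by exact_mod_cast hlt
  obtain ⟨u, hu, hu0, hgu⟩ := hg.analyticOrderAt_eq_natCast.mp hk.symm
  have h1 : u =O[𝓝[≠] 0] fun t : ℂ => t ^ (n - k) := by
    obtain ⟨C, hC⟩ := h.bound
    refine IsBigO.of_bound C ?_
    filter_upwards [hC, nhdsWithin_le_nhds hgu, self_mem_nhdsWithin] with t h2 h3 h4
    have h5 : 0 < ‖t ^ k‖ := norm_pos_iff.mpr (pow_ne_zero _ h4)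
    rw [h3, sub_zero, smul_eq_mul, norm_mul, ← Nat.sub_add_cancel hkn.le, pow_add, norm_mul] at h2
    refine le_of_mul_le_mul_left ?_ h5
    linarith
  have h2 : Tendsto (fun t : ℂ => t ^ (n - k)) (𝓝[≠] 0) (𝓝 0) := by
    have : Continuous fun t : ℂ => t ^ (n - k) := by fun_prop
    exact (this.tendsto' 0 0 (by simp [Nat.sub_ne_zero_of_lt hkn])).mono_left nhdsWithin_le_nhds
  exact hu0 (tendsto_nhds_unique (hu.continuousAt.tendsto.mono_left nhdsWithin_le_nhds)
    (h1.trans_tendsto h2))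

theorem IsMiniRegular.le_order (hf : IsMiniRegular f m) (hr : IsRep M ζ γ) (hγ : γ ∈ D1) :
    ((m * M : ℕ) : ℕ∞) ≤ analyticOrderAt (fun t => f (ζ t, t ^ M)) 0 := by
  have ha := hr.analyticAt_comp hγ hf.1
  refine le_analyticOrderAt_of_isBigO ha ?_
  obtain ⟨ζ₁, hζ₁, -, hζ⟩ := hr.exists_eq_pow_mul_self hγ
  have hφ := isArc_of_eq_pow_mul hr.pos hζ₁ hζ
  have ht : Tendsto (fun t => (ζ t, t ^ M)) (𝓝[≠] 0) (𝓝 0) := by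
    have h0 : ((ζ 0, (0 : ℂ) ^ M) : ℂ × ℂ) = 0 := hφ.2.1
    have := hφ.1.continuousAt
    rw [ContinuousAt, h0] at this
    exact this.mono_left nhdsWithin_le_nhds
  refine (hf.2.1.comp_tendsto ht).trans ?_
  have h1 : (fun t => (ζ t, t ^ M)) =O[𝓝[≠] 0] fun t : ℂ => t ^ M := by
    refine IsBigO.prod_left ?_ (isBigO_refl _ _)
    have h2 : (fun t => t ^ M * ζ₁ t) =O[𝓝[≠] 0] fun t : ℂ => t ^ M * 1 :=
      (isBigO_refl _ _).mul
        (((hζ₁.continuousAt.isBigO_one ℂ)).mono nhdsWithin_le_nhds)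
    simp only [mul_one] at h2
    exact h2.congr' (hζ.filter_mono nhdsWithin_le_nhds |>.mono fun t h => h.symm) EventuallyEq.rfl
  have h2 := h1.norm_left.pow m
  simp only [← pow_mul, mul_comm M] at h2
  exact h2

theorem IsMiniRegular.le_orderAlong (hf : IsMiniRegular f m) (hγ : γ ∈ D1) :
    ((m : ℚ) : WithTop ℚ) ≤ orderAlong f γ := by
  have hr := isRep_arc hγ
  rw [hr.orderAlong_eq hγ hf.1, coe_le_map_div_iff (Q := m * mpuis γ) hr.pos (by push_cast; rfl)]
  exact hf.le_order hr hγ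

theorem IsMiniRegular.iterate_dz_ne_zero (hf : IsMiniRegular f m) : (dz^[m] f) 0 ≠ 0 := by
  have ha : AnalyticAt ℂ (fun z : ℂ => f (z, 0)) 0 :=
    analyticAt_pair (a := fun z => z) (b := fun _ => 0) hf.1 analyticAt_id analyticAt_const
  rw [iterate_dz_eq_iteratedDeriv]
  exact ((analyticOrderAt_eq_nat_iff_iteratedDeriv_eq_zero ha).mp hf.2.2).2

theorem IsRep.coeff_eq_of_eq_pow_mul (hr : IsRep M ζ γ) (heM : e * M = E) {w : ℂ → ℂ}
    (hw : AnalyticAt ℂ w 0) (h : ∀ᶠ t in 𝓝 (0 : ℂ), ζ t = t ^ E * w t) :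
    (e : WithTop ℚ) ≤ γ.orderTop ∧ γ.coeff e = w 0 := by
  have hle : (e : WithTop ℚ) ≤ γ.orderTop := by
    rw [hr.le_orderTop_iff heM, natCast_le_analyticOrderAt hr.analyticAt]
    exact ⟨w, hw, by simpa using h⟩
  refine ⟨hle, ?_⟩
  obtain ⟨v, hv, hv0, hζv⟩ := hr.exists_eq_pow_mul heM hle
  rw [← hv0]
  have h1 : v =ᶠ[𝓝[≠] 0] w := by
    filter_upwards [nhdsWithin_le_nhds h, nhdsWithin_le_nhds hζv, self_mem_nhdsWithin]
      with t h2 h3 h4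
    exact mul_left_cancel₀ (pow_ne_zero E h4) (h3.symm.trans h2)
  exact tendsto_nhds_unique ((hv.continuousAt.tendsto.mono_left nhdsWithin_le_nhds).congr' h1)
    (hw.continuousAt.tendsto.mono_left nhdsWithin_le_nhds)

theorem isPolar_of_isRep (hf : AnalyticAt ℂ f 0) (hr : IsRep M ζ γ) (hγ : γ ∈ D1)
    (h : ∀ᶠ t in 𝓝[≠] (0 : ℂ), dz f (ζ t, t ^ M) = 0) : IsPolar f γ := by
  refine ⟨hγ, ?_⟩
  have h1 : ∀ᶠ t in 𝓝 (0 : ℂ), dz f (ζ t, t ^ M) = 0 :=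
    (hr.analyticAt_comp hγ (analyticAt_dz hf)).frequently_zero_iff_eventually_zero.mp h.frequently
  have h2 : ∀ᶠ p in germ γ, dz f p = 0 := by
    rw [hr.germ_eq hγ, eventually_map]
    exact h1
  rwa [germ, image, eventually_map] at h2

/-- The Newton polygon of `f` at `γ`, from which a side of slope `e` is considered.  Along
`γ + u y ^ e` for generic `u`, the order of `f_z` is `φ` and the order of the gradient is `q`.
The polynomial `p` is the leading coefficient in `f (γ + u y ^ e, y) - f (γ, y)`, as a function
of `u`, and `b₀` is the coefficient of `y ^ (q + 1)` in `f (γ, y)`. -/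
structure IsNewton (f : ℂ × ℂ → ℂ) (γ : HahnSeries ℚ ℂ) (e φ q : ℚ) (p : Polynomial ℂ)
    (b₀ : ℂ) : Prop where
  ne_zero : p ≠ 0
  coeff_zero : p.coeff 0 = 0
  le : ∀ k, 1 ≤ k →
    ((φ + e : ℚ) : WithTop ℚ) ≤ orderAlong (dz^[k] f) γ + ((k * e : ℚ) : WithTop ℚ)
  coeff_ne_zero_iff : ∀ k, 1 ≤ k → (p.coeff k ≠ 0 ↔
    orderAlong (dz^[k] f) γ + ((k * e : ℚ) : WithTop ℚ) = ((φ + e : ℚ) : WithTop ℚ))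
  nonneg : 0 ≤ q
  le_φ : q ≤ φ
  le_order : ((q + 1 : ℚ) : WithTop ℚ) ≤ orderAlong f γ
  b₀_ne_zero_iff : b₀ ≠ 0 ↔ orderAlong f γ = ((q + 1 : ℚ) : WithTop ℚ)
  eq_or : q = φ ∨ b₀ ≠ 0
  lead : ∀ β ∈ D1, (e : WithTop ℚ) ≤ (β - γ).orderTop →
    Lead f β e q (b₀ + if q = φ ∧ e = 1 then p.eval ((β - γ).coeff e) else 0)
      (if q = φ then p.derivative.eval ((β - γ).coeff e) else 0)
      (if q = φ then p.derivative.derivative.eval ((β - γ).coeff e) else 0)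
  exists_polar : ∀ u, p.derivative.eval u = 0 → ∃ γ', IsPolar f γ' ∧
    (e : WithTop ℚ) ≤ (γ' - γ).orderTop ∧ (γ' - γ).coeff e = u

theorem derivative_ne_zero {p : Polynomial ℂ} (hp : p ≠ 0) (h0 : p.coeff 0 = 0) :
    p.derivative ≠ 0 := by
  intro h
  apply hp
  rw [Polynomial.eq_C_of_derivative_eq_zero h, h0, Polynomial.C_0]

/-- The Newton polygon data exist: the scaling `h = t ^ E u` is applied to the difference of
`f (ζ + h, t ^ M)` and its value at `h = 0`, which has the same derivatives. -/
theorem exists_isNewton (hm : 0 < m) (hf : IsMiniRegular f m) (hγ : γ ∈ D1) (he : 1 ≤ e) :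
    ∃ φ q p b₀, IsNewton f γ e φ q p b₀ := by
  obtain ⟨M, ζ, E, hr, heM⟩ := exists_isRep_mul hγ (e := e) (by linarith)
  have hM := hr.pos
  have hME := le_of_mul_natCast he heM
  have hE : 0 < E := by omega
  have hζ0 := hr.apply_zero hγ
  have hMq : (0 : ℚ) < M := by exact_mod_cast hM
  set g : ℂ × ℂ → ℂ := fun x => f (ζ x.2 + x.1, x.2 ^ M) - f (ζ x.2, x.2 ^ M) with hgdef
  have hg : AnalyticAt ℂ g 0 := by
    have h1 : AnalyticAt ℂ (fun x : ℂ × ℂ => ζ x.2) 0 :=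
      AnalyticAt.fun_comp (g := ζ) (f := fun x : ℂ × ℂ => x.2) hr.analyticAt analyticAt_snd
    have h2 : AnalyticAt ℂ (fun x : ℂ × ℂ => f (ζ x.2 + x.1, x.2 ^ M)) 0 := by
      refine AnalyticAt.comp₂ (h := f) (f := fun x : ℂ × ℂ => ζ x.2 + x.1)
        (g := fun x => x.2 ^ M) ?_ (h1.add analyticAt_fst) (by fun_prop)
      simpa [hM.ne', hζ0, ← Prod.zero_eq_mk] using hf.1
    have h3 : AnalyticAt ℂ (fun x : ℂ × ℂ => f (ζ x.2, x.2 ^ M)) 0 := by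
      refine AnalyticAt.comp₂ (h := f) (f := fun x : ℂ × ℂ => ζ x.2)
        (g := fun x => x.2 ^ M) ?_ h1 (by fun_prop)
      simpa [hM.ne', hζ0, ← Prod.zero_eq_mk] using hf.1
    exact h2.sub h3
  have hiter : ∀ k, 1 ≤ k →
      dz^[k] g = fun x => (dz^[k] f) (ζ x.2 + x.1, x.2 ^ M) := by
    intro k hk
    obtain ⟨k, rfl⟩ := Nat.exists_eq_add_of_le' hk
    have h1 : dz g = dz fun x : ℂ × ℂ => f (ζ x.2 + x.1, x.2 ^ M) := by
      funext x
      simp only [hgdef, dz, deriv_sub_const]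
    rw [← iterate_dz_comp_shift f ζ (fun t => t ^ M) (k + 1), Function.iterate_succ_apply, h1,
      ← Function.iterate_succ_apply]
  set N : ℕ → ℕ∞ := fun k => analyticOrderAt (fun t => (dz^[k] f) (ζ t, t ^ M)) 0 with hN
  have hNeq : ∀ k, orderAlong (dz^[k] f) γ = WithTop.map (fun n : ℕ => (n : ℚ) / M) (N k) :=
    fun k => hr.orderAlong_eq hγ (analyticAt_iterate_dz hf.1 k)
  have htc : ∀ k, 1 ≤ k → analyticOrderAt (taylorCoeff g k) 0 = N k := by
    intro k hk
    have h1 : taylorCoeff g k =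
        (fun t => (dz^[k] f) (ζ t, t ^ M)) * fun _ => ((k.factorial : ℂ))⁻¹ := by
      funext t
      rw [taylorCoeff, hiter k hk]
      simp [div_eq_mul_inv]
    have h2 : analyticOrderAt (fun _ : ℂ => ((k.factorial : ℂ))⁻¹) 0 = 0 := by
      rw [analyticAt_const.analyticOrderAt_eq_zero]
      exact inv_ne_zero (by exact_mod_cast k.factorial_ne_zero)
    rw [h1, analyticOrderAt_mul (hr.analyticAt_comp hγ (analyticAt_iterate_dz hf.1 k))
      analyticAt_const, h2, add_zero]
  have htc0 : analyticOrderAt (taylorCoeff g 0) 0 = ⊤ := by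
    rw [analyticOrderAt_eq_top]
    filter_upwards with t
    simp [taylorCoeff, hgdef]
  have hNm : N m = 0 := by
    rw [(hr.analyticAt_comp hγ (analyticAt_iterate_dz hf.1 m)).analyticOrderAt_eq_zero]
    simpa [hζ0, hM.ne', ← Prod.zero_eq_mk] using hf.iterate_dz_ne_zero
  obtain ⟨b, p, G, hp0, hG, hGp, hGeq, hb, hpc⟩ := exists_scaling hg (E := E) (k₀ := m) hE (by
    rw [htc m hm, hNm]
    exact ENat.zero_ne_top)
  have hp00 : p.coeff 0 = 0 := by
    by_contra h
    rw [← ne_eq, hpc, htc0] at h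
    simp at h
  have hEb : E ≤ b := by
    obtain ⟨k, hk⟩ : ∃ k, p.coeff k ≠ 0 := by
      by_contra! h
      exact hp0 (Polynomial.ext (by simpa using h))
    have hk1 : 1 ≤ k := Nat.one_le_iff_ne_zero.mpr fun h => hk (h ▸ hp00)
    have h1 : ((k * E : ℕ) : ℕ∞) ≤ b := (hpc k).mp hk ▸ le_add_self
    have h2 : k * E ≤ b := by exact_mod_cast h1
    nlinarith
  set F₀ : ℂ → ℂ := fun t => f (ζ t, t ^ M) with hF₀
  have hF₀a : AnalyticAt ℂ F₀ 0 := hr.analyticAt_comp hγ hf.1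
  have hMn : (M : ℕ∞) ≤ analyticOrderAt F₀ 0 := by
    refine le_trans ?_ (hf.le_order hr hγ)
    exact_mod_cast Nat.le_mul_of_pos_left M hm
  have hGeq' : ∀ u, ∀ᶠ x in 𝓝 ((u, 0) : ℂ × ℂ),
      f (ζ x.2 + x.2 ^ E * x.1, x.2 ^ M) = F₀ x.2 + x.2 ^ b * G x := fun u => by
    filter_upwards [hGeq u] with x hx
    simp only [hgdef] at hx
    rw [← hx]
    ring
  -- The order of the gradient is the minimum of the orders of `f_z` and `f / y`.
  obtain ⟨Q, hQE, hQM, hQ⟩ : ∃ Q : ℕ, Q + E ≤ b ∧ ((Q + M : ℕ) : ℕ∞) ≤ analyticOrderAt F₀ 0 ∧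
      (Q + E = b ∨ analyticOrderAt F₀ 0 = ((Q + M : ℕ) : ℕ∞)) := by
    by_cases h : ((b - E + M : ℕ) : ℕ∞) ≤ analyticOrderAt F₀ 0
    · exact ⟨b - E, by omega, h, Or.inl (by omega)⟩
    · obtain ⟨n, hn⟩ := ENat.ne_top_iff_exists.mp (not_le.mp h).ne_top
      rw [← hn] at h hMn ⊢
      have h1 : n < b - E + M := by exact_mod_cast not_le.mp h
      have h2 : M ≤ n := by exact_mod_cast hMn
      have h3 : n - M + M = n := Nat.sub_add_cancel h2
      exact ⟨n - M, by omega, by rw [h3], Or.inr (by rw [h3])⟩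
  obtain ⟨F₁, hF₁, hF₁eq⟩ := (natCast_le_analyticOrderAt hF₀a).mp hQM
  simp only [sub_zero, smul_eq_mul] at hF₁eq
  have hF₁0 : F₁ 0 ≠ 0 ↔ analyticOrderAt F₀ 0 = ((Q + M : ℕ) : ℕ∞) := by
    rw [analyticOrderAt_eq_of_eq_pow_mul hF₀a hF₁ (nhdsWithin_le_nhds hF₁eq),
      ← hF₁.analyticOrderAt_eq_zero]
    constructor
    · intro h
      rw [h, add_zero]
    · intro h
      exact ENat.add_right_injective_of_ne_top (ENat.natCast_ne_top _) (h.trans (add_zero _).symm)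
  have hφM : (((b : ℚ) - E) / M + e) * M = b := by
    rw [add_mul, div_mul_cancel₀ _ hMq.ne', heM]
    ring
  have hq1M : ((Q : ℚ) / M + 1) * M = ((Q + M : ℕ) : ℚ) := by
    rw [add_mul, div_mul_cancel₀ _ hMq.ne', one_mul]
    push_cast
    rfl
  have hadd : ∀ k : ℕ, orderAlong (dz^[k] f) γ + ((k * e : ℚ) : WithTop ℚ) =
      WithTop.map (fun n : ℕ => (n : ℚ) / M) (N k + ((k * E : ℕ) : ℕ∞) : ℕ∞) := by
    intro k
    rw [hNeq]
    induction N k using ENat.recTopCoe with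
    | top => rfl
    | coe n =>
      rw [← Nat.cast_add]
      refine congrArg (fun x : ℚ => (x : WithTop ℚ)) ?_
      push_cast
      rw [add_div, mul_div_assoc, ← heM, mul_div_cancel_right₀ _ hMq.ne']
  have hflag : Q + E = b ↔ (Q : ℚ) / M = ((b : ℚ) - E) / M := by
    rw [div_left_inj' hMq.ne', eq_sub_iff_add_eq]
    norm_cast
  have hflag1 : E = M ↔ e = 1 := by
    rw [← mul_left_inj' hMq.ne', heM, one_mul]
    norm_cast
  refine ⟨((b : ℚ) - E) / M, (Q : ℚ) / M, p, F₁ 0, ⟨hp0, hp00, ?_, ?_, by positivity, ?_, ?_, ?_,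
    ?_, ?_, ?_⟩⟩
  · intro k hk
    rw [hadd, coe_le_map_div_iff hM hφM, ← htc k hk]
    exact hb k
  · intro k hk
    rw [hadd, map_div_eq_coe_iff hM hφM, ← htc k hk]
    exact hpc k
  · have : ((Q + E : ℕ) : ℚ) ≤ b := by exact_mod_cast hQE
    push_cast at this
    gcongr
    linarith
  · rw [hr.orderAlong_eq hγ hf.1, coe_le_map_div_iff hM hq1M]
    exact hQM
  · rw [hr.orderAlong_eq hγ hf.1, map_div_eq_coe_iff hM hq1M]
    exact hF₁0
  · rw [← hflag, hF₁0]
    exact hQ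
  · intro β hβ hle
    have h1 := lead_of_scaling hf.1 hr hγ he heM hG hGp hGeq' hF₁ hF₁eq hQE
      (q := (Q : ℚ) / M) (div_mul_cancel₀ _ hMq.ne') hβ hle
    have h2 : b = Q + E ↔ (Q : ℚ) / M = ((b : ℚ) - E) / M := by rw [← hflag, eq_comm]
    have h3 : b = Q + M ↔ (Q : ℚ) / M = ((b : ℚ) - E) / M ∧ e = 1 := by
      rw [← hflag, ← hflag1]
      omega
    simpa only [h2, h3] using h1
  · intro u hu
    have hp' := derivative_ne_zero hp0 hp00
    have hdG := dz_eq_derivative_eval hGp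
    -- The polars near `γ + u y ^ e` are the Puiseux roots of `G_u` through the root `u` of `p'`.
    obtain ⟨n, hn, w, hw, hw0, hweq⟩ := exists_puiseux_root (p.derivative.rootMultiplicity u)
      (dz G) u (analyticAt_dz (hG u)) ((Polynomial.rootMultiplicity_pos hp').mpr hu).ne' (by
        rw [← analyticOrderAt_polynomial_eval hp' u]
        simp only [hdG])
    have hn0 : 0 < n := hn
    have hwa : AnalyticAt ℂ (fun t => t ^ (E * n) * w t) 0 := by fun_prop
    obtain ⟨δ, hδ⟩ := exists_isRep (M := M * n) (by positivity) hwa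
    obtain ⟨hδ1, hδ2⟩ := hδ.coeff_eq_of_eq_pow_mul (e := e) (E := E * n)
      (by push_cast; rw [← mul_assoc, heM]) hw (Eventually.of_forall fun _ => rfl)
    have hγ' := (hr.comp_pow hn0).add hδ
    have hmem : γ + δ ∈ D1 := by
      refine hγ'.mem_D1 (le_trans (le_min hγ.1 (le_trans ?_ hδ1))
        HahnSeries.min_orderTop_le_orderTop_add)
      exact_mod_cast he
    refine ⟨γ + δ, isPolar_of_isRep hf.1 hγ' hmem ?_, by simpa using hδ1, by simpa [hw0] using hδ2⟩
    have hdz : ∀ᶠ x in 𝓝 ((u, 0) : ℂ × ℂ),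
        1 * x.2 ^ E * dz f (ζ x.2 + x.2 ^ E * x.1, x.2 ^ M) = x.2 ^ b * dz G x :=
      eventually_dz_scaled (c := fun _ => 1) (s := fun t => t ^ b) (a := F₀) hf.1
        hr.analyticAt.continuousAt hζ0 hM hE (hG u) ((hGeq' u).mono fun x hx => by simpa using hx)
    have ht : Tendsto (fun t => ((w t, t ^ n) : ℂ × ℂ)) (𝓝 0) (𝓝 (u, 0)) := by
      have : ContinuousAt (fun t => ((w t, t ^ n) : ℂ × ℂ)) 0 :=
        hw.continuousAt.prodMk (by fun_prop)
      simpa [ContinuousAt, hw0, hn0.ne'] using this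
    filter_upwards [nhdsWithin_le_nhds (ht.eventually hdz), nhdsWithin_le_nhds hweq,
      self_mem_nhdsWithin] with t h1 h2 h3
    have h4 : (t ^ n) ^ E ≠ 0 := pow_ne_zero _ (pow_ne_zero _ h3)
    rw [h2, mul_zero, one_mul] at h1
    have h5 := (mul_eq_zero.mp h1).resolve_left h4
    rw [← h5]
    simp only [← pow_mul, mul_comm n]

end NewtonData

/-! ### Sides of the Newton polygon -/

section NewtonSides

variable {f : ℂ × ℂ → ℂ} {m : ℕ} {α β γ : HahnSeries ℚ ℂ} {e φ q d : ℚ} {p : Polynomial ℂ}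
  {b₀ : ℂ}

theorem orderAlong_nonneg (g : ℂ × ℂ → ℂ) (α : HahnSeries ℚ ℂ) : 0 ≤ orderAlong g α := by
  rw [orderAlong]
  induction analyticOrderAt (fun t => g (arc α t)) 0 using ENat.recTopCoe with
  | top => exact le_top
  | coe n =>
    have : (0 : ℚ) ≤ (n : ℚ) / mpuis α := by positivity
    exact WithTop.coe_le_coe.mpr this

theorem IsMiniRegular.orderAlong_iterate_dz (hf : IsMiniRegular f m) (hγ : γ ∈ D1) :
    orderAlong (dz^[m] f) γ = ((0 : ℚ) : WithTop ℚ) := by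
  have hr := isRep_arc hγ
  rw [hr.orderAlong_eq hγ (analyticAt_iterate_dz hf.1 m),
    map_div_eq_coe_iff (Q := 0) hr.pos (by simp), Nat.cast_zero,
    (hr.analyticAt_comp hγ (analyticAt_iterate_dz hf.1 m)).analyticOrderAt_eq_zero]
  have h0 : (arc γ 0).1 = 0 := hr.apply_zero hγ
  simpa [h0, hr.pos.ne', ← Prod.zero_eq_mk] using hf.iterate_dz_ne_zero

theorem IsNewton.le_add (h : IsNewton f γ e φ q p b₀) {k : ℕ} (hk : 1 ≤ k) {n : ℚ}
    (hn : orderAlong (dz^[k] f) γ = (n : WithTop ℚ)) : φ + e ≤ n + k * e := by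
  have := h.le k hk
  rw [hn] at this
  exact_mod_cast this

theorem IsNewton.exists_order (h : IsNewton f γ e φ q p b₀) {k : ℕ} (hk : p.coeff k ≠ 0) :
    1 ≤ k ∧ ∃ n : ℚ, 0 ≤ n ∧ orderAlong (dz^[k] f) γ = (n : WithTop ℚ) ∧ n + k * e = φ + e := by
  have hk1 : 1 ≤ k := Nat.one_le_iff_ne_zero.mpr fun h0 => hk (h0 ▸ h.coeff_zero)
  have h1 := (h.coeff_ne_zero_iff k hk1).mp hk
  have h2 := orderAlong_nonneg (dz^[k] f) γ
  refine ⟨hk1, ?_⟩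
  cases hn : orderAlong (dz^[k] f) γ with
  | top =>
    rw [hn, top_add] at h1
    exact absurd h1 WithTop.top_ne_coe
  | coe n =>
    rw [hn] at h1 h2
    exact ⟨n, by exact_mod_cast h2, rfl, by exact_mod_cast h1⟩

theorem IsNewton.coeff_ne_zero (h : IsNewton f γ e φ q p b₀) {k : ℕ} (hk : 1 ≤ k) {n : ℚ}
    (hn : orderAlong (dz^[k] f) γ = (n : WithTop ℚ)) (heq : n + k * e = φ + e) :
    p.coeff k ≠ 0 := by
  rw [h.coeff_ne_zero_iff k hk, hn]
  exact_mod_cast heq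

theorem IsNewton.exists_coeff_ne_zero (h : IsNewton f γ e φ q p b₀) : ∃ k, p.coeff k ≠ 0 := by
  by_contra! h0
  exact h.ne_zero (Polynomial.ext (by simpa using h0))

theorem IsNewton.le_of_coeff_ne_zero (hm : 0 < m) (hf : IsMiniRegular f m) (hγ : γ ∈ D1)
    (he : 0 < e) (h : IsNewton f γ e φ q p b₀) {k : ℕ} (hk : p.coeff k ≠ 0) : k ≤ m := by
  obtain ⟨-, n, hn0, -, hn⟩ := h.exists_order hk
  have h1 := h.le_add hm (hf.orderAlong_iterate_dz hγ)
  have h2 : (k : ℚ) * e ≤ m * e := by linarith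
  exact_mod_cast le_of_mul_le_mul_right h2 he

theorem coeff_add_term_sub (γ : HahnSeries ℚ ℂ) (u : ℂ) (e : ℚ) :
    (γ + term u e - γ).coeff e = u := by
  simp [term]

theorem le_orderTop_add_term_sub (γ : HahnSeries ℚ ℂ) (u : ℂ) (e : ℚ) :
    (e : WithTop ℚ) ≤ (γ + term u e - γ).orderTop := by
  rw [add_sub_cancel_left]
  exact le_orderTop_term u e

theorem IsNewton.eventually_ne (h : IsNewton f γ e φ q p b₀) : ∀ᶠ u in cofinite,
    (if q = φ then p.derivative.eval u else 0) ≠ 0 ∨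
      b₀ + (if q = φ ∧ e = 1 then p.eval u else 0) ≠ 0 := by
  by_cases hq : q = φ
  · filter_upwards [eventually_eval_ne_zero (derivative_ne_zero h.ne_zero h.coeff_zero)] with u hu
    exact Or.inl (by simpa [hq] using hu)
  · refine Eventually.of_forall fun u => Or.inr ?_
    simpa [hq] using h.eq_or.resolve_left hq

theorem IsNewton.eventually_gradOrder (hf : AnalyticAt ℂ f 0) (hγ : γ ∈ D1) (he : 1 ≤ e)
    (h : IsNewton f γ e φ q p b₀) : ∀ᶠ u in cofinite, gradOrder f (γ + term u e) = q := by
  filter_upwards [h.eventually_ne] with u hu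
  have hmem := add_term_mem_D1 hγ he u
  refine ((h.lead _ hmem (le_orderTop_add_term_sub γ u e)).le_gradOrder hf hmem he).2 ?_
  rwa [coeff_add_term_sub]

theorem eventually_exists_hasK (hm : 0 < m) (hf : IsMiniRegular f m) (hγ : γ ∈ D1) (he : 1 ≤ e) :
    ∀ᶠ u in cofinite,
      ∃ L a, HasK f (germ (γ + term u e)) L a ∧ ((-2 * e : ℚ) : WithTop ℚ) ≤ L := by
  obtain ⟨φ, q, p, b₀, h⟩ := exists_isNewton hm hf hγ he
  filter_upwards [h.eventually_ne] with u hu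
  have hmem := add_term_mem_D1 hγ he u
  refine (h.lead _ hmem (le_orderTop_add_term_sub γ u e)).exists_hasK hf.1 hmem he ?_
  rwa [coeff_add_term_sub]

/-- For slopes slightly less than `e`, the supporting line touches the Newton polygon only at the
last exponent on the side of slope `e`. -/
theorem IsNewton.exists_eventually_monomial (hm : 0 < m) (hf : IsMiniRegular f m) (hγ : γ ∈ D1)
    (he : 1 < e) (h : IsNewton f γ e φ q p b₀) :
    ∃ e₀, 1 ≤ e₀ ∧ e₀ < e ∧ ∀ e₁, e₀ ≤ e₁ → e₁ < e → ∀ φ₁ q₁ p₁ b₁,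
      IsNewton f γ e₁ φ₁ q₁ p₁ b₁ → ∀ k, p₁.coeff k ≠ 0 → k = p.natDegree := by
  set k₀ := p.natDegree with hk₀
  have hk₀p : p.coeff k₀ ≠ 0 := by
    rw [hk₀, Polynomial.coeff_natDegree, Polynomial.leadingCoeff_ne_zero]
    exact h.ne_zero
  obtain ⟨hk₀1, n₀, hn₀0, hn₀, hn₀e⟩ := h.exists_order hk₀p
  -- For `e₁` slightly less than `e`, the exponents greater than `k₀` stay above the line through
  -- `k₀`.
  have hev : ∀ k ∈ Finset.Icc (k₀ + 1) m, ∀ᶠ e₁ in 𝓝[<] e, ∀ n : ℚ,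
      orderAlong (dz^[k] f) γ = (n : WithTop ℚ) → n₀ + k₀ * e₁ < n + k * e₁ := by
    intro k hk
    have hk' := Finset.mem_Icc.mp hk
    have hk1 : 1 ≤ k := by omega
    cases hn : orderAlong (dz^[k] f) γ with
    | top => exact Eventually.of_forall fun _ n hn => absurd hn WithTop.top_ne_coe
    | coe n =>
      have h1 := h.le_add hk1 hn
      have h2 : n + k * e ≠ φ + e := fun h3 =>
        h.coeff_ne_zero hk1 hn h3 (Polynomial.coeff_eq_zero_of_natDegree_lt (by omega))
      have h3 : n₀ + k₀ * e < n + k * e := by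
        rw [hn₀e]
        exact lt_of_le_of_ne h1 (Ne.symm h2)
      have h4 : ∀ᶠ e₁ in 𝓝 e, n₀ + k₀ * e₁ < n + k * e₁ :=
        (by fun_prop : ContinuousAt (fun x : ℚ => n₀ + k₀ * x) e).eventually_lt
          (by fun_prop : ContinuousAt (fun x : ℚ => n + k * x) e) h3
      filter_upwards [nhdsWithin_le_nhds h4] with e₁ h5 n' hn'
      rw [← WithTop.coe_inj.mp hn']
      exact h5
  rw [← Filter.eventually_all_finset] at hev
  obtain ⟨l, hl, hsub⟩ := mem_nhdsLT_iff_exists_Ico_subset.mp hev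
  refine ⟨max 1 l, le_max_left _ _, max_lt he hl, fun e₁ he₁ he₁e φ₁ q₁ p₁ b₁ h₁ k hk => ?_⟩
  have he₁1 : 1 ≤ e₁ := le_trans (le_max_left _ _) he₁
  have hkm := h₁.le_of_coeff_ne_zero hm hf hγ (by linarith) hk
  obtain ⟨hk1, n, hn0, hn, hne⟩ := h₁.exists_order hk
  have h1 := h₁.le_add hk₀1 hn₀
  have h2 := h.le_add hk1 hn
  rcases lt_trichotomy k k₀ with hlt | heq | hgt
  -- An exponent `k < k₀` is not below the line of slope `e` through `k₀`, hence it is above the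
  -- line of slope `e₁` through `k₀`.
  · have h3 : (k : ℚ) < k₀ := by exact_mod_cast hlt
    nlinarith
  · exact heq
  · have h3 := hsub ⟨le_trans (le_max_right _ _) he₁, he₁e⟩ k
      (Finset.mem_Icc.mpr ⟨by omega, hkm⟩) n hn
    linarith

theorem eq_monomial_of_coeff {p : Polynomial ℂ} {k : ℕ} (h : ∀ j, p.coeff j ≠ 0 → j = k) :
    p = Polynomial.monomial k (p.coeff k) := by
  ext j
  rw [Polynomial.coeff_monomial]
  split_ifs with hj
  · rw [hj]
  · by_contra h0
    exact hj (h j h0).symm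

theorem derivative_eval_ne_zero {p : Polynomial ℂ} (hp : p ≠ 0) {k : ℕ} (hk : 1 ≤ k)
    (h : ∀ j, p.coeff j ≠ 0 → j = k) {u : ℂ} (hu : u ≠ 0 ∨ k = 1) :
    p.derivative.eval u ≠ 0 := by
  have h1 := eq_monomial_of_coeff h
  have h2 : p.coeff k ≠ 0 := fun h0 => hp (by rw [h1, h0, map_zero])
  rw [h1, Polynomial.derivative_monomial, Polynomial.eval_monomial]
  refine mul_ne_zero (mul_ne_zero h2 (by exact_mod_cast (by omega : k ≠ 0))) ?_
  rcases hu with hu | hu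
  · exact pow_ne_zero _ hu
  · simp [hu]

/-- If there is no polar of the given order of contact, then the order of the gradient is constant
for some smaller order of contact. -/
theorem IsNewton.exists_gradOrder_const (hm : 0 < m) (hf : IsMiniRegular f m) (hγ : γ ∈ D1)
    (he : 1 < e) (h : IsNewton f γ e φ q p b₀) (hp : p.natDegree = 1) :
    ∃ e₀, 1 ≤ e₀ ∧ e₀ < e ∧ ∀ e₁, e₀ < e₁ → e₁ < e → ∃ r : ℚ, ∀ β ∈ D1,
      (e₁ : WithTop ℚ) ≤ (β - γ).orderTop → gradOrder f β = r := by
  obtain ⟨e₀, h1, h2, h3⟩ := h.exists_eventually_monomial hm hf hγ he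
  refine ⟨e₀, h1, h2, fun e₁ he₁ he₁e => ?_⟩
  obtain ⟨φ₁, q₁, p₁, b₁, h₁⟩ := exists_isNewton hm hf hγ (e := e₁) (by linarith)
  refine ⟨q₁, fun β hβ hle => ?_⟩
  refine ((h₁.lead β hβ hle).le_gradOrder hf.1 hβ (by linarith)).2 ?_
  have hne1 : e₁ ≠ 1 := by linarith
  by_cases hq : q₁ = φ₁
  · left
    rw [if_pos hq]
    exact derivative_eval_ne_zero h₁.ne_zero le_rfl
      (fun j hj => (h3 e₁ he₁.le he₁e φ₁ q₁ p₁ b₁ h₁ j hj).trans hp) (Or.inr rfl)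
  · right
    simpa [hne1] using h₁.eq_or.resolve_left hq

end NewtonSides

/-! ### Gradient degrees of polars -/

section GradientDegree

variable {f : ℂ × ℂ → ℂ} {m : ℕ} {α β γ : HahnSeries ℚ ℂ} {e φ q d q₀ : ℚ} {p : Polynomial ℂ}
  {b₀ : ℂ}

theorem IsPolar.orderAlong_dz (hγ : IsPolar f γ) : orderAlong (dz^[1] f) γ = ⊤ := by
  have h : analyticOrderAt (fun t => (dz^[1] f) (arc γ t)) 0 = ⊤ := by
    rw [analyticOrderAt_eq_top]
    exact hγ.2
  rw [orderAlong, h]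
  rfl

theorem IsNewton.two_le (hγ : IsPolar f γ) (h : IsNewton f γ e φ q p b₀) {k : ℕ}
    (hk : p.coeff k ≠ 0) : 2 ≤ k := by
  obtain ⟨hk1, n, -, hn, -⟩ := h.exists_order hk
  by_contra! hlt
  obtain rfl : k = 1 := by omega
  rw [hγ.orderAlong_dz] at hn
  exact WithTop.top_ne_coe hn

theorem IsNewton.derivative_eval_zero (hγ : IsPolar f γ) (h : IsNewton f γ e φ q p b₀) :
    p.derivative.eval 0 = 0 := by
  rw [← Polynomial.coeff_zero_eq_eval_zero, Polynomial.coeff_derivative]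
  have : p.coeff (0 + 1) = 0 := by
    by_contra h0
    have := h.two_le hγ h0
    omega
  rw [this, zero_mul]

theorem IsNewton.le_φ_of_isPolar (hγ : IsPolar f γ) (he : 1 ≤ e)
    (h : IsNewton f γ e φ q p b₀) : e ≤ φ := by
  obtain ⟨k, hk⟩ := h.exists_coeff_ne_zero
  have hk2 : (2 : ℚ) ≤ k := by exact_mod_cast h.two_le hγ hk
  obtain ⟨-, n, hn0, -, hn⟩ := h.exists_order hk
  nlinarith

theorem IsPolar.le_gradOrder (hf : AnalyticAt ℂ f 0) (hγ : IsPolar f γ) (he : 1 ≤ e)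
    (h : IsNewton f γ e φ q p b₀) :
    (q : WithTop ℚ) ≤ gradOrder f γ ∧ (b₀ ≠ 0 → gradOrder f γ = q) := by
  have h1 := (h.lead γ hγ.1 (by rw [sub_self, HahnSeries.orderTop_zero]; exact le_top)).le_gradOrder
    hf hγ.1 he
  refine ⟨h1.1, fun hb => h1.2 (Or.inr ?_)⟩
  have : p.eval 0 = 0 := by rw [← Polynomial.coeff_zero_eq_eval_zero, h.coeff_zero]
  simpa [this] using hb

/-- Along a polar, the order of the gradient is one less than the order of `f`. -/
theorem IsPolar.gradOrder_eq (hm : 0 < m) (hf : IsMiniRegular f m) (hγ : IsPolar f γ)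
    (hq₀ : orderAlong f γ = ((q₀ + 1 : ℚ) : WithTop ℚ)) : gradOrder f γ = q₀ := by
  have he : 1 ≤ max 1 (q₀ + 1) := le_max_left _ _
  obtain ⟨φ, q, p, b₀, h⟩ := exists_isNewton hm hf hγ.1 he
  have h1 := h.le_φ_of_isPolar hγ he
  have h2 := h.le_order
  rw [hq₀, WithTop.coe_le_coe] at h2
  have hb : b₀ ≠ 0 := h.eq_or.resolve_left fun h3 => by
    have := le_max_right 1 (q₀ + 1)
    linarith
  have h4 := h.b₀_ne_zero_iff.mp hb
  rw [hq₀, WithTop.coe_inj] at h4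
  rw [(hγ.le_gradOrder hf.1 he h).2 hb, WithTop.coe_inj]
  linarith

theorem IsPolar.orderAlong_ne_top (hm : 0 < m) (hf : IsMiniRegular f m) (hγ : IsPolar f γ)
    (h : gradOrder f γ ≠ ⊤) : orderAlong f γ ≠ ⊤ := by
  intro htop
  obtain ⟨r, hr⟩ := WithTop.ne_top_iff_exists.mp h
  have he : 1 ≤ max 1 (r + 1) := le_max_left _ _
  obtain ⟨φ, q, p, b₀, h⟩ := exists_isNewton hm hf hγ.1 he
  have h1 := h.le_φ_of_isPolar hγ he
  have hb : ¬ b₀ ≠ 0 := fun hb => by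
    rw [h.b₀_ne_zero_iff, htop] at hb
    exact WithTop.top_ne_coe hb
  have h2 := h.eq_or.resolve_right hb
  have h3 := (hγ.le_gradOrder hf.1 he h).1
  rw [← hr, WithTop.coe_le_coe] at h3
  have := le_max_right 1 (r + 1)
  linarith

theorem gradDeg_eq_coe_iff : gradDeg f γ = (d : WithTop ℚ) ↔ IsLeast {e : ℚ | 1 ≤ e ∧
    ∀ᶠ u : ℂ in cofinite, gradOrder f γ = gradOrder f (γ + term u e)} d := by
  rw [gradDeg]
  split_ifs with h
  · rw [WithTop.coe_inj]
    exact ⟨fun h1 => h1 ▸ h.choose_spec, fun h1 => h.choose_spec.unique h1⟩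
  · exact ⟨fun h1 => absurd h1 WithTop.top_ne_coe, fun h1 => absurd ⟨d, h1⟩ h⟩

/-- The order of the gradient does not change under a generic perturbation of order `e` if and only
if the generic order `φ` of `f_z` is at least the order of the gradient along the polar. -/
theorem IsPolar.eventually_gradOrder_iff (hm : 0 < m) (hf : IsMiniRegular f m) (hγ : IsPolar f γ)
    (hq₀ : orderAlong f γ = ((q₀ + 1 : ℚ) : WithTop ℚ)) (he : 1 ≤ e)
    (h : IsNewton f γ e φ q p b₀) :
    (∀ᶠ u : ℂ in cofinite, gradOrder f γ = gradOrder f (γ + term u e)) ↔ q₀ ≤ φ := by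
  rw [hγ.gradOrder_eq hm hf hq₀]
  have h1 := h.eventually_gradOrder hf.1 hγ.1 he
  have h2 := h.le_order
  rw [hq₀, WithTop.coe_le_coe] at h2
  constructor
  · intro h3
    obtain ⟨u, h4, h5⟩ := (h1.and h3).exists
    rw [h4, WithTop.coe_inj] at h5
    rw [h5]
    exact h.le_φ
  · intro h3
    have h4 : q = q₀ := by
      rcases h.eq_or with h4 | h4
      · linarith
      · rw [h.b₀_ne_zero_iff, hq₀, WithTop.coe_inj] at h4
        linarith
    exact h1.mono fun u hu => by rw [hu, h4]

theorem IsNewton.le_φ_iff (hm : 0 < m) (hf : IsMiniRegular f m) (hγ : γ ∈ D1) (he : 1 ≤ e)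
    (h : IsNewton f γ e φ q p b₀) : q₀ ≤ φ ↔ ∀ k ∈ Finset.Icc 1 m, ∀ n : ℚ,
      orderAlong (dz^[k] f) γ = (n : WithTop ℚ) → q₀ + e ≤ n + k * e := by
  constructor
  · intro h1 k hk n hn
    have := h.le_add (Finset.mem_Icc.mp hk).1 hn
    linarith
  · intro h1
    obtain ⟨k, hk⟩ := h.exists_coeff_ne_zero
    have hkm := h.le_of_coeff_ne_zero hm hf hγ (by linarith) hk
    obtain ⟨hk1, n, -, hn, hne⟩ := h.exists_order hk
    have := h1 k (Finset.mem_Icc.mpr ⟨hk1, hkm⟩) n hn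
    linarith

/-- If `f` does not vanish along the polar, then the gradient degree is finite.  It is the least
slope `e ≥ 1` for which the generic order of `f_z` is at least the order `q₀` of the gradient
along `γ`. -/
theorem IsPolar.exists_gradDeg (hm : 0 < m) (hf : IsMiniRegular f m) (hγ : IsPolar f γ)
    (hq₀ : orderAlong f γ = ((q₀ + 1 : ℚ) : WithTop ℚ)) :
    ∃ d : ℚ, gradDeg f γ = d := by
  -- The condition of `IsNewton.le_φ_iff` for the exponent `k` is a lower bound `c k` for the slope.
  have hc : ∀ k, ∃ c : ℚ, 1 ≤ k → ∀ e, 1 ≤ e → ((∀ n : ℚ,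
      orderAlong (dz^[k] f) γ = (n : WithTop ℚ) → q₀ + e ≤ n + k * e) ↔ c ≤ e) := by
    intro k
    by_cases hk : 2 ≤ k
    · have hk' : (0 : ℚ) < k - 1 := by
        have : (2 : ℚ) ≤ k := by exact_mod_cast hk
        linarith
      cases hn : orderAlong (dz^[k] f) γ with
      | top =>
        exact ⟨1, fun _ e he => iff_of_true (fun n hn => absurd hn WithTop.top_ne_coe) he⟩
      | coe n =>
        refine ⟨(q₀ - n) / (k - 1), fun _ e he => ?_⟩
        rw [div_le_iff₀ hk']
        constructor
        · intro h1
          have := h1 n rfl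
          linarith
        · intro h1 n' hn'
          rw [← WithTop.coe_inj.mp hn']
          linarith
    · refine ⟨1, fun hk1 e he => iff_of_true (fun n hn => ?_) he⟩
      obtain rfl : k = 1 := by omega
      rw [hγ.orderAlong_dz] at hn
      exact absurd hn WithTop.top_ne_coe
  choose c hc using hc
  have hne : (Finset.Icc 1 m).Nonempty := ⟨1, Finset.mem_Icc.mpr ⟨le_rfl, hm⟩⟩
  refine ⟨(Finset.Icc 1 m).sup' hne fun k => max 1 (c k), gradDeg_eq_coe_iff.mpr ?_⟩
  have hiff : ∀ e : ℚ, (1 ≤ e ∧ ∀ᶠ u : ℂ in cofinite,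
      gradOrder f γ = gradOrder f (γ + term u e)) ↔
      (Finset.Icc 1 m).sup' hne (fun k => max 1 (c k)) ≤ e := by
    intro e
    rw [Finset.sup'_le_iff]
    constructor
    · rintro ⟨he, h1⟩ k hk
      obtain ⟨φ, q, p, b₀, h⟩ := exists_isNewton hm hf hγ.1 he
      rw [hγ.eventually_gradOrder_iff hm hf hq₀ he h, h.le_φ_iff hm hf hγ.1 he] at h1
      exact max_le he ((hc k (Finset.mem_Icc.mp hk).1 e he).mp (h1 k hk))
    · intro h1
      obtain ⟨k, hk⟩ := hne
      have he : 1 ≤ e := le_trans (le_max_left _ _) (h1 k hk)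
      obtain ⟨φ, q, p, b₀, h⟩ := exists_isNewton hm hf hγ.1 he
      rw [hγ.eventually_gradOrder_iff hm hf hq₀ he h, h.le_φ_iff hm hf hγ.1 he]
      exact ⟨he, fun k hk => (hc k (Finset.mem_Icc.mp hk).1 e he).mpr
        (le_trans (le_max_right _ _) (h1 k hk))⟩
  exact ⟨(hiff _).mpr le_rfl, fun e he => (hiff e).mp he⟩

theorem IsPolar.exists_orderAlong (hm : 0 < m) (hf : IsMiniRegular f m) (hγ : IsPolar f γ)
    (hd : gradDeg f γ = (d : WithTop ℚ)) :
    1 ≤ d ∧ ∃ q₀ : ℚ, orderAlong f γ = ((q₀ + 1 : ℚ) : WithTop ℚ) := by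
  have h1 := (gradDeg_eq_coe_iff.mp hd).1
  refine ⟨h1.1, ?_⟩
  obtain ⟨φ, q, p, b₀, h⟩ := exists_isNewton hm hf hγ.1 h1.1
  obtain ⟨u, h2, h3⟩ := (h1.2.and (h.eventually_gradOrder hf.1 hγ.1 h1.1)).exists
  have h4 : gradOrder f γ ≠ ⊤ := by
    rw [h2, h3]
    exact WithTop.coe_ne_top
  obtain ⟨r, hr⟩ := WithTop.ne_top_iff_exists.mp (hγ.orderAlong_ne_top hm hf h4)
  exact ⟨r - 1, by rw [← hr, sub_add_cancel]⟩

theorem IsPolar.gradDeg_le_iff (hm : 0 < m) (hf : IsMiniRegular f m) (hγ : IsPolar f γ)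
    (hd : gradDeg f γ = (d : WithTop ℚ)) (hq₀ : orderAlong f γ = ((q₀ + 1 : ℚ) : WithTop ℚ))
    (he : 1 ≤ e) (h : IsNewton f γ e φ q p b₀) : d ≤ e ↔ q₀ ≤ φ := by
  have h1 := gradDeg_eq_coe_iff.mp hd
  constructor
  · intro h2
    obtain ⟨φ', q', p', b', h'⟩ := exists_isNewton hm hf hγ.1 h1.1.1
    have h3 := (hγ.eventually_gradOrder_iff hm hf hq₀ h1.1.1 h').mp h1.1.2
    rw [h'.le_φ_iff hm hf hγ.1 h1.1.1] at h3
    rw [h.le_φ_iff hm hf hγ.1 he]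
    intro k hk n hn
    have h4 := h3 k hk n hn
    have h5 : (1 : ℚ) ≤ k := by exact_mod_cast (Finset.mem_Icc.mp hk).1
    nlinarith
  · intro h2
    exact h1.2 ⟨he, (hγ.eventually_gradOrder_iff hm hf hq₀ he h).mpr h2⟩

theorem IsPolar.q_eq (hm : 0 < m) (hf : IsMiniRegular f m) (hγ : IsPolar f γ)
    (hd : gradDeg f γ = (d : WithTop ℚ)) (hq₀ : orderAlong f γ = ((q₀ + 1 : ℚ) : WithTop ℚ))
    (he : 1 ≤ e) (h : IsNewton f γ e φ q p b₀) (hde : d ≤ e) : q = q₀ ∧ b₀ ≠ 0 := by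
  have h1 := (hγ.gradDeg_le_iff hm hf hd hq₀ he h).mp hde
  have h2 := h.le_order
  rw [hq₀, WithTop.coe_le_coe] at h2
  have h3 : q = q₀ := by
    rcases h.eq_or with h4 | h4
    · linarith
    · rw [h.b₀_ne_zero_iff, hq₀, WithTop.coe_inj] at h4
      linarith
  exact ⟨h3, h.b₀_ne_zero_iff.mpr (by rw [hq₀, h3])⟩

theorem IsMiniRegular.le_q₀ (hf : IsMiniRegular f m) (hγ : γ ∈ D1)
    (hq₀ : orderAlong f γ = ((q₀ + 1 : ℚ) : WithTop ℚ)) : (m : ℚ) - 1 ≤ q₀ := by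
  have := hf.le_orderAlong hγ
  rw [hq₀, WithTop.coe_le_coe] at this
  linarith

/-- The gradient degree is a slope at which the orders of `f_z` and of the gradient agree. -/
theorem IsPolar.φ_eq (hm : 0 < m) (hf : IsMiniRegular f m) (hγ : IsPolar f γ)
    (hd : gradDeg f γ = (d : WithTop ℚ)) (hq₀ : orderAlong f γ = ((q₀ + 1 : ℚ) : WithTop ℚ))
    (h : IsNewton f γ d φ q p b₀) : φ = q₀ := by
  have hd1 := (gradDeg_eq_coe_iff.mp hd).1.1
  have h1 := (hγ.gradDeg_le_iff hm hf hd hq₀ hd1 h).mp le_rfl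
  by_contra hne
  have hlt : q₀ < φ := lt_of_le_of_ne h1 (Ne.symm hne)
  have hmq : (0 : ℚ) < m := by exact_mod_cast hm
  rcases hd1.eq_or_lt with rfl | hd1'
  · have h2 := h.le_add hm (hf.orderAlong_iterate_dz hγ.1)
    have h3 := hf.le_q₀ hγ.1 hq₀
    linarith
  · -- The condition which defines the gradient degree also holds for a smaller exponent `e`.
    set e := max 1 (d - (φ - q₀) / m) with he
    have he1 : 1 ≤ e := le_max_left _ _
    have hed : e < d := max_lt hd1' (by
      have : 0 < (φ - q₀) / m := div_pos (by linarith) hmq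
      linarith)
    have hed' : (m : ℚ) * (d - e) ≤ φ - q₀ := by
      have h2 := le_max_right 1 (d - (φ - q₀) / m)
      rw [← he] at h2
      have h3 : d - e ≤ (φ - q₀) / m := by linarith
      rwa [le_div_iff₀ hmq, mul_comm] at h3
    obtain ⟨φ', q', p', b', h'⟩ := exists_isNewton hm hf hγ.1 he1
    refine absurd ((hγ.gradDeg_le_iff hm hf hd hq₀ he1 h').mpr ?_) (not_le.mpr hed)
    rw [h'.le_φ_iff hm hf hγ.1 he1]
    intro k hk n hn
    have h2 := h.le_add (Finset.mem_Icc.mp hk).1 hn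
    have h3 : (k : ℚ) ≤ m := by exact_mod_cast (Finset.mem_Icc.mp hk).2
    nlinarith

/-- Beyond the gradient degree, the order of the gradient is constant. -/
theorem IsPolar.gradOrder_const (hm : 0 < m) (hf : IsMiniRegular f m) (hγ : IsPolar f γ)
    (hd : gradDeg f γ = (d : WithTop ℚ)) (hq₀ : orderAlong f γ = ((q₀ + 1 : ℚ) : WithTop ℚ))
    (hde : d < e) (hβ : β ∈ D1) (hle : (e : WithTop ℚ) ≤ (β - γ).orderTop) :
    gradOrder f β = q₀ := by
  have hd1 := (gradDeg_eq_coe_iff.mp hd).1.1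
  have he : 1 < e := by linarith
  obtain ⟨φ, q, p, b₀, h⟩ := exists_isNewton hm hf hγ.1 he.le
  obtain ⟨h1, h2⟩ := hγ.q_eq hm hf hd hq₀ he.le h hde.le
  rw [← h1]
  refine ((h.lead β hβ hle).le_gradOrder hf.1 hβ he.le).2 (Or.inr ?_)
  simpa [he.ne'] using h2

end GradientDegree

/-! ### The curvature on a gradient canyon -/

section Canyon

variable {f : ℂ × ℂ → ℂ} {m : ℕ} {α β γ : HahnSeries ℚ ℂ} {e φ q d q₀ : ℚ} {p : Polynomial ℂ}
  {b₀ : ℂ}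

/-- The leading coefficient of `Δ_f` on a canyon does not vanish identically: as a function of `u`,
its order at `0` is one less than the order of `P`. -/
theorem finite_leadΔ_eq_zero {P B : Polynomial ℂ} (hP : P ≠ 0) (hP0 : P.eval 0 = 0)
    (hB : B.eval 0 ≠ 0) {q : ℂ} (hq : q + 1 ≠ 0) (flag : Prop) [Decidable flag] :
    {u : ℂ | leadΔ flag q (B.eval u) (P.eval u) (P.derivative.eval u) = 0}.Finite := by
  set D : Polynomial ℂ := -P.derivative * (Polynomial.C (q + 1) * B) ^ 2 +
    if flag then Polynomial.C q * (Polynomial.C (q + 1) * B) * P ^ 2 else 0 with hD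
  have heval : ∀ u, D.eval u = leadΔ flag q (B.eval u) (P.eval u) (P.derivative.eval u) := by
    intro u
    rw [hD, leadΔ]
    split_ifs <;> simp
  suffices hD0 : D ≠ 0 by
    refine (eventually_eval_ne_zero hD0).subset fun u hu => ?_
    simpa [heval] using hu
  intro hD0
  obtain ⟨r, hr, hrd⟩ := P.exists_eq_pow_rootMultiplicity_mul_and_not_dvd hP 0
  have hpos := (Polynomial.rootMultiplicity_pos hP).mpr hP0
  obtain ⟨k, hk⟩ := Nat.exists_eq_succ_of_ne_zero hpos.ne'
  rw [hk, Polynomial.C_0, sub_zero] at hr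
  have hr0 : r.eval 0 ≠ 0 := fun h => hrd (Polynomial.dvd_iff_isRoot.mpr h)
  have hder : P.derivative =
      Polynomial.X ^ k * (((k + 1 : ℕ) : Polynomial ℂ) * r + Polynomial.X * r.derivative) := by
    rw [hr, Polynomial.derivative_mul, Polynomial.derivative_X_pow]
    simp only [Nat.succ_eq_add_one, Nat.add_sub_cancel, map_natCast]
    ring
  have hfac : D = Polynomial.X ^ k *
      (-(((k + 1 : ℕ) : Polynomial ℂ) * r + Polynomial.X * r.derivative) *
        (Polynomial.C (q + 1) * B) ^ 2 +
      if flag then Polynomial.C q * (Polynomial.C (q + 1) * B) * (Polynomial.X ^ (k + 2) * r ^ 2)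
        else 0) := by
    rw [hD, hder]
    split_ifs
    · rw [hr]
      simp only [Nat.succ_eq_add_one]
      ring
    · ring
  rw [hfac, mul_eq_zero] at hD0
  have h1 := congrArg (Polynomial.eval 0) (hD0.resolve_left (pow_ne_zero _ Polynomial.X_ne_zero))
  have h2 : -(((k : ℂ) + 1) * r.eval 0) * ((q + 1) * B.eval 0) ^ 2 = 0 := by
    split_ifs at h1 <;> simpa using h1
  have h3 : (k : ℂ) + 1 ≠ 0 := by exact_mod_cast k.succ_ne_zero
  exact mul_ne_zero (neg_ne_zero.mpr (mul_ne_zero h3 hr0)) (pow_ne_zero _ (mul_ne_zero hq hB)) h2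

theorem leadK_nonneg (flag : Prop) [Decidable flag] (e : ℚ) (q c b p₁ p₂ : ℂ) :
    0 ≤ leadK flag e q c b p₁ p₂ := by
  have h1 := nrm_nonneg (p₁, (q + 1) * b - c * p₁)
  have h2 := nrm_nonneg (c, 1)
  rw [leadK]
  positivity

theorem leadK_eq_zero {flag : Prop} [Decidable flag] {e : ℚ} {q c b p₁ p₂ : ℂ} (hq : q + 1 ≠ 0)
    (hne : p₁ ≠ 0 ∨ b ≠ 0) (h : leadK flag e q c b p₁ p₂ = 0) : leadΔ flag q b p₁ p₂ = 0 := by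
  have h1 : 0 < nrm (p₁, (q + 1) * b - c * p₁) := by
    refine nrm_pos fun h0 => ?_
    rw [Prod.mk_eq_zero] at h0
    obtain ⟨h2, h3⟩ := h0
    rw [h2, mul_zero, sub_zero, mul_eq_zero] at h3
    exact hne.elim (fun h => h h2) fun h => h3.elim hq h
  have h2 : 0 < nrm (c, 1) := nrm_pos (by simp)
  by_contra h0
  have h3 : 0 < ‖leadΔ flag q b p₁ p₂‖ := norm_pos_iff.mpr h0
  have : 0 < leadK flag e q c b p₁ p₂ := by
    rw [leadK]
    positivity
  exact this.ne' h

theorem coeff_one_eq (he : 1 ≤ e) (hle : (e : WithTop ℚ) ≤ (β - γ).orderTop) :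
    β.coeff 1 = (γ + term ((β - γ).coeff e) e).coeff 1 := by
  rw [HahnSeries.coeff_add, term]
  rcases he.eq_or_lt with rfl | he
  · simp
  · have h1 : (β - γ).coeff 1 = 0 := HahnSeries.coeff_eq_zero_of_lt_orderTop
      (lt_of_lt_of_le (by exact_mod_cast he) hle)
    rw [HahnSeries.coeff_sub, sub_eq_zero] at h1
    rw [HahnSeries.coeff_single_of_ne he.ne, add_zero, h1]

/-- A canyon of degree `1` contains all of `D1`, so that it is minimal only if all polars have
gradient degree `1`. -/
theorem gradDeg_eq_one_of_isMinimal {γ' : HahnSeries ℚ ℂ} (hm : 0 < m) (hf : IsMiniRegular f m)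
    (hd : gradDeg f γ = ((1 : ℚ) : WithTop ℚ)) (hγ : IsPolar f γ) (hmin : IsMinimal f γ)
    (hγ' : IsPolar f γ') : gradDeg f γ' = ((1 : ℚ) : WithTop ℚ) := by
  have h1 : canyon f γ' = canyon f γ := hmin γ' hγ' fun α hα =>
    ⟨hα.1, by rw [hd]; exact one_le_orderTop_sub hα.1 hγ.1⟩
  have hmem := add_term_mem_D1 hγ'.1 le_rfl 1
  have h2 : γ' + term 1 1 ∈ canyon f γ :=
    ⟨hmem, by rw [hd]; exact one_le_orderTop_sub hmem hγ.1⟩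
  rw [← h1] at h2
  have h3 := h2.2
  rw [add_sub_cancel_left, term, HahnSeries.orderTop_single one_ne_zero] at h3
  obtain ⟨d', hd'⟩ := WithTop.ne_top_iff_exists.mp (ne_top_of_le_ne_top WithTop.coe_ne_top h3)
  rw [← hd', WithTop.coe_le_coe] at h3
  rw [← hd', WithTop.coe_inj]
  exact le_antisymm h3 (hγ'.exists_orderAlong hm hf hd'.symm).1

/-- If the canyon is minimal, then the gradient has the same order along all arcs in the canyon.
Otherwise there would be a polar in the canyon along which the order of the gradient is larger,
and its canyon would be smaller. -/
theorem IsPolar.gradient_lead_ne_zero (hm : 0 < m) (hf : IsMiniRegular f m) (hγ : IsPolar f γ)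
    (hd : gradDeg f γ = (d : WithTop ℚ)) (hmin : 1 < d ∨ IsMinimal f γ)
    (hq₀ : orderAlong f γ = ((q₀ + 1 : ℚ) : WithTop ℚ)) (h : IsNewton f γ d φ q p b₀) (u : ℂ) :
    p.derivative.eval u ≠ 0 ∨ b₀ + (if d = 1 then p.eval u else 0) ≠ 0 := by
  have hd1 := (hγ.exists_orderAlong hm hf hd).1
  obtain ⟨hq, hb⟩ := hγ.q_eq hm hf hd hq₀ hd1 h le_rfl
  have hφ := hγ.φ_eq hm hf hd hq₀ h
  by_contra! hcon
  obtain ⟨h1, h2⟩ := hcon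
  by_cases hdd : d = 1
  swap
  · exact hb (by simpa [hdd] using h2)
  subst hdd
  have hmin' := hmin.resolve_left (lt_irrefl _)
  obtain ⟨γ', hγ', hle, hu⟩ := h.exists_polar u h1
  have hd' := gradDeg_eq_one_of_isMinimal hm hf hd hγ hmin' hγ'
  have h3 := (h.lead γ' hγ'.1 hle).orderAlong hf.1 hγ'.1
  rw [hu] at h3
  obtain ⟨-, q', hq'⟩ := hγ'.exists_orderAlong hm hf hd'
  obtain ⟨φ', q'', p', b', h'⟩ := exists_isNewton hm hf hγ'.1 (le_refl (1 : ℚ))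
  have e1 := hγ'.φ_eq hm hf hd' hq' h'
  have e2 := h.le_add hm (hf.orderAlong_iterate_dz hγ.1)
  have e3 := h'.le_add hm (hf.orderAlong_iterate_dz hγ'.1)
  have e4 := hf.le_q₀ hγ.1 hq₀
  have e5 := hf.le_q₀ hγ'.1 hq'
  refine (h3.2.mpr ?_) (by simpa [hq, hφ] using h2)
  rw [hq', WithTop.coe_inj]
  linarith

/-- Along every `β = γ + u y ^ d + ⋯`, including the terms of order greater than `d`, the gradient
does not vanish and `K / s ^ (- 2 d)` tends to `2 R (u)`, where `R ≥ 0` has only finitely many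
zeros.  The distance `nrm` from the origin stands for the arc length, to which it is asymptotic.
-/
def HornLimit (f : ℂ × ℂ → ℂ) (γ : HahnSeries ℚ ℂ) (d : ℚ) (R : ℂ → ℝ) : Prop :=
  {u | R u = 0}.Finite ∧ (∀ u, 0 ≤ R u) ∧ ∀ β ∈ D1,
    (d : WithTop ℚ) ≤ (β - γ).orderTop → (∀ᶠ p in punct (germ β), dz f p ≠ 0 ∨ dw f p ≠ 0) ∧
    Tendsto (fun p => K f p / nrm p ^ ((-2 * d : ℚ) : ℝ)) (punct (germ β))
      (𝓝 (2 * R ((β - γ).coeff d)))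

/-- The curvature on a minimal canyon, and on every canyon of degree greater than `1`: the gradient
has the same order along all arcs in the canyon, so that the limit of `K / s ^ (- 2 d)` is given by
the leading coefficients of `f`, `f_z` and `f_zz`. -/
theorem IsPolar.exists_curvature (hm : 0 < m) (hf : IsMiniRegular f m) (hγ : IsPolar f γ)
    (hd : gradDeg f γ = (d : WithTop ℚ)) (hmin : 1 < d ∨ IsMinimal f γ) :
    ∃ R, HornLimit f γ d R := by
  obtain ⟨hd1, q₀, hq₀⟩ := hγ.exists_orderAlong hm hf hd
  obtain ⟨φ, q, p, b₀, h⟩ := exists_isNewton hm hf hγ.1 hd1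
  obtain ⟨hq, hb⟩ := hγ.q_eq hm hf hd hq₀ hd1 h le_rfl
  have hφ : q = φ := hq.trans (hγ.φ_eq hm hf hd hq₀ h).symm
  have hne := hγ.gradient_lead_ne_zero hm hf hd hmin hq₀ h
  have hq1 : (q : ℂ) + 1 ≠ 0 := by
    have : q + 1 ≠ 0 := by have := h.nonneg; linarith
    exact_mod_cast this
  refine ⟨fun u => leadK (d = 1) d q ((γ + term u d).coeff 1)
    (b₀ + if d = 1 then p.eval u else 0) (p.derivative.eval u)
    (p.derivative.derivative.eval u) / 2, ?_, ?_, ?_⟩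
  · have hp' := derivative_ne_zero h.ne_zero h.coeff_zero
    have hp0 : p.eval 0 = 0 := by rw [← Polynomial.coeff_zero_eq_eval_zero, h.coeff_zero]
    refine (finite_leadΔ_eq_zero (B := Polynomial.C b₀ + if d = 1 then p else 0) hp'
      (h.derivative_eval_zero hγ) ?_ hq1 (d = 1)).subset fun u hu => ?_
    · split_ifs <;> simpa [hp0] using hb
    · have hu' : leadK (d = 1) d q ((γ + term u d).coeff 1)
        (b₀ + if d = 1 then p.eval u else 0) (p.derivative.eval u)
        (p.derivative.derivative.eval u) / 2 = 0 := hu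
      have h1 := leadK_eq_zero hq1 (hne u) ((div_eq_zero_iff.mp hu').resolve_right two_ne_zero)
      have h2 : (Polynomial.C b₀ + if d = 1 then p else 0).eval u =
          b₀ + if d = 1 then p.eval u else 0 := by split_ifs <;> simp
      rw [Set.mem_ofPred_eq, h2]
      exact h1
  · intro u
    exact div_nonneg (leadK_nonneg _ _ _ _ _ _ _) two_pos.le
  · intro β hβ hle
    have h1 := h.lead β hβ hle
    simp only [hφ, if_true, true_and] at h1
    have h2 := h1.curvature hf.1 hβ hd1 (hne _)
    refine ⟨h2.1, ?_⟩
    have h3 := h2.2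
    rw [coeff_one_eq hd1 hle] at h3
    simp only [hφ]
    rwa [mul_div_cancel₀ _ (two_ne_zero' ℝ)]

/-- On a canyon of degree `d > 1` the orders of `f` and of its gradient are constant, so that every
polar in it has gradient degree at most `d`. -/
theorem isMinimal_of_one_lt (hm : 0 < m) (hf : IsMiniRegular f m) (hγ : IsPolar f γ)
    (hd : gradDeg f γ = (d : WithTop ℚ)) (hd1 : 1 < d) : IsMinimal f γ := by
  obtain ⟨-, q₀, hq₀⟩ := hγ.exists_orderAlong hm hf hd
  obtain ⟨φ, q, p, b₀, h⟩ := exists_isNewton hm hf hγ.1 hd1.le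
  obtain ⟨hq, hb⟩ := hγ.q_eq hm hf hd hq₀ hd1.le h le_rfl
  intro γ' hγ' hsub
  have hle : (d : WithTop ℚ) ≤ (γ' - γ).orderTop := by
    rw [← hd]
    exact (hsub ⟨hγ'.1, by rw [sub_self, HahnSeries.orderTop_zero]; exact le_top⟩).2
  have hconst : ∀ β ∈ D1, (d : WithTop ℚ) ≤ (β - γ).orderTop →
      gradOrder f β = q₀ ∧ orderAlong f β = ((q₀ + 1 : ℚ) : WithTop ℚ) := by
    intro β hβ hβle
    have h1 := h.lead β hβ hβle
    simp only [hd1.ne', and_false, if_false, add_zero] at h1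
    rw [← hq]
    exact ⟨(h1.le_gradOrder hf.1 hβ hd1.le).2 (Or.inr hb), (h1.orderAlong hf.1 hβ).2.mp hb⟩
  obtain ⟨d', hd'⟩ := hγ'.exists_gradDeg hm hf (hconst γ' hγ'.1 hle).2
  have hd'1 := (hγ'.exists_orderAlong hm hf hd').1
  have h1 : d' ≤ d := by
    refine (gradDeg_eq_coe_iff.mp hd').2 ⟨hd1.le, Eventually.of_forall fun u => ?_⟩
    rw [(hconst γ' hγ'.1 hle).1, (hconst _ (add_term_mem_D1 hγ'.1 hd1.le u) (by
      exact le_orderTop_sub_trans (le_orderTop_add_term_sub γ' u d) hle)).1]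
  have h2 : d ≤ d' := by
    have hmem : γ' + term 1 d' ∈ canyon f γ' :=
      ⟨add_term_mem_D1 hγ'.1 hd'1 1, by rw [hd']; exact le_orderTop_add_term_sub γ' 1 d'⟩
    have h3 := (hsub hmem).2
    rw [hd] at h3
    have h4 := le_orderTop_sub_trans h3 (orderTop_sub_comm γ' γ ▸ hle)
    rw [add_sub_cancel_left, term, HahnSeries.orderTop_single one_ne_zero] at h4
    exact_mod_cast h4
  obtain rfl := le_antisymm h1 h2
  refine hsub.antisymm fun α hα => ⟨hα.1, ?_⟩
  have h3 := hα.2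
  rw [hd] at h3
  rw [hd']
  exact le_orderTop_sub_trans h3 (orderTop_sub_comm γ' γ ▸ hle)

theorem hasK_of_tendsto (hβ : β ∈ D1) {r : ℚ} {a : ℝ} (ha : 0 < a)
    (h : (∀ᶠ p in punct (germ β), dz f p ≠ 0 ∨ dw f p ≠ 0) ∧
      Tendsto (fun p => K f p / nrm p ^ ((r : ℚ) : ℝ)) (punct (germ β)) (𝓝 a)) :
    HasK f (germ β) r a :=
  (hasK_iff (germ_mem_CPstar hβ)).mpr ⟨h.1, Or.inr ⟨r, rfl, ha, h.2⟩⟩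

theorem IsPolar.eventually_hasL (hm : 0 < m) (hf : IsMiniRegular f m) (hγ : IsPolar f γ)
    (hd : gradDeg f γ = (d : WithTop ℚ)) (hmin : 1 < d ∨ IsMinimal f γ) :
    ∀ᶠ u in cofinite, HasL f (germ (γ + term u d)) ((-2 * d : ℚ) : WithTop ℚ) := by
  obtain ⟨R, hR, hR0, h⟩ := hγ.exists_curvature hm hf hd hmin
  have hd1 := (hγ.exists_orderAlong hm hf hd).1
  have h1 : ∀ᶠ u in cofinite, R u ≠ 0 := by
    refine hR.subset fun u hu => ?_
    simpa using hu
  filter_upwards [h1] with u hu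
  have hmem := add_term_mem_D1 hγ.1 hd1 u
  have h2 := h _ hmem (le_orderTop_add_term_sub γ u d)
  rw [coeff_add_term_sub] at h2
  exact ⟨_, hasK_of_tendsto hmem (mul_pos two_pos (lt_of_le_of_ne (hR0 u) hu.symm)) h2⟩

end Canyon

/-! ### Arcs with tangent `[1:0]` -/

section VerticalTangent

variable {f : ℂ × ℂ → ℂ} {m : ℕ}

theorem analyticAt_comp_swap (hf : AnalyticAt ℂ f 0) : AnalyticAt ℂ (f ∘ Prod.swap) 0 :=
  AnalyticAt.comp₂ (h := f) (f := fun x : ℂ × ℂ => x.2) (g := fun x => x.1) hf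
    analyticAt_snd analyticAt_fst

theorem isRep_zero : IsRep 1 (fun _ => 0) 0 :=
  ⟨one_pos, fun q hq => absurd rfl hq, Eventually.of_forall fun t => by simp⟩

theorem zero_mem_D1 : (0 : HahnSeries ℚ ℂ) ∈ D1 :=
  isRep_zero.mem_D1 (by rw [HahnSeries.orderTop_zero]; exact le_top)

/-- After the interchange of the coordinates, mini-regularity means that the tangent `[1:0]` is not
a zero of the initial form of `f`. -/
theorem exists_lead_swap (hm : 0 < m) (hf : IsMiniRegular f m) :
    ∃ p : Polynomial ℂ, p.eval 0 ≠ 0 ∧ ∀ β ∈ D1, Lead (f ∘ Prod.swap) β 1 (m - 1)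
      (p.eval (β.coeff 1)) (p.derivative.eval (β.coeff 1))
      (p.derivative.derivative.eval (β.coeff 1)) := by
  have hfs := analyticAt_comp_swap hf.1
  have htc : analyticOrderAt (taylorCoeff (f ∘ Prod.swap) 0) 0 = m := by
    rw [← hf.2.2]
    congr 1
    funext t
    simp [taylorCoeff]
  obtain ⟨b, p, G, hp0, hG, hGp, hGeq, hb, hpc⟩ := exists_scaling hfs (E := 1) le_rfl (k₀ := 0)
    (by rw [htc]; exact ENat.natCast_ne_top m)
  -- `b` is the order of `f` along the generic line, and `m` is the order along the line `w = 0`.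
  have hbm : b = m := by
    apply le_antisymm
    · have := hb 0
      rw [htc] at this
      exact_mod_cast (by simpa using this : (b : ℕ∞) ≤ m)
    · obtain ⟨u, hu⟩ := (eventually_eval_ne_zero hp0).exists
      have ht : Tendsto (fun t : ℂ => ((u, t) : ℂ × ℂ)) (𝓝 0) (𝓝 (u, 0)) :=
        (by fun_prop : Continuous fun t : ℂ => ((u, t) : ℂ × ℂ)).tendsto' _ _ rfl
      have hGu : AnalyticAt ℂ (fun t => G (u, t)) 0 :=
        analyticAt_pair (a := fun _ => u) (b := fun t => t) (hG u) analyticAt_const analyticAt_id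
      have hline : AnalyticAt ℂ (fun t : ℂ => f (t, t * u)) 0 :=
        analyticAt_pair (a := fun t => t) (b := fun t => t * u)
          (by simpa [← Prod.zero_eq_mk] using hf.1) analyticAt_id (by fun_prop)
      have h1 : analyticOrderAt (fun t : ℂ => f (t, t * u)) 0 = b := by
        rw [analyticOrderAt_eq_of_eq_pow_mul hline hGu (n := b)
          (nhdsWithin_le_nhds ((ht.eventually (hGeq u)).mono fun t h => by simpa using h)),
          hGu.analyticOrderAt_eq_zero.mpr (by rwa [hGp]), add_zero]
      have h2 : (m : ℕ∞) ≤ analyticOrderAt (fun t : ℂ => f (t, t * u)) 0 := by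
        refine le_analyticOrderAt_of_isBigO hline ?_
        have h3 : Tendsto (fun t : ℂ => ((t, t * u) : ℂ × ℂ)) (𝓝[≠] 0) (𝓝 0) :=
          ((by fun_prop : Continuous fun t : ℂ => ((t, t * u) : ℂ × ℂ)).tendsto' 0 0
            (by simp)).mono_left nhdsWithin_le_nhds
        refine (hf.2.1.comp_tendsto h3).trans ?_
        have h4 : (fun t : ℂ => ((t, t * u) : ℂ × ℂ)) =O[𝓝[≠] 0] fun t : ℂ => t :=
          (isBigO_refl _ _).prod_left (by simpa [mul_comm] using
            (isBigO_refl (fun t : ℂ => t) (𝓝[≠] 0)).const_mul_left u)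
        exact h4.norm_left.pow m
      rw [h1] at h2
      exact_mod_cast h2
  subst hbm
  refine ⟨p, ?_, fun β hβ => ?_⟩
  · rw [← Polynomial.coeff_zero_eq_eval_zero, hpc, htc]
    simp
  · have h := lead_of_scaling (f := f ∘ Prod.swap) hfs isRep_zero zero_mem_D1 (le_refl (1 : ℚ))
      (E := 1) (by simp) hG hGp (F₀ := fun _ => 0) (b := b)
      (fun u => (hGeq u).mono fun x hx => by simpa using hx) (Q := b - 1) (F₁ := fun _ => 0)
      analyticAt_const (by simp) (by omega) (q := b - 1)
      (by rw [Nat.cast_sub (by omega)]; simp) hβ (by simpa using hβ.1)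
    have h1 : b = b - 1 + 1 := by omega
    simpa [← h1] using h

/-- Along arcs whose tangent is not a zero of the initial form, in particular along those with
tangent `[1:0]`, the gradient has the minimal order `m - 1` and the curvature has an order of at
least `-2`. -/
theorem exists_curvature_swap (hm : 0 < m) (hf : IsMiniRegular f m) :
    ∃ p : Polynomial ℂ, p.eval 0 ≠ 0 ∧ ∀ β ∈ D1, p.eval (β.coeff 1) ≠ 0 →
      gradOrder (f ∘ Prod.swap) β = ((m - 1 : ℚ) : WithTop ℚ) ∧
      ∃ L, HasL f (germ' β) L ∧ ((-2 : ℚ) : WithTop ℚ) ≤ L := by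
  have hfs := analyticAt_comp_swap hf.1
  obtain ⟨p, hp, h⟩ := exists_lead_swap hm hf
  refine ⟨p, hp, fun β hβ hne => ⟨?_, ?_⟩⟩
  · exact ((h β hβ).le_gradOrder hfs hβ le_rfl).2 (Or.inr hne)
  · obtain ⟨L, a, h1, h2⟩ := (h β hβ).exists_hasK hfs hβ le_rfl (Or.inr hne)
    exact ⟨L, (hasL_germ'_iff hβ).mpr ⟨a, h1⟩, by simpa using h2⟩

theorem coeff_one_eq_zero {β : HahnSeries ℚ ℂ} (h : 1 < β.orderTop) : β.coeff 1 = 0 :=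
  HahnSeries.coeff_eq_zero_of_lt_orderTop h

theorem exists_hasL_germ' (hm : 0 < m) (hf : IsMiniRegular f m) {β : HahnSeries ℚ ℂ}
    (hβ : β ∈ D1) (hβ1 : 1 < β.orderTop) :
    ∃ L, HasL f (germ' β) L ∧ ((-2 : ℚ) : WithTop ℚ) ≤ L := by
  obtain ⟨p, hp, h⟩ := exists_curvature_swap hm hf
  exact (h β hβ (by rwa [coeff_one_eq_zero hβ1])).2

end VerticalTangent

/-! ### Horns on which the order of the gradient is constant -/

section ConstantGradient

variable {f : ℂ × ℂ → ℂ} {m : ℕ} {α β γ : HahnSeries ℚ ℂ} {e e₂ r : ℚ} {L : WithTop ℚ}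

theorem finite_range_conj (hα : α ∈ D1) : (Set.range fun k => conj k α).Finite := by
  refine ((Set.finite_Iio (mpuis α)).image fun k => conj k α).subset ?_
  rintro _ ⟨k, rfl⟩
  refine ⟨k % mpuis α, Nat.mod_lt _ hα.2.1, ?_⟩
  change conj (k % mpuis α) α = conj k α
  conv_rhs => rw [← Nat.mod_add_div k (mpuis α)]
  rw [← conj_conj, (isRep_arc hα).conj_mul]

/-- A generic perturbation of order `e₂ < e` leaves the horn of order `e`. -/
theorem eventually_not_le_orderTop (hα : α ∈ D1) (he : e₂ < e) : ∀ᶠ v : ℂ in cofinite,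
    ∀ β, (e : WithTop ℚ) ≤ (β - α).orderTop →
      ∀ k, ¬ (e : WithTop ℚ) ≤ (conj k α - (β + term v e₂)).orderTop := by
  refine ((finite_range_conj hα).image fun δ => δ.coeff e₂ - α.coeff e₂).subset fun v hv => ?_
  simp only [Set.mem_compl_iff, Set.mem_ofPred_eq, not_forall, not_not] at hv
  obtain ⟨β, hβ, k, hk⟩ := hv
  refine ⟨conj k α, ⟨k, rfl⟩, ?_⟩
  have hlt : (e₂ : WithTop ℚ) < e := by exact_mod_cast he
  have h1 := HahnSeries.coeff_eq_zero_of_lt_orderTop (lt_of_lt_of_le hlt hβ)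
  have h2 := HahnSeries.coeff_eq_zero_of_lt_orderTop (lt_of_lt_of_le hlt hk)
  simp only [HahnSeries.coeff_sub, HahnSeries.coeff_add, term, HahnSeries.coeff_single_same]
    at h1 h2
  linear_combination h2 + h1

theorem eventually_hasL_add_term (hf : AnalyticAt ℂ f 0) (hβ : β ∈ D1) (he₂ : 1 ≤ e₂)
    (hconst : ∀ v, gradOrder f (β + term v e₂) = r) (hL : HasL f (germ β) L) (hLtop : L ≠ ⊤) :
    ∀ᶠ v in cofinite, ∃ L' ≤ L, HasL f (germ (β + term v e₂)) L' := by
  obtain ⟨M, ζ, E, hr, heM⟩ := exists_isRep_mul hβ (e := e₂) (by linarith)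
  have hMq : (M : ℚ) ≠ 0 := by exact_mod_cast hr.pos.ne'
  have hrv : ∀ v, IsRep M (fun t => ζ t + t ^ E * v) (β + term v e₂) := fun v =>
    hr.add (isRep_term hr.pos v heM)
  have hmem : ∀ v, β + term v e₂ ∈ D1 := add_term_mem_D1 hβ he₂
  obtain ⟨Q, hQ⟩ : ∃ Q : ℕ, r * M = Q := by
    have h1 := hconst 0
    rw [(hrv 0).gradOrder_eq (hmem 0) hf] at h1
    cases hn : analyticOrderAt (fun t => grad f (ζ t + t ^ E * 0, t ^ M)) 0 with
    | top =>
      rw [hn] at h1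
      exact absurd h1 WithTop.top_ne_coe
    | coe n =>
      rw [hn] at h1
      exact ⟨n, by rw [← WithTop.coe_inj.mp h1, div_mul_cancel₀ _ hMq]⟩
  obtain ⟨ζ₁, hζ₁, -, hζ⟩ := hr.exists_eq_pow_mul_self hβ
  have h := eventually_hasL_perturb hf hr.pos (le_of_mul_natCast he₂ heM) hζ₁ hζ (Q := Q)
    (fun v => by
      have h1 := hconst v
      rw [(hrv v).gradOrder_eq (hmem v) hf, map_div_eq_coe_iff hr.pos hQ,
        ((hrv v).analyticAt_comp (hmem v) (analyticAt_grad hf)).analyticOrderAt_eq_natCast] at h1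
      simpa using h1) (hr.germ_eq hβ ▸ hL) hLtop
  exact h.mono fun v hv => by rwa [(hrv v).germ_eq (hmem v)]

/-- If the order of the gradient is constant on a horn of order `e₂ < e`, then the order of the
curvature does not increase when one leaves the horn of order `e`. -/
theorem false_of_gradOrder_const (hf : AnalyticAt ℂ f 0) (hα : α ∈ D1) (he₂ : 1 ≤ e₂)
    (he : e₂ < e)
    (hconst : ∀ ν ∈ D1, (e₂ : WithTop ℚ) ≤ (ν - α).orderTop → gradOrder f ν = r)
    (hβ : β ∈ D1) (hle : (e : WithTop ℚ) ≤ (β - α).orderTop) (hL : HasL f (germ β) L)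
    (hlt : ∀ ν ∈ D1, (e₂ : WithTop ℚ) ≤ (ν - α).orderTop →
      (∀ k, ¬ (e : WithTop ℚ) ≤ (conj k α - ν).orderTop) → ∃ L', HasL f (germ ν) L' ∧ L < L') :
    False := by
  have hle₂ : ∀ v, (e₂ : WithTop ℚ) ≤ (β + term v e₂ - α).orderTop := fun v =>
    le_orderTop_sub_trans (le_orderTop_add_term_sub β v e₂)
      (le_trans (by exact_mod_cast he.le) hle)
  have hmem : ∀ v, β + term v e₂ ∈ D1 := add_term_mem_D1 hβ he₂
  have hfar := eventually_not_le_orderTop hα he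
  have hLtop : L ≠ ⊤ := by
    obtain ⟨v, hv⟩ := hfar.exists
    obtain ⟨L', -, hL'⟩ := hlt _ (hmem v) (hle₂ v) (hv β hle)
    exact hL'.ne_top
  obtain ⟨v, hv, L', hL'le, hL'⟩ := (hfar.and (eventually_hasL_add_term hf hβ he₂
    (fun v => hconst _ (hmem v) (hle₂ v)) hL hLtop)).exists
  obtain ⟨L'', hL'', hlt'⟩ := hlt _ (hmem v) (hle₂ v) (hv β hle)
  rw [hL''.unique hL'] at hlt'
  exact absurd hL'le (not_le.mpr hlt')

theorem exists_hasL_of_hasGenericL (hα : α ∈ D1) (he : 1 ≤ e)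
    (h : HasGenericL f e (germ α) L) :
    ∃ β ∈ D1, (e : WithTop ℚ) ≤ (β - α).orderTop ∧ HasL f (germ β) L := by
  obtain ⟨α', hα', ⟨h1, h2⟩ | ⟨h1, h2, -⟩⟩ := h
  · obtain ⟨u, hu⟩ := h2.exists
    obtain ⟨k, hk⟩ := exists_eq_conj_of_germ_eq hα hα' h1
    have hmem := add_term_mem_D1 hα' he u
    refine ⟨conj k (α' + term u e), conj_mem_D1 hmem k, ?_, by rwa [germ_conj hmem]⟩
    rw [hk, orderTop_conj_sub_conj]
    exact le_orderTop_add_term_sub α' u e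
  · exact absurd h2 (germ_ne_germ' hα hα' h1)

theorem exists_hasL_of_hasGenericL' (hα : α ∈ D1) (hα1 : 1 < α.orderTop) (he : 1 ≤ e)
    (h : HasGenericL f e (germ' α) L) :
    ∃ β ∈ D1, (e : WithTop ℚ) ≤ (β - α).orderTop ∧ HasL f (germ' β) L := by
  obtain ⟨α', hα', ⟨h1, -⟩ | ⟨-, h2, h3⟩⟩ := h
  · exact absurd h1.symm (germ_ne_germ' hα' hα hα1)
  · obtain ⟨u, hu⟩ := h3.exists
    obtain ⟨k, hk⟩ := exists_eq_conj_of_germ_eq hα hα' (germ'_injective h2)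
    have hmem := add_term_mem_D1 hα' he u
    refine ⟨conj k (α' + term u e), conj_mem_D1 hmem k, ?_, ?_⟩
    · rw [hk, orderTop_conj_sub_conj]
      exact le_orderTop_add_term_sub α' u e
    · rwa [germ'_eq_map_swap, germ_conj hmem, ← germ'_eq_map_swap]

theorem mem_horn_germ_diff (hα : α ∈ D1) (hβ : β ∈ D1) (he₂ : 1 ≤ e₂) (he : 1 < e)
    (h : (e₂ : WithTop ℚ) ≤ (β - α).orderTop)
    (h' : ∀ k, ¬ (e : WithTop ℚ) ≤ (conj k α - β).orderTop) :
    germ β ∈ horn e₂ (germ α) \ horn e (germ α) := by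
  refine ⟨(mem_horn_germ_iff he₂ hα).mpr
    (Or.inl ⟨β, hβ, rfl, by rwa [orderTop_sub_comm]⟩), fun h1 => ?_⟩
  rcases (mem_horn_germ_iff he.le hα).mp h1 with ⟨β', hβ', h2, h3⟩ | ⟨h2, -⟩
  · obtain ⟨k, rfl⟩ := exists_eq_conj_of_germ_eq hβ hβ' h2
    exact h' k (by rwa [orderTop_conj_sub_conj])
  · exact he.ne' h2

theorem mem_horn_germ'_diff (hα : α ∈ D1) (hα1 : 1 < α.orderTop) (hβ : β ∈ D1)
    (hβ1 : 1 < β.orderTop) (he : 1 < e) (h : (e₂ : WithTop ℚ) ≤ (β - α).orderTop)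
    (h' : ∀ k, ¬ (e : WithTop ℚ) ≤ (conj k α - β).orderTop) :
    germ' β ∈ horn e₂ (germ' α) \ horn e (germ' α) := by
  refine ⟨⟨germ'_mem_CPstar hβ, ?_⟩, fun h1 => ?_⟩
  · obtain ⟨c, hc, hle⟩ := exists_isMaxConjOrder hα hβ
    refine ⟨c, ⟨α, hα, β, hβ, Or.inr (Or.inl ⟨hα1, hβ1, rfl, rfl, hc⟩)⟩, ?_⟩
    rw [orderTop_sub_comm] at h
    exact h.trans hle
  · obtain ⟨-, c, hc, hle⟩ := h1
    rcases hasContact_germ'_cases hα hα1 hc with ⟨β', hβ', -, h2, h3⟩ | ⟨h2, -⟩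
    · obtain ⟨k, rfl⟩ := exists_eq_conj_of_germ_eq hβ hβ' (germ'_injective h2)
      exact h' k (by rwa [orderTop_conj_sub_conj, h3])
    · rw [h2] at hle
      exact absurd (by exact_mod_cast hle : e ≤ 1) (not_le.mpr he)

theorem horn_mono {e e' : ℚ} (h : e' ≤ e) (A : Filter (ℂ × ℂ)) : horn e A ⊆ horn e' A :=
  fun _ ⟨h1, c, h2, h3⟩ => ⟨h1, c, h2, le_trans (by exact_mod_cast h) h3⟩

/-- The order of the gradient is not constant on the horns slightly larger than a tableland. -/
theorem not_isTablelandAt_germ {e₀ : ℚ} (hf : AnalyticAt ℂ f 0) (hα : α ∈ D1) (he₀ : 1 ≤ e₀)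
    (he : e₀ < e) (hconst : ∀ e₁, e₀ < e₁ → e₁ < e → ∃ r : ℚ, ∀ β ∈ D1,
      (e₁ : WithTop ℚ) ≤ (β - α).orderTop → gradOrder f β = r) :
    ¬ IsTablelandAt f e (germ α) := by
  rintro ⟨he1, L, hL, -, h2⟩
  have he' : 1 < e := by linarith
  obtain ⟨e', -, hlt, h3⟩ := h2 he'
  obtain ⟨β, hβ, hle, hLβ⟩ := exists_hasL_of_hasGenericL hα he1 hL
  obtain ⟨e₁, h4, h5⟩ := exists_between (max_lt hlt he)
  obtain ⟨r, hr⟩ := hconst e₁ (lt_of_le_of_lt (le_max_right _ _) h4) h5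
  have he₁ : 1 ≤ e₁ := by have := le_max_right e' e₀; linarith
  refine false_of_gradOrder_const hf hα he₁ h5 hr hβ hle hLβ fun ν hν h6 h7 => h3 _ ?_
  obtain ⟨h8, h9⟩ := mem_horn_germ_diff hα hν he₁ he' h6 h7
  exact ⟨horn_mono (lt_of_le_of_lt (le_max_left _ _) h4).le _ h8, h9⟩

/-- Near `[1:0]` the order of the gradient is constant, so that there is no tableland of order
greater than `1`. -/
theorem not_isTablelandAt_germ' (hm : 0 < m) (hf : IsMiniRegular f m) (hα : α ∈ D1)
    (hα1 : 1 < α.orderTop) (he : 1 < e) : ¬ IsTablelandAt f e (germ' α) := by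
  rintro ⟨he1, L, hL, -, h2⟩
  obtain ⟨e', -, hlt, h3⟩ := h2 he
  obtain ⟨β, hβ, hle, hLβ⟩ := exists_hasL_of_hasGenericL' hα hα1 he1 hL
  obtain ⟨e₁, h4, h5⟩ := exists_between (max_lt hlt he)
  have he₁ : 1 < e₁ := lt_of_le_of_lt (le_max_right _ _) h4
  have horder : ∀ ν : HahnSeries ℚ ℂ, (e₁ : WithTop ℚ) ≤ (ν - α).orderTop → 1 < ν.orderTop := by
    intro ν hν
    have h6 : (1 : WithTop ℚ) < (ν - α).orderTop :=
      lt_of_lt_of_le (by exact_mod_cast he₁) hν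
    have h7 := HahnSeries.min_orderTop_le_orderTop_add (x := ν - α) (y := α)
    rw [sub_add_cancel] at h7
    exact lt_of_lt_of_le (lt_min h6 hα1) h7
  obtain ⟨p, hp, hgrad⟩ := exists_curvature_swap hm hf
  refine false_of_gradOrder_const (analyticAt_comp_swap hf.1) hα he₁.le h5 (r := m - 1)
    (fun ν hν h6 => (hgrad ν hν (by rwa [coeff_one_eq_zero (horder ν h6)])).1) hβ hle
    ((hasL_germ'_iff hβ).mp hLβ) fun ν hν h6 h7 => ?_
  obtain ⟨h8, h9⟩ := mem_horn_germ'_diff hα hα1 hν (horder ν h6) he h6 h7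
  obtain ⟨L', hL', hlt'⟩ := h3 _ ⟨horn_mono (lt_of_le_of_lt (le_max_left _ _) h4).le _ h8, h9⟩
  exact ⟨L', (hasL_germ'_iff hν).mp hL', hlt'⟩

end ConstantGradient

/-! ### Curvature tablelands -/

section Tablelands

variable {f : ℂ × ℂ → ℂ} {m : ℕ} {α β γ : HahnSeries ℚ ℂ} {e d : ℚ} {L : WithTop ℚ}

theorem IsPolar.le_hasL (hm : 0 < m) (hf : IsMiniRegular f m) (hγ : IsPolar f γ)
    (hd : gradDeg f γ = (d : WithTop ℚ)) (hmin : 1 < d ∨ IsMinimal f γ) (hβ : β ∈ D1)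
    (hle : (d : WithTop ℚ) ≤ (β - γ).orderTop) :
    ∃ L, HasL f (germ β) L ∧ ((-2 * d : ℚ) : WithTop ℚ) ≤ L := by
  obtain ⟨R, -, -, h⟩ := hγ.exists_curvature hm hf hd hmin
  obtain ⟨h1, h2⟩ := h β hβ hle
  obtain ⟨L, a, hK⟩ := exists_hasK_germ hf.1 hβ h1
  exact ⟨L, ⟨a, hK⟩, hK.le_of_tendsto h2⟩

/-- Outside of a canyon the order of the curvature is larger: there the order of the gradient is
the order of `f_z`, and `f_z` has no zero nearby. -/
theorem IsPolar.exists_lt_hasL (hm : 0 < m) (hf : IsMiniRegular f m) (hγ : IsPolar f γ)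
    (hd : gradDeg f γ = (d : WithTop ℚ)) (hd1 : 1 < d) :
    ∃ e₀ : ℚ, 1 ≤ e₀ ∧ e₀ < d ∧ ∀ ν ∈ D1, (e₀ : WithTop ℚ) ≤ (ν - γ).orderTop →
      (ν - γ).orderTop < d → ∃ L, HasL f (germ ν) L ∧ ((-2 * d : ℚ) : WithTop ℚ) < L := by
  obtain ⟨-, q₀, hq₀⟩ := hγ.exists_orderAlong hm hf hd
  obtain ⟨φ, q, p, b₀, h⟩ := exists_isNewton hm hf hγ.1 hd1.le
  obtain ⟨e₀, he₀1, he₀d, hmono⟩ := h.exists_eventually_monomial hm hf hγ.1 hd1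
  refine ⟨e₀, he₀1, he₀d, fun ν hν hle hlt => ?_⟩
  obtain ⟨e₁, he₁⟩ := WithTop.ne_top_iff_exists.mp hlt.ne_top
  have hu : (ν - γ).coeff e₁ ≠ 0 := HahnSeries.coeff_orderTop_ne he₁.symm
  have hle₁ : (e₁ : WithTop ℚ) ≤ (ν - γ).orderTop := he₁.le
  rw [← he₁, WithTop.coe_le_coe] at hle
  rw [← he₁, WithTop.coe_lt_coe] at hlt
  have he₁1 : 1 ≤ e₁ := he₀1.trans hle
  obtain ⟨φ₁, q₁, p₁, b₁, h₁⟩ := exists_isNewton hm hf hγ.1 he₁1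
  have hφ₁ := fun h2 => not_le.mpr hlt ((hγ.gradDeg_le_iff hm hf hd hq₀ he₁1 h₁).mpr h2)
  have hq₁ : q₁ = φ₁ := h₁.eq_or.resolve_right fun hb => by
    rw [h₁.b₀_ne_zero_iff, hq₀, WithTop.coe_inj] at hb
    have := h₁.le_φ
    exact hφ₁ (by linarith)
  have hk1 : 1 ≤ p.natDegree := by
    refine (h.exists_order (k := p.natDegree) ?_).1
    rw [Polynomial.coeff_natDegree, Polynomial.leadingCoeff_ne_zero]
    exact h.ne_zero
  obtain ⟨L, a, hK, hL⟩ := (h₁.lead ν hν hle₁).exists_hasK hf.1 hν he₁1 (Or.inl (by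
    rw [if_pos hq₁]
    exact derivative_eval_ne_zero h₁.ne_zero hk1 (hmono e₁ hle hlt φ₁ q₁ p₁ b₁ h₁) (Or.inl hu)))
  refine ⟨L, ⟨a, hK⟩, lt_of_lt_of_le ?_ hL⟩
  exact_mod_cast (by linarith : -2 * d < -2 * e₁)

/-- A minimal canyon is a tableland: its generic value is `-2 d`, which is the least one on the
canyon and which is exceeded just outside of it. -/
theorem IsPolar.isTablelandAt (hm : 0 < m) (hf : IsMiniRegular f m) (hγ : IsPolar f γ)
    (hd : gradDeg f γ = (d : WithTop ℚ)) (hmin : IsMinimal f γ) :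
    IsTablelandAt f d (germ γ) := by
  have hd1 := (hγ.exists_orderAlong hm hf hd).1
  refine ⟨hd1, ((-2 * d : ℚ) : WithTop ℚ),
    ⟨γ, hγ.1, Or.inl ⟨rfl, hγ.eventually_hasL hm hf hd (Or.inr hmin)⟩⟩, fun B hB => ?_,
    fun hd1' => ?_⟩
  · rcases (mem_horn_germ_iff hd1 hγ.1).mp hB with ⟨β, hβ, rfl, hle⟩ | ⟨rfl, β, hβ, hβ1, rfl⟩
    · rw [orderTop_sub_comm] at hle
      exact hγ.le_hasL hm hf hd (Or.inr hmin) hβ hle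
    · simpa using exists_hasL_germ' hm hf hβ hβ1
  · obtain ⟨e₀, he₀1, he₀d, h⟩ := hγ.exists_lt_hasL hm hf hd hd1'
    refine ⟨e₀, he₀1, he₀d, fun B hB => ?_⟩
    obtain ⟨hB1, hB2⟩ := hB
    rcases (mem_horn_germ_iff he₀1 hγ.1).mp hB1 with ⟨ν, hν, rfl, hle⟩ | ⟨-, ν, hν, hν1, rfl⟩
    · refine h ν hν (orderTop_sub_comm ν γ ▸ hle) (not_le.mp fun hle' => hB2 ?_)
      exact (mem_horn_germ_iff hd1 hγ.1).mpr (Or.inl ⟨ν, hν, rfl, orderTop_sub_comm γ ν ▸ hle'⟩)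
    · obtain ⟨L, hL, hle⟩ := exists_hasL_germ' hm hf hν hν1
      refine ⟨L, hL, lt_of_lt_of_le ?_ hle⟩
      exact_mod_cast (by linarith : -2 * d < -2)

theorem HasGenericL.center {A : Filter (ℂ × ℂ)} (h : HasGenericL f e A L) :
    (∃ α ∈ D1, A = germ α) ∨ ∃ α ∈ D1, 1 < α.orderTop ∧ A = germ' α := by
  obtain ⟨α, hα, ⟨h1, -⟩ | ⟨h1, h2, -⟩⟩ := h
  · exact Or.inl ⟨α, hα, h1⟩
  · exact Or.inr ⟨α, hα, h1, h2⟩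

/-- The scaling by `y ^ e` bounds the generic order of the curvature on a horn of order `e`. -/
theorem HasGenericL.le_of_germ (hm : 0 < m) (hf : IsMiniRegular f m) (he : 1 ≤ e) (hα : α ∈ D1)
    (h : HasGenericL f e (germ α) L) : ((-2 * e : ℚ) : WithTop ℚ) ≤ L := by
  obtain ⟨α', hα', ⟨-, h2⟩ | ⟨h1, h2, -⟩⟩ := h
  · obtain ⟨u, h3, L', a, h4, h5⟩ := (h2.and (eventually_exists_hasK hm hf hα' he)).exists
    rwa [h3.unique ⟨a, h4⟩]
  · exact absurd h2 (germ_ne_germ' hα hα' h1)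

theorem HasGenericL.neg_two_le {A : Filter (ℂ × ℂ)} (hm : 0 < m) (hf : IsMiniRegular f m)
    (h : HasGenericL f 1 A L) : ((-2 : ℚ) : WithTop ℚ) ≤ L := by
  have h0 := h
  obtain ⟨α, hα, ⟨rfl, -⟩ | ⟨h1, -, h2⟩⟩ := h
  · simpa using h0.le_of_germ hm hf le_rfl hα
  · obtain ⟨p, hp, hswap⟩ := exists_curvature_swap hm hf
    obtain ⟨u, h3, h4⟩ :=
      (h2.and (eventually_eval_ne_zero (p := p) fun h => hp (by simp [h]))).exists
    obtain ⟨-, L', h5, h6⟩ := hswap _ (add_term_mem_D1 hα le_rfl u) (by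
      rw [HahnSeries.coeff_add, coeff_one_eq_zero h1, term, HahnSeries.coeff_single_same, zero_add]
      exact h4)
    rwa [h3.unique h5]

theorem IsPolar.exists_gradDeg_of_hasL (hm : 0 < m) (hf : IsMiniRegular f m) (hγ : IsPolar f γ)
    (h : HasL f (germ γ) L) : ∃ d : ℚ, gradDeg f γ = d := by
  obtain ⟨r, hr⟩ := WithTop.ne_top_iff_exists.mp
    (hγ.orderAlong_ne_top hm hf (gradOrder_ne_top_of_hasL hf.1 hγ.1 h))
  exact hγ.exists_gradDeg hm hf (q₀ := r - 1) (by rw [← hr, sub_add_cancel])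

theorem IsNewton.exists_root_derivative {φ q b₀} {p : Polynomial ℂ} (h : IsNewton f γ e φ q p b₀)
    (hp : p.natDegree ≠ 1) : ∃ u, p.derivative.eval u = 0 := by
  obtain ⟨k, hk⟩ := h.exists_coeff_ne_zero
  have hk1 := (h.exists_order hk).1
  have hdeg : p.derivative.degree ≠ 0 := fun h2 => by
    have h3 : p.derivative.natDegree = 0 := Polynomial.natDegree_eq_of_degree_eq_some h2
    rw [Polynomial.natDegree_derivative] at h3
    have := Polynomial.le_natDegree_of_ne_zero hk
    omega
  exact IsAlgClosed.exists_root _ hdeg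

/-- A tableland of order `e > 1` contains a polar of gradient degree `e`. -/
theorem exists_polar_of_isTablelandAt (hm : 0 < m) (hf : IsMiniRegular f m) (hα : α ∈ D1)
    (he : 1 < e) (h : IsTablelandAt f e (germ α)) : ∃ γ, IsPolar f γ ∧
      gradDeg f γ = (e : WithTop ℚ) ∧ (e : WithTop ℚ) ≤ (γ - α).orderTop := by
  have h0 := h
  obtain ⟨-, L, hL, h1, -⟩ := h
  obtain ⟨φ, q, p, b₀, hN⟩ := exists_isNewton hm hf hα he.le
  have hdeg : p.natDegree ≠ 1 := fun h2 => by
    obtain ⟨e₀, h3, h4, h5⟩ := hN.exists_gradOrder_const hm hf hα he h2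
    exact not_isTablelandAt_germ hf.1 hα h3 h4 h5 h0
  obtain ⟨u, hu⟩ := hN.exists_root_derivative hdeg
  obtain ⟨γ, hγ, hle, -⟩ := hN.exists_polar u hu
  have hle' : (e : WithTop ℚ) ≤ (α - γ).orderTop := orderTop_sub_comm γ α ▸ hle
  obtain ⟨L₁, hL₁, -⟩ := h1 _ ((mem_horn_germ_iff he.le hα).mpr (Or.inl ⟨γ, hγ.1, rfl, hle'⟩))
  obtain ⟨d, hd⟩ := hγ.exists_gradDeg_of_hasL hm hf hL₁
  obtain ⟨hd1, q₀, hq₀⟩ := hγ.exists_orderAlong hm hf hd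
  refine ⟨γ, hγ, ?_, hle⟩
  rw [hd, WithTop.coe_inj]
  -- If `d < e`, then the gradient has constant order between `d` and `e`.  If `d > e`, then the
  -- curvature has the order `-2 d < -2 e` somewhere in the horn.
  rcases lt_trichotomy d e with hde | hde | hde
  · refine absurd h0 (not_isTablelandAt_germ hf.1 hα hd1 hde fun e₁ h2 h3 =>
      ⟨q₀, fun β hβ h4 => hγ.gradOrder_const hm hf hd hq₀ h2 hβ (le_orderTop_sub_trans h4 ?_)⟩)
    exact le_trans (by exact_mod_cast h3.le) hle'
  · exact hde
  · obtain ⟨u, hu⟩ := (hγ.eventually_hasL hm hf hd (Or.inl (he.trans hde))).exists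
    have hmem := add_term_mem_D1 hγ.1 hd1 u
    have h2 : (e : WithTop ℚ) ≤ (α - (γ + term u d)).orderTop := by
      rw [orderTop_sub_comm]
      exact le_orderTop_sub_trans (le_trans (by exact_mod_cast hde.le)
        (le_orderTop_add_term_sub γ u d)) hle
    obtain ⟨L₂, hL₂, h3⟩ := h1 _ ((mem_horn_germ_iff he.le hα).mpr (Or.inl ⟨_, hmem, rfl, h2⟩))
    rw [hL₂.unique hu] at h3
    have h4 := (hL.le_of_germ hm hf he.le hα).trans h3
    rw [WithTop.coe_le_coe] at h4
    linarith

/-- The initial form of `f` has degree `m ≥ 2` in `z`, so that its derivative has a root, which is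
the initial coefficient of a polar. -/
theorem exists_polar (hm : 2 ≤ m) (hf : IsMiniRegular f m) : ∃ γ, IsPolar f γ := by
  have hm0 : 0 < m := by omega
  have hmz := hf.orderAlong_iterate_dz zero_mem_D1
  obtain ⟨φ, q, p, b₀, h⟩ := exists_isNewton hm0 hf zero_mem_D1 (le_refl (1 : ℚ))
  have h1 := h.le_add hm0 hmz
  -- The generic order of `f` along lines is at least `m`, which forces the degree of `p` to be at
  -- least `m`.
  have hq : (m : ℚ) ≤ q + 1 := by
    rcases h.eq_or with hq | hb
    · have hp : Polynomial.C b₀ + p ≠ 0 := fun h0 => by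
        have := congrArg Polynomial.derivative h0
        simp only [Polynomial.derivative_add, Polynomial.derivative_C, zero_add,
          Polynomial.derivative_zero] at this
        exact derivative_ne_zero h.ne_zero h.coeff_zero this
      obtain ⟨u, hu⟩ := (eventually_eval_ne_zero hp).exists
      have hmem := add_term_mem_D1 zero_mem_D1 (le_refl (1 : ℚ)) u
      have h2 := (h.lead _ hmem (le_orderTop_add_term_sub 0 u 1)).orderAlong hf.1 hmem
      rw [coeff_add_term_sub] at h2
      have h3 := hf.le_orderAlong hmem
      rw [h2.2.mp (by simpa [hq] using hu), WithTop.coe_le_coe] at h3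
      exact h3
    · have h3 := hf.le_orderAlong zero_mem_D1
      rwa [h.b₀_ne_zero_iff.mp hb, WithTop.coe_le_coe] at h3
  have h2 := h.le_φ
  have h3 := Polynomial.le_natDegree_of_ne_zero (h.coeff_ne_zero hm0 hmz (by linarith))
  obtain ⟨u, hu⟩ := h.exists_root_derivative (by omega)
  obtain ⟨γ, hγ, -⟩ := h.exists_polar u hu
  exact ⟨γ, hγ⟩

/-- If all of `D1` is a tableland, then every polar has gradient degree `1`, as the curvature
would have an order less than `-2` in a canyon of a larger degree. -/
theorem gradDeg_eq_one_of_isTablelandAt {A : Filter (ℂ × ℂ)} (hm : 0 < m) (hf : IsMiniRegular f m)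
    (h : IsTablelandAt f 1 A) (hγ : IsPolar f γ) : gradDeg f γ = ((1 : ℚ) : WithTop ℚ) := by
  obtain ⟨-, L, hL, h1, -⟩ := h
  have hhorn : ∀ β ∈ D1, germ β ∈ horn ((1 : ℚ) : WithTop ℚ) A := fun β hβ =>
    (mem_horn_one_iff hL.center).mpr (Or.inl ⟨β, hβ, rfl⟩)
  obtain ⟨L₁, hL₁, -⟩ := h1 _ (hhorn γ hγ.1)
  obtain ⟨d, hd⟩ := hγ.exists_gradDeg_of_hasL hm hf hL₁
  have hd1 := (hγ.exists_orderAlong hm hf hd).1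
  rcases hd1.eq_or_lt with rfl | hd1'
  · exact hd
  · obtain ⟨u, hu⟩ := (hγ.eventually_hasL hm hf hd (Or.inl hd1')).exists
    obtain ⟨L₂, hL₂, h3⟩ := h1 _ (hhorn _ (add_term_mem_D1 hγ.1 hd1 u))
    rw [hL₂.unique hu] at h3
    have h4 := (hL.neg_two_le hm hf).trans h3
    rw [WithTop.coe_le_coe] at h4
    linarith

theorem isMinimal_of_gradDeg_eq_one
    (h : ∀ γ, IsPolar f γ → gradDeg f γ = ((1 : ℚ) : WithTop ℚ))
    (γ : HahnSeries ℚ ℂ) : IsMinimal f γ := fun γ' hγ' hsub => hsub.antisymm fun α hα =>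
  ⟨hα.1, by rw [h γ' hγ']; exact one_le_orderTop_sub hα.1 hγ'.1⟩

/-- Every curvature tableland is a minimal canyon, and `γ` can be chosen close to a given member. -/
theorem exists_canyon_of_isTablelandAt {A : Filter (ℂ × ℂ)} (hm : 2 ≤ m) (hf : IsMiniRegular f m)
    (h : IsTablelandAt f e A) (hβ : β ∈ D1) (hβA : germ β ∈ horn e A) :
    ∃ γ, IsPolar f γ ∧ gradDeg f γ = (e : WithTop ℚ) ∧ IsMinimal f γ ∧
      (e : WithTop ℚ) ≤ (β - γ).orderTop ∧ horn e A = horn e (germ γ) := by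
  have hm0 : 0 < m := by omega
  have he := h.1
  obtain ⟨-, L, hL, -⟩ := id h
  rcases he.eq_or_lt with rfl | he1
  · obtain ⟨γ, hγ⟩ := exists_polar hm hf
    have hdeg : ∀ γ, IsPolar f γ → gradDeg f γ = ((1 : ℚ) : WithTop ℚ) := fun _ =>
      gradDeg_eq_one_of_isTablelandAt hm0 hf h
    refine ⟨γ, hγ, hdeg γ hγ, isMinimal_of_gradDeg_eq_one hdeg γ, one_le_orderTop_sub hβ hγ.1, ?_⟩
    ext B
    rw [mem_horn_one_iff hL.center, mem_horn_one_iff (Or.inl ⟨γ, hγ.1, rfl⟩)]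
  · rcases hL.center with ⟨α, hα, rfl⟩ | ⟨α, hα, hα1, rfl⟩
    swap
    · exact absurd h (not_isTablelandAt_germ' hm0 hf hα hα1 he1)
    rcases (mem_horn_germ_iff he hα).mp hβA with ⟨β', hβ', h1, h2⟩ | ⟨h1, -⟩
    swap
    · exact absurd h1 he1.ne'
    -- Replace the coordinate `α` by the conjugate which is close to `β`.
    obtain ⟨k, rfl⟩ := exists_eq_conj_of_germ_eq hβ hβ' h1
    have hα' := conj_mem_D1 hα k
    rw [← germ_conj hα k] at h ⊢
    obtain ⟨γ, hγ, hd, hle⟩ := exists_polar_of_isTablelandAt hm0 hf hα' he1 h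
    rw [orderTop_sub_comm] at hle
    refine ⟨γ, hγ, hd, isMinimal_of_one_lt hm0 hf hγ hd he1, ?_, horn_germ_eq he hα' hγ.1 hle⟩
    refine le_orderTop_sub_trans ?_ hle
    rwa [orderTop_conj_sub_conj, orderTop_sub_comm]

/-- Minimal canyons of finite gradient degree are exactly the curvature tablelands. -/
theorem isTableland_iff (hm : 2 ≤ m) (hf : IsMiniRegular f m) (S : Set (Filter (ℂ × ℂ))) :
    IsTableland f S ↔
      ∃ γ, IsPolar f γ ∧ gradDeg f γ ≠ ⊤ ∧ IsMinimal f γ ∧ S = canyonStar f γ := by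
  have hm0 : 0 < m := by omega
  constructor
  · rintro ⟨e, A, rfl, h⟩
    obtain ⟨β, hβ, hβA⟩ : ∃ β ∈ D1, germ β ∈ horn e A := by
      obtain ⟨he, L, hL, -⟩ := id h
      rcases he.eq_or_lt with rfl | he1
      · exact ⟨0, zero_mem_D1, (mem_horn_one_iff hL.center).mpr (Or.inl ⟨0, zero_mem_D1, rfl⟩)⟩
      · rcases hL.center with ⟨α, hα, rfl⟩ | ⟨α, hα, hα1, rfl⟩
        · refine ⟨α, hα, (mem_horn_germ_iff he hα).mpr (Or.inl ⟨α, hα, rfl, ?_⟩)⟩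
          rw [sub_self, HahnSeries.orderTop_zero]
          exact le_top
        · exact absurd h (not_isTablelandAt_germ' hm0 hf hα hα1 he1)
    obtain ⟨γ, hγ, hd, hmin, -, hS⟩ := exists_canyon_of_isTablelandAt hm hf h hβ hβA
    exact ⟨γ, hγ, by rw [hd]; exact WithTop.coe_ne_top, hmin, by rw [hS, canyonStar, hd]⟩
  · rintro ⟨γ, hγ, hd, hmin, rfl⟩
    obtain ⟨d, hd⟩ := WithTop.ne_top_iff_exists.mp hd
    exact ⟨d, germ γ, by rw [canyonStar, hd], hγ.isTablelandAt hm0 hf hd.symm hmin⟩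

end Tablelands

/-! ### A'Campo bumps -/

section Bumps

variable {f : ℂ × ℂ → ℂ} {m : ℕ} {β γ : HahnSeries ℚ ℂ} {e d L : ℚ} {R R' : ℂ → ℝ} {a : ℝ}

theorem tendsto_arc_iff (hβ : β ∈ D1) (L : ℚ) (a : ℝ) :
    Tendsto (fun t : ℂ => K f (arc β t) / (2 * arcLength (arc β) t ^ (2 * (L : ℝ)))) (𝓝[≠] 0)
      (𝓝 a) ↔
    Tendsto (fun p => K f p / nrm p ^ ((2 * L : ℚ) : ℝ)) (punct (germ β)) (𝓝 (2 * a)) := by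
  rw [germ, ← (isArc_arc hβ).map_eq_punct, tendsto_map'_iff]
  refine Iff.trans ?_ (tendsto_div_arcLength_iff (isArc_arc hβ) (K f) _ (2 * a))
  push_cast
  constructor
  · intro h
    refine (h.const_mul 2).congr fun t => ?_
    rw [mul_comm (2 : ℝ) (_ ^ _), ← div_div, mul_div_cancel₀ _ two_ne_zero]
  · intro h
    refine (by simpa using h.div_const 2 :
      Tendsto _ _ (𝓝 a)).congr fun t => ?_
    rw [mul_comm (2 : ℝ) (_ ^ _), ← div_div]

theorem isR_iff (hγ : γ ∈ D1) (hd : 1 ≤ d) : IsR f γ d L R ↔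
    (∀ u, Tendsto (fun p => K f p / nrm p ^ ((2 * L : ℚ) : ℝ)) (punct (germ (γ + term u d)))
      (𝓝 (2 * R u))) ∧ ∃ u, R u ≠ 0 :=
  and_congr_left fun _ => forall_congr' fun u => tendsto_arc_iff (add_term_mem_D1 hγ hd u) L (R u)

theorem HornLimit.tendsto (h : HornLimit f γ d R) (hγ : γ ∈ D1) (hd : 1 ≤ d) (u : ℂ) :
    (∀ᶠ p in punct (germ (γ + term u d)), dz f p ≠ 0 ∨ dw f p ≠ 0) ∧
    Tendsto (fun p => K f p / nrm p ^ ((-2 * d : ℚ) : ℝ)) (punct (germ (γ + term u d)))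
      (𝓝 (2 * R u)) := by
  have := h.2.2 _ (add_term_mem_D1 hγ hd u) (le_orderTop_add_term_sub γ u d)
  rwa [coeff_add_term_sub] at this

theorem HornLimit.exists_ne (h : HornLimit f γ d R) : ∃ u, R u ≠ 0 := by
  obtain ⟨u, hu⟩ := h.1.infinite_compl.nonempty
  exact ⟨u, hu⟩

theorem HornLimit.isR (h : HornLimit f γ d R) (hγ : γ ∈ D1) (hd : 1 ≤ d) : IsR f γ d (-d) R := by
  refine (isR_iff hγ hd).mpr ⟨fun u => ?_, h.exists_ne⟩
  have := (h.tendsto hγ hd u).2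
  rwa [show -2 * d = 2 * -d by ring] at this

/-- The exponent and the function in the definition of `R_γ` are unique, as neither limit vanishes
identically. -/
theorem HornLimit.eq_of_isR (h : HornLimit f γ d R) (hγ : γ ∈ D1) (hd : 1 ≤ d)
    (h' : IsR f γ d L R') : R' = R := by
  obtain ⟨h1, u', hu'⟩ := (isR_iff hγ hd).mp h'
  have hmem := add_term_mem_D1 hγ hd
  have hne := fun u => neBot_punct (germ_mem_CPstar (hmem u))
  have hpos : 0 < 2 * R' u' := by
    refine lt_of_le_of_ne ?_ (mul_ne_zero two_ne_zero hu').symm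
    have := hne u'
    refine ge_of_tendsto (h1 u') (Eventually.of_forall fun p => ?_)
    have := nrm_nonneg p
    rw [K]
    positivity
  have h2 := (hasK_of_tendsto (hmem u') hpos ⟨(h.tendsto hγ hd u').1, h1 u'⟩).le_of_tendsto
    (h.tendsto hγ hd u').2
  obtain ⟨u, hu⟩ := h.exists_ne
  have hpos' : 0 < 2 * R u := mul_pos two_pos (lt_of_le_of_ne (h.2.1 u) hu.symm)
  have h3 := (hasK_of_tendsto (hmem u) hpos' (h.tendsto hγ hd u)).le_of_tendsto (h1 u)
  rw [WithTop.coe_le_coe] at h2 h3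
  have hL : 2 * L = -2 * d := le_antisymm h3 h2
  funext v
  have := hne v
  have h4 := tendsto_nhds_unique (h1 v) (hL ▸ (h.tendsto hγ hd v).2)
  linarith

theorem symb_le_iff {L L' : WithTop ℚ} {a a' : ℝ} :
    symb L' a' ≤ symb L a ↔ L < L' ∨ L = L' ∧ a' ≤ a := by
  rw [symb, symb, Prod.Lex.toLex_le_toLex]
  simp [eq_comm]

/-- At a local maximum `c` of `R`, the symbol `2 R (c) δ ^ (- 2 d)` is the largest one nearby. -/
theorem HornLimit.isBump (h : HornLimit f γ d R) (hf : AnalyticAt ℂ f 0) (hγ : γ ∈ D1)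
    (htab : IsTablelandAt f d (germ γ)) {c : ℂ} (hc : IsLocalMax R c) :
    IsBump f (hornPlus (d : WithTop ℚ) (germ (γ + term c d))) := by
  have hd := htab.1
  have hmem := add_term_mem_D1 hγ hd c
  obtain ⟨ε, hε, hball⟩ := Metric.eventually_nhds_iff.mp hc
  -- The local maximum is positive, since `R` has only finitely many zeros.
  have hpos : 0 < R c := by
    refine lt_of_le_of_ne (h.2.1 c) fun h0 => ?_
    have hsub : Metric.ball c ε ⊆ {u | R u = 0} := fun u hu =>
      le_antisymm (h0 ▸ hball (Metric.mem_ball.mp hu)) (h.2.1 u)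
    exact (infinite_of_mem_nhds c (Metric.ball_mem_nhds c hε)) (h.1.subset hsub)
  refine ⟨d, germ γ, htab, γ + term c d, hmem, ?_, rfl, ε / 2, by positivity, ?_⟩
  · refine (mem_horn_germ_iff hd hγ).mpr (Or.inl ⟨_, hmem, rfl, ?_⟩)
    rw [orderTop_sub_comm]
    exact le_orderTop_add_term_sub γ c d
  · rintro _ ⟨μ, hμ, rfl, c', hc', hlt⟩
    have hle : (d : WithTop ℚ) ≤ (μ - γ).orderTop := by
      have h1 : (d : WithTop ℚ) ≤ (μ - (γ + term c d)).orderTop := by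
        have := HahnSeries.min_orderTop_le_orderTop_add (x := μ - (γ + term c d) - term c' d)
          (y := term c' d)
        rw [sub_add_cancel] at this
        exact (le_min hlt.le (le_orderTop_term c' d)).trans this
      exact le_orderTop_sub_trans h1 (le_orderTop_add_term_sub γ c d)
    have hcoeff : (μ - γ).coeff d = c + c' := by
      have := HahnSeries.coeff_eq_zero_of_lt_orderTop hlt
      simp only [HahnSeries.coeff_sub, HahnSeries.coeff_add, term, HahnSeries.coeff_single_same]
        at this
      rw [HahnSeries.coeff_sub]
      linear_combination this
    have h1 := h.2.2 μ hμ hle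
    rw [hcoeff] at h1
    have hle' : R (c + c') ≤ R c := hball (by
      rw [dist_eq_norm, add_sub_cancel_left]
      linarith)
    have hK := hasK_of_tendsto hmem (mul_pos two_pos hpos) (h.tendsto hγ hd c)
    rcases (h.2.1 (c + c')).eq_or_lt with h0 | h0
    · obtain ⟨L', a', hK'⟩ := exists_hasK_germ hf hμ h1.1
      refine ⟨_, _, L', a', hK, hK', symb_le_iff.mpr (Or.inl (hK'.lt_of_tendsto_zero ?_))⟩
      rw [← h0, mul_zero] at h1
      exact h1.2
    · refine ⟨_, _, _, _, hK, hasK_of_tendsto hμ (mul_pos two_pos h0) h1,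
        symb_le_iff.mpr (Or.inr ⟨rfl, ?_⟩)⟩
      linarith

/-- A germ in the canyon with locally maximal curvature belongs to a local maximum of `R`. -/
theorem HornLimit.isLocalMax (h : HornLimit f γ d R) (hd : 1 ≤ d) (hβ : β ∈ D1)
    (hle : (d : WithTop ℚ) ≤ (β - γ).orderTop) {ε : ℝ} (hε : 0 < ε)
    (hmax : ∀ M ∈ hornInterval d β ε, ∃ L a L' a',
      HasK f (germ β) L a ∧ HasK f M L' a' ∧ symb L' a' ≤ symb L a) :
    IsLocalMax R ((β - γ).coeff d) := by
  refine Metric.eventually_nhds_iff.mpr ⟨ε, hε, fun u hu => ?_⟩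
  set c := (β - γ).coeff d with hc
  -- Where `R` vanishes nothing is to be shown; elsewhere the symbol at `u` is
  -- `2 R (u) δ ^ (- 2 d)`.
  rcases (h.2.1 u).eq_or_lt with h0 | h0
  · exact h0 ▸ h.2.1 c
  have hmem := add_term_mem_D1 hβ hd (u - c)
  obtain ⟨L, a, L', a', hK, hK', hs⟩ := hmax (germ (β + term (u - c) d)) ⟨_, hmem, rfl, u - c,
    by rw [← dist_eq_norm]; exact hu.le, by
      rw [add_sub_cancel_left, sub_self, HahnSeries.orderTop_zero]
      exact WithTop.coe_lt_top d⟩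
  have h1 := h.2.2 _ hmem (le_orderTop_sub_trans (le_orderTop_add_term_sub β (u - c) d) hle)
  have hcoeff : (β + term (u - c) d - γ).coeff d = u := by
    rw [add_sub_right_comm, HahnSeries.coeff_add, ← hc, term, HahnSeries.coeff_single_same]
    ring
  rw [hcoeff] at h1
  obtain ⟨rfl, rfl⟩ := (hasK_of_tendsto hmem (mul_pos two_pos h0) h1).unique hK'
  have h2 := h.2.2 β hβ hle
  rw [← hc] at h2
  have hle2 := hK.le_of_tendsto h2.2
  rcases symb_le_iff.mp hs with hlt | ⟨rfl, ha⟩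
  · exact absurd hle2 (not_le.mpr hlt)
  · rcases (h.2.1 c).eq_or_lt with h3 | h3
    · rw [← h3, mul_zero] at h2
      exact absurd (hK.lt_of_tendsto_zero h2.2) (lt_irrefl _)
    · rw [← (hasK_of_tendsto hβ (mul_pos two_pos h3) h2).unique hK |>.2] at ha
      linarith

theorem lt_orderTop_sub_term (hle : (d : WithTop ℚ) ≤ (β - γ).orderTop) :
    (d : WithTop ℚ) < (β - (γ + term ((β - γ).coeff d) d)).orderTop := by
  rw [← sub_sub]
  have h1 : (d : WithTop ℚ) ≤ (β - γ - term ((β - γ).coeff d) d).orderTop := by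
    have := HahnSeries.min_orderTop_le_orderTop_sub (x := β - γ) (y := term ((β - γ).coeff d) d)
    exact (le_min hle (le_orderTop_term _ d)).trans this
  refine lt_of_le_of_ne h1 fun h2 => HahnSeries.coeff_orderTop_ne h2.symm ?_
  rw [HahnSeries.coeff_sub (x := β - γ), term, HahnSeries.coeff_single_same, sub_self]

end Bumps

end ACampo

theorem theoremA (f : ℂ × ℂ → ℂ) (m : ℕ) (hm : 2 ≤ m) (hf : IsMiniRegular f m) :
    -- the minimal canyons of finite gradient degree are exactly the curvature tablelands
    (∀ S : Set (Filter (ℂ × ℂ)), IsTableland f S ↔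
      ∃ γ, IsPolar f γ ∧ gradDeg f γ ≠ ⊤ ∧ IsMinimal f γ ∧ S = canyonStar f γ) ∧
    -- local maxima of `R_γ` give A'Campo bumps
    (∀ (γ : HahnSeries ℚ ℂ) (d : ℚ),
      IsPolar f γ → gradDeg f γ = (d : WithTop ℚ) → IsMinimal f γ →
        (∃ L R, IsR f γ d L R) ∧
        ∀ L R, IsR f γ d L R → ∀ c : ℂ, IsLocalMax R c →
          IsBump f (hornPlus (d : WithTop ℚ) (germ (γ + term c d)))) ∧
    -- every A'Campo bump arises in this way
    (∀ S : Set (Filter (ℂ × ℂ)), IsBump f S →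
      ∃ (γ : HahnSeries ℚ ℂ) (d L : ℚ) (R : ℂ → ℝ) (c : ℂ),
        IsPolar f γ ∧ gradDeg f γ = (d : WithTop ℚ) ∧ IsMinimal f γ ∧
        IsR f γ d L R ∧ IsLocalMax R c ∧
        S = hornPlus (d : WithTop ℚ) (germ (γ + term c d))) := by
  have hm0 : 0 < m := by omega
  refine ⟨isTableland_iff hm hf, fun γ d hγ hd hmin => ?_, ?_⟩
  · have hd1 := (hγ.exists_orderAlong hm0 hf hd).1
    obtain ⟨R, h⟩ := hγ.exists_curvature hm0 hf hd (Or.inr hmin)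
    refine ⟨⟨-d, R, h.isR hγ.1 hd1⟩, fun L R' hR' c hc => ?_⟩
    rw [h.eq_of_isR hγ.1 hd1 hR'] at hc
    exact h.isBump hf.1 hγ.1 (hγ.isTablelandAt hm0 hf hd hmin) hc
  · rintro _ ⟨e, A, htab, β, hβ, hβA, rfl, ε, hε, hmax⟩
    obtain ⟨γ, hγ, hd, hmin, hle, -⟩ := exists_canyon_of_isTablelandAt hm hf htab hβ hβA
    obtain ⟨R, h⟩ := hγ.exists_curvature hm0 hf hd (Or.inr hmin)
    exact ⟨γ, e, -e, R, (β - γ).coeff e, hγ, hd, hmin, h.isR hγ.1 htab.1,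
      h.isLocalMax htab.1 hβ hle hε hmax,
      hornPlus_germ_eq htab.1 hβ (add_term_mem_D1 hγ.1 htab.1 _) (lt_orderTop_sub_term hle)⟩
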